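/- Time is measured in arithmetic operations over $\mathbb R$: a program works on real registers and pays one unit for loading a constant, for $+,-,\times,\div$, for a square root, for a comparison, and for one evaluation of a given function $f:\mathbb R\to\mathbb R$. Let $\omega$ be a matrix multiplication exponent, i.e. two $n\times n$ matrices can be multiplied by arithmetic circuits with $O(n^\omega)$ operations, and let $\alpha$ be the dual exponent, the supremum of all $\beta$ such that an $n\times n$ matrix can be multiplied with an $n\times\lceil n^{\beta}\rceil$ matrix in $O(n^{2+o(1)})$ operations. Let $0\le a\le\alpha$, let $A\in\mathbb R^{d\times n}$ have full rank $d$ with $1\le d\le n$, and let $0<\varepsilon_{mp}<1/4$. Write $U=\operatorname{diag}(u)$, $\tilde U=\operatorname{diag}(\tilde u)$, $f(v)_i=f(v_i)$, and $\log=\log_2$. Consider the following projection maintenance data structure with variables $M,\tilde u,\tilde v,w$. * Initialize$(u,v)$, for $u>0$: set $\tilde u=u$, $\tilde v=v$, $M=A^\top(AUA^\top)^{-1}A$, $w=M\sqrt U f(v)$. * Update$(u^{new},v^{new})$: let $y_i=u^{new}_i/\tilde u_i-1$, let $\pi$ be a permutation sorting the $|y_i|$ in non-increasing order, and let $k$ be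 the number of $i$ with $|y_i|\ge\varepsilon_{mp}$. If $k\ge n^a$: while $1.5k<n$ and $|y_{\pi(\lceil 1.5k\rceil)}|\ge(1-1/\log n)|y_{\pi(k)}|$, replace $k$ by $\lceil1.5k\rceil$. Let $S=\pi(\{1,\dots,k\})$, let $\tilde u^{new}$ equal $u^{new}$ on $S$ and $\tilde u$ elsewhere, and let $\Delta=\operatorname{diag}(\tilde u^{new}-\tilde u)$ and $W=M_S(\Delta_{S,S}^{-1}+M_{S,S})^{-1}M_S^\top$. - If $k\ge n^a$ (rank-update branch): set $M\leftarrow M-W$, $\tilde u\leftarrow\tilde u^{new}$, $\tilde v\leftarrow v^{new}$, $w\leftarrow M\sqrt{\tilde U}f(\tilde v)$, and return $\tilde u,\tilde v,f(\tilde v),\sqrt{\tilde U}w$. - If $k<n^a$ (small-$k$ branch): let $B$ be the set of $i$ violating $(1-\varepsilon_{mp})\tilde v_i\le v^{new}_i\le(1+\varepsilon_{mp})\tilde v_i$. If $|B|\ge n^a$, put $\tilde v^{new}=v^{new}$ and set $w\leftarrow M\sqrt{\tilde U}f(v^{new})$, $\tilde v\leftarrow v^{new}$; otherwise let $\tilde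 v^{new}$ equal $v^{new}$ on $B$ and $\tilde v$ elsewhere and leave the variables unchanged. Return $\tilde u^{new},\tilde v^{new},f(\tilde v^{new}),\sqrt{\tilde U^{new}}(M-W)\sqrt{\tilde U^{new}}f(\tilde v^{new})$ (with the product $M\sqrt{\tilde U^{new}}f(\tilde v^{new})$ in the last case computed as $w+M(\sqrt{\tilde U^{new}}f(\tilde v^{new})-\sqrt{\tilde U}f(\tilde v))$). Then: 1. (Preprocessing.) Initialize can be implemented in $O(n^2d^{\omega-2})$ time. 2. (Updates.) Let $n\ge3$. There is a program, depending only on $n,d,a,\omega$, implementing Update up to the body of the small-$k$ branch, with the following property. Let $C\ge0$ and let $u^{(0)}>0,v^{(0)}$ be the vectors given to Initialize and $(u^{(1)},v^{(1)}),\dots,(u^{(T)},v^{(T)})$ the subsequent updates, such that for all $0\le t<T$ $$\sum_{i=1}^n\Big(\frac{u^{(t+1)}_i-u^{(t)}_i}{u^{(t)}_i}\Big)^2\le C^2,\qquad \Big|\frac{u^{(t+1)}_i-u^{(t)}_i}{u^{(t)}_i}\Big|\le\frac14\ \text{ for all } i.$$ Then, ignoring the calls of Update that take the small-$k$ branch,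 the total time of the $T$ updates is $$O\Big(T\cdot \frac{C}{\varepsilon_{mp}}\big(n^{\omega-1/2}+n^{2-a/2+o(1)}\big)\log n\Big).$$ Each ignored call takes $O(n\log n)$ time before it enters the small-$k$ branch. The constants in $O(\cdot)$ and the $o(1)$ term (as $n\to\infty$) depend only on $\omega$ and $a$. -/

import Mathlib

/-! ### Arithmetic programs

Programs over real registers, in the style of algebraic computation trees.  One instruction
(loading a constant, a field operation, a square root, an evaluation of the given function `f`,
or a comparison) costs one unit of time. -/

/-- The four field operations. -/
inductive ArithOp where
  | add
  | sub
  | mul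
  | div

/-- The value of a field operation. -/
noncomputable def ArithOp.eval : ArithOp → ℝ → ℝ → ℝ
  | .add, x, y => x + y
  | .sub, x, y => x - y
  | .mul, x, y => x * y
  | .div, x, y => x / y

/-- Arithmetic programs whose registers are indexed by `ρ`; `z` is always the target register,
`P` (or `Q`) is the rest of the program. -/
inductive Prog (ρ : Type) where
  | halt : Prog ρ
  | const (z : ρ) (c : ℝ) (P : Prog ρ) : Prog ρ
  | arith (o : ArithOp) (z x y : ρ) (P : Prog ρ) : Prog ρ
  | sqrt (z x : ρ) (P : Prog ρ) : Prog ρ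
  | call (z x : ρ) (P : Prog ρ) : Prog ρ
  | ifLT (x y : ρ) (P Q : Prog ρ) : Prog ρ

open Classical in
/-- The memory `σ` after writing the value `c` into register `z`. -/
noncomputable def writeReg {ρ : Type} (σ : ρ → ℝ) (z : ρ) (c : ℝ) : ρ → ℝ :=
  fun x => if x = z then c else σ x

open Classical in
/-- The memory after running a program on the memory `σ`, where `call` evaluates `f`. -/
noncomputable def Prog.run {ρ : Type} (f : ℝ → ℝ) : Prog ρ → (ρ → ℝ) → (ρ → ℝ)
  | .halt, σ => σ
  | .const z c P, σ => P.run f (writeReg σ z c)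
  | .arith o z x y P, σ => P.run f (writeReg σ z (o.eval (σ x) (σ y)))
  | .sqrt z x P, σ => P.run f (writeReg σ z (Real.sqrt (σ x)))
  | .call z x P, σ => P.run f (writeReg σ z (f (σ x)))
  | .ifLT x y P Q, σ => if σ x < σ y then P.run f σ else Q.run f σ

open Classical in
/-- The number of instructions executed when a program is run on the memory `σ`. -/
noncomputable def Prog.cost {ρ : Type} (f : ℝ → ℝ) : Prog ρ → (ρ → ℝ) → ℕ
  | .halt, _ => 0
  | .const z c P, σ => P.cost f (writeReg σ z c) + 1
  | .arith o z x y P, σ => P.cost f (writeReg σ z (o.eval (σ x) (σ y))) + 1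
  | .sqrt z x P, σ => P.cost f (writeReg σ z (Real.sqrt (σ x))) + 1
  | .call z x P, σ => P.cost f (writeReg σ z (f (σ x))) + 1
  | .ifLT x y P Q, σ => (if σ x < σ y then P.cost f σ else Q.cost f σ) + 1

/-- Arithmetic circuits: straight-line programs with constants, `+`, `-` and `*` only. -/
def Prog.IsCircuit {ρ : Type} : Prog ρ → Prop
  | .halt => True
  | .const _ _ P => P.IsCircuit
  | .arith o _ _ _ P => o ≠ .div ∧ P.IsCircuit
  | .sqrt _ _ _ => False
  | .call _ _ _ => False
  | .ifLT _ _ _ _ => False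

/-! ### Fast matrix multiplication -/

/-- Registers for the product `Z = X * Y` of an `n × m` by an `m × p` matrix, and scratch
registers. -/
inductive MulReg (n m p : ℕ) where
  | X (i : Fin n) (k : Fin m)
  | Y (k : Fin m) (j : Fin p)
  | Z (i : Fin n) (j : Fin p)
  | tmp (l : ℕ)

/-- An `n × m` matrix can be multiplied with an `m × p` matrix in at most `t` arithmetic
operations. -/
def CanMultiply (n m p t : ℕ) : Prop :=
  ∃ P : Prog (MulReg n m p), P.IsCircuit ∧ ∀ σ : MulReg n m p → ℝ,
    P.cost id σ ≤ t ∧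
    ∀ i j, P.run id σ (.Z i j) = ∑ k : Fin m, σ (.X i k) * σ (.Y k j)

/-- Two `n × n` matrices can be multiplied in `O(n ^ ω)` arithmetic operations. -/
def IsMatMulExponent (ω : ℝ) : Prop :=
  ∃ t : ℕ → ℕ, (∀ n, CanMultiply n n n (t n)) ∧
    (fun n : ℕ => (t n : ℝ)) =O[Filter.atTop] (fun n : ℕ => (n : ℝ) ^ ω)

/-- An `n × n` matrix can be multiplied with an `n × n ^ β` matrix in `O(n ^ (2 + o(1)))`
arithmetic operations. -/
def IsDualAdmissible (β : ℝ) : Prop :=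
  ∃ (t : ℕ → ℕ) (η : ℕ → ℝ), (∀ n : ℕ, CanMultiply n n ⌈(n : ℝ) ^ β⌉₊ (t n)) ∧
    Filter.Tendsto η Filter.atTop (nhds 0) ∧
    (fun n : ℕ => (t n : ℝ)) =O[Filter.atTop] (fun n : ℕ => (n : ℝ) ^ (2 + η n))

/-- The dual matrix exponent `α`. -/
noncomputable def dualExponent : ℝ := sSup {β : ℝ | IsDualAdmissible β}

/-! ### The projection maintenance algorithm -/

/-- The variables of the data structure that change: `M`, `ũ`, `ṽ`, `w`. -/
structure DSState (n : ℕ) where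
  M : Matrix (Fin n) (Fin n) ℝ
  ut : Fin n → ℝ
  vt : Fin n → ℝ
  w : Fin n → ℝ

/-- The four vectors that a call of `Update` returns: `ũ`, `ṽ`, `f(ṽ)` and the approximate
projection `r`. -/
structure DSOutput (n : ℕ) where
  u : Fin n → ℝ
  v : Fin n → ℝ
  fv : Fin n → ℝ
  r : Fin n → ℝ

/-- `√U f(v)`, where `U = diag(u)`. -/
noncomputable def sqrtMul {n : ℕ} (f : ℝ → ℝ) (u v : Fin n → ℝ) : Fin n → ℝ :=
  fun i => Real.sqrt (u i) * f (v i)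

/-- `Aᵀ (A U Aᵀ)⁻¹ A`, where `U = diag(u)`. -/
noncomputable def projCore {n d : ℕ} (A : Matrix (Fin d) (Fin n) ℝ) (u : Fin n → ℝ) :
    Matrix (Fin n) (Fin n) ℝ :=
  A.transpose * (A * Matrix.diagonal u * A.transpose)⁻¹ * A

/-- The result of `Initialize`. -/
noncomputable def initState {n d : ℕ} (A : Matrix (Fin d) (Fin n) ℝ) (f : ℝ → ℝ)
    (u v : Fin n → ℝ) : DSState n where
  M := projCore A u
  ut := u
  vt := v
  w := (projCore A u).mulVec (sqrtMul f u v)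

/-- `y_i = u_i^new / ũ_i - 1`. -/
noncomputable def relDev {n : ℕ} (s : DSState n) (un : Fin n → ℝ) : Fin n → ℝ :=
  fun i => un i / s.ut i - 1

open Classical in
/-- The number of indices `i` with `|y_i| ≥ ε`. -/
noncomputable def numLarge {n : ℕ} (ε : ℝ) (y : Fin n → ℝ) : ℕ :=
  (Finset.univ.filter (fun i => ε ≤ |y i|)).card

/-- `|y_{π(k)}|` with positions `k` counted from 1 (and 0 at positions out of range). -/
noncomputable def sortedAbs {n : ℕ} (y : Fin n → ℝ) (π : Equiv.Perm (Fin n)) (k : ℕ) : ℝ :=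
  if h : 1 ≤ k ∧ k ≤ n then |y (π ⟨k - 1, by omega⟩)| else 0

open Classical in
/-- The while-loop: as long as `1.5 k < n` and `z(⌈1.5 k⌉) ≥ (1 - 1 / log n) z(k)`, replace `k` by
`⌈1.5 k⌉ = (3 k + 1) / 2` (which is then at most `n`).  It is only started with `k ≥ 1`. -/
noncomputable def enlarge (n : ℕ) (z : ℕ → ℝ) (k : ℕ) : ℕ :=
  if _h : 1 ≤ k ∧ 3 * k < 2 * n ∧
      (1 - 1 / Real.logb 2 n) * z k ≤ z ((3 * k + 1) / 2) then
    enlarge n z ((3 * k + 1) / 2)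
  else k
termination_by n - k
decreasing_by omega

/-- The call of `Update` takes the branch `k ≥ n ^ a`.  (The while-loop, which runs only if this
holds, does not decrease `k`; so the test has the same outcome before and after it.) -/
def RankBranch {n : ℕ} (a ε : ℝ) (s : DSState n) (un : Fin n → ℝ) : Prop :=
  (n : ℝ) ^ a ≤ (numLarge ε (relDev s un) : ℝ)

open Classical in
/-- The final value of `k`, given the sorting permutation `π`. -/
noncomputable def batchSize {n : ℕ} (a ε : ℝ) (s : DSState n) (un : Fin n → ℝ)
    (π : Equiv.Perm (Fin n)) : ℕ :=
  if RankBranch a ε s un then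
    enlarge n (sortedAbs (relDev s un) π) (numLarge ε (relDev s un))
  else numLarge ε (relDev s un)

/-- `S = π([k])`. -/
def firstIndices {n : ℕ} (π : Equiv.Perm (Fin n)) (k : ℕ) : Finset (Fin n) :=
  Finset.univ.filter (fun i => (π.symm i : ℕ) < k)

/-- The matrix `M_S (Δ_{S,S}⁻¹ + M_{S,S})⁻¹ (M_S)ᵀ` of the Sherman-Morrison-Woodbury identity,
where `Δ = diag(δ)`. -/
noncomputable def woodburyTerm {n : ℕ} (M : Matrix (Fin n) (Fin n) ℝ) (δ : Fin n → ℝ)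
    (S : Finset (Fin n)) : Matrix (Fin n) (Fin n) ℝ :=
  let MS : Matrix (Fin n) {i // i ∈ S} ℝ := M.submatrix id Subtype.val
  let MSS : Matrix {i // i ∈ S} {i // i ∈ S} ℝ := M.submatrix Subtype.val Subtype.val
  let DSS : Matrix {i // i ∈ S} {i // i ∈ S} ℝ := Matrix.diagonal (fun i => δ i.val)
  MS * (DSS⁻¹ + MSS)⁻¹ * MS.transpose

open Classical in
/-- A call of `Update` with input `un, vn` can turn the state `s` into `s'` and return `o`.
It is a relation because ties in the sorting permutation may be broken in any way. -/
def IsUpdate {n : ℕ} (a ε : ℝ) (f : ℝ → ℝ) (s : DSState n) (un vn : Fin n → ℝ)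
    (s' : DSState n) (o : DSOutput n) : Prop :=
  ∃ π : Equiv.Perm (Fin n), Antitone (fun j => |relDev s un (π j)|) ∧
    let S := firstIndices π (batchSize a ε s un π)
    let utn : Fin n → ℝ := fun i => if i ∈ S then un i else s.ut i
    let W := woodburyTerm s.M (utn - s.ut) S
    if RankBranch a ε s un then
      s'.M = s.M - W ∧
      s'.w = s'.M.mulVec (sqrtMul f utn vn) ∧
      s'.ut = utn ∧
      s'.vt = vn ∧
      o.u = utn ∧ o.v = vn ∧ o.fv = (fun i => f (vn i)) ∧
      o.r = fun i => Real.sqrt (utn i) * s'.w i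
    else
      let bad := Finset.univ.filter
        (fun i => ¬ ((1 - ε) * s.vt i ≤ vn i ∧ vn i ≤ (1 + ε) * s.vt i))
      if (n : ℝ) ^ a ≤ (bad.card : ℝ) then
        s'.M = s.M ∧
        s'.w = s.M.mulVec (sqrtMul f s.ut vn) ∧
        s'.ut = s.ut ∧
        s'.vt = vn ∧
        o.u = utn ∧ o.v = vn ∧ o.fv = (fun i => f (vn i)) ∧
        o.r = fun i => Real.sqrt (utn i) *
          (s.M.mulVec (sqrtMul f utn vn) i - W.mulVec (sqrtMul f utn vn) i)
      else
        let vtn : Fin n → ℝ := fun i => if i ∈ bad then vn i else s.vt i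
        s' = s ∧
        o.u = utn ∧ o.v = vtn ∧ o.fv = (fun i => f (vtn i)) ∧
        o.r = fun i => Real.sqrt (utn i) *
          (s.w i + s.M.mulVec (sqrtMul f utn vtn - sqrtMul f s.ut s.vt) i
            - W.mulVec (sqrtMul f utn vtn) i)

/-- `s 0, …, s T` are the states of the data structure when it is initialized with
`u 0, v 0` and then receives the `T` updates `(u 1, v 1), …, (u T, v T)`. -/
def IsExecution {n d : ℕ} (a ε : ℝ) (A : Matrix (Fin d) (Fin n) ℝ) (f : ℝ → ℝ) (T : ℕ)
    (u v : ℕ → Fin n → ℝ) (s : ℕ → DSState n) : Prop :=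
  s 0 = initState A f (u 0) (v 0) ∧
  ∀ t < T, ∃ o : DSOutput n, IsUpdate a ε f (s t) (u (t + 1)) (v (t + 1)) (s (t + 1)) o

open Classical in
/-- The indices `t < T` such that the call number `t + 1` takes the branch `k ≥ n ^ a`. -/
noncomputable def rankCalls {n : ℕ} (a ε : ℝ) (T : ℕ) (u : ℕ → Fin n → ℝ)
    (s : ℕ → DSState n) : Finset ℕ :=
  (Finset.range T).filter (fun t => RankBranch a ε (s t) (u (t + 1)))

/-- Bounded multiplicative change of the sequence `u 0, …, u T`. -/
def SmallChange {n : ℕ} (C : ℝ) (T : ℕ) (u : ℕ → Fin n → ℝ) : Prop :=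
  ∀ t < T, ∑ i, ((u (t + 1) i - u t i) / u t i) ^ 2 ≤ C ^ 2 ∧
    ∀ i, |(u (t + 1) i - u t i) / u t i| ≤ 1 / 4

/-! ### Memory layout of an implementation -/

/-- Registers of an implementation: the fixed data `A`, `ε`; the input `un`, `vn` of a call; the
variables `M`, `ũ`, `ṽ`, `w`; the returned vectors `f(ṽ)`, `r` (the returned `ũ`, `ṽ` coincide with
the variables); and scratch registers. -/
inductive DSReg (n d : ℕ) where
  | A (i : Fin d) (j : Fin n)
  | eps
  | un (i : Fin n)
  | vn (i : Fin n)
  | M (i j : Fin n)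
  | ut (i : Fin n)
  | vt (i : Fin n)
  | w (i : Fin n)
  | fv (i : Fin n)
  | r (i : Fin n)
  | tmp (l : ℕ)

/-- The memory `σ` contains the fixed data `A`, `ε`. -/
def HoldsData {n d : ℕ} (σ : DSReg n d → ℝ) (A : Matrix (Fin d) (Fin n) ℝ) (ε : ℝ) : Prop :=
  (∀ i j, σ (.A i j) = A i j) ∧ σ .eps = ε

/-- The memory `σ` contains the input vectors of a call. -/
def HoldsInput {n d : ℕ} (σ : DSReg n d → ℝ) (un vn : Fin n → ℝ) : Prop :=
  (∀ i, σ (.un i) = un i) ∧ (∀ i, σ (.vn i) = vn i)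

/-- The memory `σ` contains the state `s`. -/
def HoldsState {n d : ℕ} (σ : DSReg n d → ℝ) (s : DSState n) : Prop :=
  (∀ i j, σ (.M i j) = s.M i j) ∧ (∀ i, σ (.ut i) = s.ut i) ∧
    (∀ i, σ (.vt i) = s.vt i) ∧ (∀ i, σ (.w i) = s.w i)

/-- On input `u, v` the program `P` performs `Initialize`. -/
def ImplementsInit {n d : ℕ} (P : Prog (DSReg n d)) (A : Matrix (Fin d) (Fin n) ℝ) (ε : ℝ)
    (f : ℝ → ℝ) (u v : Fin n → ℝ) : Prop :=
  ∀ σ : DSReg n d → ℝ, HoldsData σ A ε → HoldsInput σ u v →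
    HoldsData (P.run f σ) A ε ∧ HoldsState (P.run f σ) (initState A f u v)

/-- In the state `s`, on input `un, vn`, the program `P` performs the call of `Update`, apart from
the body of the branch `k < n ^ a`: if that branch is taken, then `P` stops on entering it, with
the data structure and the input still unchanged. -/
def ImplementsUpdate {n d : ℕ} (P : Prog (DSReg n d)) (a : ℝ) (A : Matrix (Fin d) (Fin n) ℝ)
    (ε : ℝ) (f : ℝ → ℝ) (s : DSState n) (un vn : Fin n → ℝ) : Prop :=
  ∀ σ : DSReg n d → ℝ, HoldsData σ A ε → HoldsInput σ un vn → HoldsState σ s →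
    HoldsData (P.run f σ) A ε ∧
    (RankBranch a ε s un → ∃ (s' : DSState n) (o : DSOutput n),
      IsUpdate a ε f s un vn s' o ∧ HoldsState (P.run f σ) s' ∧
      (∀ i, P.run f σ (.fv i) = o.fv i) ∧ (∀ i, P.run f σ (.r i) = o.r i)) ∧
    (¬ RankBranch a ε s un → HoldsInput (P.run f σ) un vn ∧ HoldsState (P.run f σ) s)

/-!
*Preprocessing.* Positive definite `2 ^ l × 2 ^ l` matrices are inverted blockwise, by recursion on
their Schur complements, in time `O((2 ^ l) ^ ω)`; as `A` has full rank, this applies to the `d × d`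
matrix `A U Aᵀ`, padded with an identity matrix.  The products with `A` and `Aᵀ` split into
`⌈n / d⌉` and `⌈n / d⌉ ^ 2` products of `d × d` matrices.

*One update.* By the Woodbury identity, a batch of size `k` costs one inversion of size `k` and a
few products of an `n × k` by a `k × n` matrix.  A circuit that multiplies `b × ⌈b ^ β⌉` by
`⌈b ^ β⌉ × b` matrices bounds the rank of their multiplication tensor, up to a constant.  For
`β < α` this gives rank at most `b ^ (2 + δ)`, where `b` is large but constant.  A tensor power of
such a scheme, with matrices of size `(k / n ^ β) ^ (1 / (1 - β))` as entries, multiplies in time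
`O(n ^ ω (k / n) ^ θ)` for all `k ≥ n ^ a`.  If `ω > 5 / 2 - a / 2`, then `β` and `δ` can be chosen
with `θ > 1 / 2`.  Otherwise `ω` is replaced by numbers tending to `5 / 2 - a / 2` from above; this
produces the term `n ^ (2 - a / 2 + o(1))`.

*All updates.* The potential of a state sorts the relative deviations `|u_i / ũ_i - 1|`, truncated
at `2 ε`, in non-increasing order and gives the `j`-th of them the weight `j ^ (θ - 1)`.  By the
Cauchy–Schwarz inequality a small change of `u` raises it by `O(C n ^ (θ - 1 / 2))`, as `θ > 1 / 2`.
A batch of size `k` lowers it by a multiple of `k ^ θ ε / log n`, because the enlargement of `k`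
stops at a gap: beyond `3 k / 2` the deviations are smaller by a multiple of `ε / log n`.
Telescoping bounds the sum of `k ^ θ`, and with it the total time, over all batches.
-/

/-! ### Straight-line computations -/

/-- `Instr c V g`: one instruction with operands in `V` produces the quantity `g`.  A quantity is a
real function on a set `Ω` of inputs; the function that an instruction `call` evaluates may depend
on the input `ω` and is `c ω`. -/
inductive Instr {Ω : Type} (c : Ω → ℝ → ℝ) (V : Set (Ω → ℝ)) : (Ω → ℝ) → Prop
  | const (r : ℝ) : Instr c V fun _ => r
  | arith (o : ArithOp) {g h : Ω → ℝ} (hg : g ∈ V) (hh : h ∈ V) :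
      Instr c V fun ω => o.eval (g ω) (h ω)
  | sqrt {g : Ω → ℝ} (hg : g ∈ V) : Instr c V fun ω => Real.sqrt (g ω)
  | call {g : Ω → ℝ} (hg : g ∈ V) : Instr c V fun ω => c ω (g ω)

/-- `StraightLine c V t W`: all quantities in `W` can be computed from those in `V` by at most `t`
instructions.  There are no registers: computed quantities stay available, so that
computations can be composed without naming intermediate results. -/
inductive StraightLine {Ω : Type} (c : Ω → ℝ → ℝ) : Set (Ω → ℝ) → ℕ → Set (Ω → ℝ) → Prop
  | done {V W : Set (Ω → ℝ)} {t : ℕ} (hW : W ⊆ V) : StraightLine c V t W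
  | step {V W : Set (Ω → ℝ)} {t : ℕ} {g : Ω → ℝ} (hg : Instr c V g)
      (H : StraightLine c (insert g V) t W) : StraightLine c V (t + 1) W

/-- The set of entries of a matrix-valued function, as quantities of a straight-line
computation. -/
def entries {Ω I J : Type} (X : Ω → Matrix I J ℝ) : Set (Ω → ℝ) :=
  Set.range fun p : I × J => fun ω => X ω p.1 p.2

section Entries

variable {Ω I J : Type} {X : Ω → Matrix I J ℝ} {V : Set (Ω → ℝ)}

theorem mem_of_entries_subset (h : entries X ⊆ V) (i : I) (j : J) : (fun ω => X ω i j) ∈ V :=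
  h ⟨(i, j), rfl⟩

theorem entries_subset (h : ∀ i j, (fun ω => X ω i j) ∈ V) : entries X ⊆ V :=
  Set.range_subset_iff.2 fun p => h p.1 p.2

end Entries

theorem Instr.mono {Ω : Type} {c : Ω → ℝ → ℝ} {V V' : Set (Ω → ℝ)} {g : Ω → ℝ}
    (hg : Instr c V g) (hV : V ⊆ V') : Instr c V' g := by
  cases hg with
  | const r => exact .const r
  | arith o hg hh => exact .arith o (hV hg) (hV hh)
  | sqrt hg => exact .sqrt (hV hg)
  | call hg => exact .call (hV hg)

namespace StraightLine

variable {Ω : Type} {c : Ω → ℝ → ℝ} {V V' W W' : Set (Ω → ℝ)} {s t : ℕ} {g h : Ω → ℝ}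

theorem mono {t' : ℕ} (H : StraightLine c V t W) (hV : V ⊆ V') (ht : t ≤ t') (hW : W' ⊆ W) :
    StraightLine c V' t' W' := by
  induction H generalizing V' t' with
  | done hWV => exact .done (hW.trans (hWV.trans hV))
  | step hg _ ih =>
    obtain ⟨t', rfl⟩ := Nat.exists_eq_add_of_lt ht
    exact .step (hg.mono hV) (ih (Set.insert_subset_insert hV) (by omega) hW)

theorem weaken (H : StraightLine c V s W) (h : s ≤ t) : StraightLine c V t W :=
  H.mono subset_rfl h subset_rfl

theorem mono_left (H : StraightLine c V t W) (h : V ⊆ V') : StraightLine c V' t W :=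
  H.mono h le_rfl subset_rfl

theorem mono_right (H : StraightLine c V t W) (h : W' ⊆ W) : StraightLine c V t W' :=
  H.mono subset_rfl le_rfl h

theorem union_left (H : StraightLine c V t W) : StraightLine c V t (V ∪ W) := by
  induction H with
  | done hW => exact .done (Set.union_subset subset_rfl hW)
  | step hg _ ih =>
    exact .step hg (ih.mono_right (Set.union_subset_union_left _ (Set.subset_insert _ _)))

theorem trans (H : StraightLine c V s W) (H' : StraightLine c (V ∪ W) t W') :
    StraightLine c V (s + t) W' := by
  induction H with
  | done hW => exact H'.mono (Set.union_subset subset_rfl hW) (by omega) subset_rfl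
  | step hg _ ih =>
    refine (step hg (ih (H'.mono_left ?_))).weaken (by omega)
    exact Set.union_subset_union_left _ (Set.subset_insert _ _)

theorem union (H : StraightLine c V s W) (H' : StraightLine c V t W') :
    StraightLine c V (s + t) (W ∪ W') :=
  H.trans ((H'.mono_left Set.subset_union_left).union_left.mono_right
    (Set.union_subset_union_left _ Set.subset_union_right))

theorem of_mem (hg : g ∈ V) : StraightLine c V 0 {g} := .done (Set.singleton_subset_iff.2 hg)

theorem of_instr (hg : Instr c V g) : StraightLine c V 1 {g} :=
  .step hg (of_mem (Set.mem_insert _ _))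

theorem const (r : ℝ) : StraightLine c V 1 {fun _ => r} := of_instr (.const r)

theorem arith (o : ArithOp) (Hg : StraightLine c V s {g}) (Hh : StraightLine c V t {h}) :
    StraightLine c V (s + t + 1) {fun ω => o.eval (g ω) (h ω)} :=
  (Hg.union Hh).trans (of_instr (.arith o (by simp) (by simp)))

theorem add (Hg : StraightLine c V s {g}) (Hh : StraightLine c V t {h}) :
    StraightLine c V (s + t + 1) {fun ω => g ω + h ω} := arith .add Hg Hh

theorem sub (Hg : StraightLine c V s {g}) (Hh : StraightLine c V t {h}) :
    StraightLine c V (s + t + 1) {fun ω => g ω - h ω} := arith .sub Hg Hh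

theorem mul (Hg : StraightLine c V s {g}) (Hh : StraightLine c V t {h}) :
    StraightLine c V (s + t + 1) {fun ω => g ω * h ω} := arith .mul Hg Hh

theorem div (Hg : StraightLine c V s {g}) (Hh : StraightLine c V t {h}) :
    StraightLine c V (s + t + 1) {fun ω => g ω / h ω} := arith .div Hg Hh

theorem sqrt (Hg : StraightLine c V s {g}) :
    StraightLine c V (s + 1) {fun ω => Real.sqrt (g ω)} :=
  Hg.trans (of_instr (.sqrt (by simp)))

theorem call (Hg : StraightLine c V s {g}) : StraightLine c V (s + 1) {fun ω => c ω (g ω)} :=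
  Hg.trans (of_instr (.call (by simp)))

theorem biUnion {ι : Type} (S : Finset ι) {U : ι → Set (Ω → ℝ)}
    (H : ∀ i ∈ S, StraightLine c V t (U i)) : StraightLine c V (S.card * t) (⋃ i ∈ S, U i) := by
  classical
  induction S using Finset.induction_on with
  | empty => exact .done (by simp)
  | insert a S ha ih =>
    rw [Finset.card_insert_of_notMem ha, add_mul, one_mul, add_comm, Finset.set_biUnion_insert]
    exact (H a (Finset.mem_insert_self _ _)).union
      (ih fun i hi => H i (Finset.mem_insert_of_mem hi))

theorem iUnion {ι : Type} [Fintype ι] {U : ι → Set (Ω → ℝ)}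
    (H : ∀ i, StraightLine c V t (U i)) : StraightLine c V (Fintype.card ι * t) (⋃ i, U i) := by
  simpa using biUnion Finset.univ (U := U) fun i _ => H i

theorem range {ι : Type} [Fintype ι] {u : ι → Ω → ℝ} (H : ∀ i, StraightLine c V t {u i}) :
    StraightLine c V (Fintype.card ι * t) (Set.range u) := by
  simpa using iUnion H

theorem matrix {I J : Type} [Fintype I] [Fintype J] {X : Ω → Matrix I J ℝ}
    (H : ∀ i j, StraightLine c V t {fun ω => X ω i j}) :
    StraightLine c V (Fintype.card I * Fintype.card J * t) (entries X) := by
  rw [← Fintype.card_prod]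
  exact range fun p : I × J => H p.1 p.2

theorem sum {ι : Type} (S : Finset ι) {u : ι → Ω → ℝ} (h0 : (fun _ => 0) ∈ V)
    (H : ∀ i ∈ S, StraightLine c V t {u i}) :
    StraightLine c V (S.card * (t + 1)) {fun ω => ∑ i ∈ S, u i ω} := by
  classical
  induction S using Finset.induction_on with
  | empty => simpa using of_mem h0
  | insert a S ha ih =>
    simp only [Finset.sum_insert ha, Finset.card_insert_of_notMem ha]
    exact ((H a (Finset.mem_insert_self _ _)).add
      (ih fun i hi => H i (Finset.mem_insert_of_mem hi))).weaken (by grind)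

theorem linearCombination {ι : Type} [Fintype ι] (a : ι → ℝ) {u : ι → Ω → ℝ}
    (h0 : (fun _ => 0) ∈ V) (H : ∀ i, u i ∈ V) :
    StraightLine c V (Fintype.card ι * 3) {fun ω => ∑ i, a i * u i ω} :=
  sum Finset.univ h0 fun i _ => (const (a i)).mul (of_mem (H i))

theorem mulVec {I J : Type} [Fintype I] [Fintype J] {X : Ω → Matrix I J ℝ} {y : Ω → J → ℝ}
    (h0 : (fun _ => 0) ∈ V) (hX : entries X ⊆ V) (hy : ∀ j, (fun ω => y ω j) ∈ V) :
    StraightLine c V (Fintype.card I * (Fintype.card J * 2))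
      (Set.range fun i => fun ω => (X ω).mulVec (y ω) i) :=
  range fun i => sum (u := fun j ω => X ω i j * y ω j) Finset.univ h0 fun j _ =>
    (of_mem (mem_of_entries_subset hX i j)).mul (of_mem (hy j))

end StraightLine

/-! ### Circuits over commutative algebras -/

theorem writeReg_eq_update {ρ : Type} [DecidableEq ρ] (σ : ρ → ℝ) (z : ρ) (r : ℝ) :
    writeReg σ z r = Function.update σ z r := by
  funext x
  by_cases hx : x = z <;> simp [writeReg, hx]

/-- The operations `+`, `-`, `*` in a ring `R`.  The value `0` of a division is a dummy: circuits do
not divide. -/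
def ArithOp.evalIn {R : Type} [Ring R] : ArithOp → R → R → R
  | .add, x, y => x + y
  | .sub, x, y => x - y
  | .mul, x, y => x * y
  | .div, _, _ => 0

namespace Prog

open Classical in
/-- The memory after running a circuit on registers that hold elements of an algebra `R` over `ℝ`.
Only the instructions of circuits are interpreted, the others are skipped. -/
noncomputable def runIn (R : Type) [CommRing R] [Algebra ℝ R] {ρ : Type} :
    Prog ρ → (ρ → R) → ρ → R
  | .halt, τ => τ
  | .const z r P, τ => P.runIn R (Function.update τ z (algebraMap ℝ R r))
  | .arith o z x y P, τ => P.runIn R (Function.update τ z (o.evalIn (τ x) (τ y)))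
  | .sqrt _ _ P, τ => P.runIn R τ
  | .call _ _ P, τ => P.runIn R τ
  | .ifLT _ _ P _, τ => P.runIn R τ

theorem IsCircuit.runIn_real {ρ : Type} {P : Prog ρ} (hP : P.IsCircuit) (σ : ρ → ℝ) :
    P.runIn ℝ σ = P.run id σ := by
  classical
  induction P generalizing σ with
  | halt => rfl
  | const z r P ih => simp [runIn, run, ih hP, writeReg_eq_update]
  | arith o z x y P ih =>
    have evalIn_eq_eval (r s : ℝ) : o.evalIn r s = o.eval r s := by
      cases o <;> first | rfl | exact (hP.1 rfl).elim
    simp [runIn, run, ih hP.2, writeReg_eq_update, evalIn_eq_eval]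
  | _ => exact hP.elim

theorem map_runIn {R S ρ : Type} [CommRing R] [Algebra ℝ R] [CommRing S] [Algebra ℝ S]
    (φ : R →ₐ[ℝ] S) (P : Prog ρ) (τ : ρ → R) (x : ρ) :
    φ (P.runIn R τ x) = P.runIn S (fun y => φ (τ y)) x := by
  classical
  have map_evalIn (o : ArithOp) (r s : R) : φ (o.evalIn r s) = o.evalIn (φ r) (φ s) := by
    cases o <;> simp [ArithOp.evalIn]
  have map_update (τ : ρ → R) (z : ρ) (r : R) :
      (fun y => φ (Function.update τ z r y)) = Function.update (fun y => φ (τ y)) z (φ r) :=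
    funext fun y => Function.apply_update (fun _ => φ) τ z r y
  induction P generalizing τ with
  | _ => simp_all [runIn]

end Prog

theorem StraightLine.of_circuit {Ω ρ : Type} {c : Ω → ℝ → ℝ} {P : Prog ρ} (hP : P.IsCircuit)
    {V : Set (Ω → ℝ)} (τ : Ω → ρ → ℝ) (hτ : ∀ x, (fun ω => τ ω x) ∈ V) (f : ℝ → ℝ) (σ : ρ → ℝ) :
    StraightLine c V (P.cost f σ) (Set.range fun x => fun ω => P.run id (τ ω) x) := by
  have mem_insert_writeReg {τ : Ω → ρ → ℝ} {V : Set (Ω → ℝ)} (hτ : ∀ x, (fun ω => τ ω x) ∈ V)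
      (z : ρ) (g : Ω → ℝ) (x : ρ) : (fun ω => writeReg (τ ω) z (g ω) x) ∈ insert g V := by
    by_cases hx : x = z
    · exact Or.inl (funext fun ω => if_pos hx)
    · exact Or.inr (by simpa only [writeReg, if_neg hx] using hτ x)
  induction P generalizing τ V σ with
  | halt => exact .done (Set.range_subset_iff.2 hτ)
  | const z r P ih =>
    exact .step (.const r) (ih hP _ (mem_insert_writeReg hτ z fun _ => r) _)
  | arith o z x y P ih =>
    exact .step (.arith o (hτ x) (hτ y)) (ih hP.2 _
      (mem_insert_writeReg hτ z fun ω => o.eval (τ ω x) (τ ω y)) _)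
  | _ => exact hP.elim

/-! ### Matrix multiplication by straight-line computations -/

/-- A matrix with rows `I` and columns `J` can be multiplied with a matrix with rows `J` and columns
`K` by a straight-line computation with `t` instructions.  The quantity `0` is given for free, so
that matrices can be padded with zeros. -/
def MulBound (I J K : Type) [Fintype J] (t : ℕ) : Prop :=
  ∀ (Ω : Type) (c : Ω → ℝ → ℝ) (V : Set (Ω → ℝ)) (X : Ω → Matrix I J ℝ) (Y : Ω → Matrix J K ℝ),
    (fun _ => 0) ∈ V → entries X ⊆ V → entries Y ⊆ V →
      StraightLine c V t (entries fun ω => X ω * Y ω)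

/-- The memory that holds the factors `X`, `Y` and is zero elsewhere. -/
def mulMemory {n m p : ℕ} (X : Matrix (Fin n) (Fin m) ℝ) (Y : Matrix (Fin m) (Fin p) ℝ) :
    MulReg n m p → ℝ
  | .X i k => X i k
  | .Y k j => Y k j
  | .Z _ _ => 0
  | .tmp _ => 0

theorem CanMultiply.mulBound {n m p t : ℕ} (h : CanMultiply n m p t) :
    MulBound (Fin n) (Fin m) (Fin p) t := by
  intro Ω c V X Y h0 hX hY
  obtain ⟨P, hP, hrun⟩ := h
  have mulMemory_mem : ∀ x, (fun ω => mulMemory (X ω) (Y ω) x) ∈ V := by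
    rintro (⟨i, k⟩ | ⟨k, j⟩ | _ | _)
    exacts [mem_of_entries_subset hX i k, mem_of_entries_subset hY k j, h0, h0]
  refine ((StraightLine.of_circuit hP _ mulMemory_mem id 0).weaken (hrun 0).1).mono_right
    (entries_subset fun i j => ⟨.Z i j, ?_⟩)
  funext ω
  simp only [(hrun _).2 i j, Matrix.mul_apply, mulMemory]

/-- `X`, placed in the rows `e₁` and the columns `e₂` of a zero matrix. -/
noncomputable def zeroPad {I J I' J' : Type} (e₁ : I ↪ I') (e₂ : J ↪ J') (X : Matrix I J ℝ) :
    Matrix I' J' ℝ :=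
  Matrix.of fun i j => Function.extend (Prod.map e₁ e₂) (fun p => X p.1 p.2) 0 (i, j)

section ZeroPad

variable {I J K I' J' K' : Type} (e₁ : I ↪ I') (e₂ : J ↪ J') (e₃ : K ↪ K')

theorem zeroPad_apply (X : Matrix I J ℝ) (i : I) (j : J) :
    zeroPad e₁ e₂ X (e₁ i) (e₂ j) = X i j :=
  (e₁.injective.prodMap e₂.injective).extend_apply (fun p => X p.1 p.2) 0 (i, j)

theorem zeroPad_eq_zero (X : Matrix I J ℝ) {i : I'} {j : J'}
    (h : (i, j) ∉ Set.range (Prod.map e₁ e₂)) : zeroPad e₁ e₂ X i j = 0 :=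
  Function.extend_apply' (fun p : I × J => X p.1 p.2) (fun _ => (0 : ℝ)) _ h

theorem zeroPad_mul_zeroPad [Fintype J] [Fintype J'] (X : Matrix I J ℝ) (Y : Matrix J K ℝ) (i : I)
    (k : K) : (zeroPad e₁ e₂ X * zeroPad e₂ e₃ Y) (e₁ i) (e₃ k) = (X * Y) i k := by
  simp only [Matrix.mul_apply]
  refine (Fintype.sum_of_injective e₂ e₂.injective _ _ (fun j hj => ?_) fun j => ?_).symm
  · rw [zeroPad_eq_zero, zero_mul]
    rintro ⟨p, hp⟩
    exact hj ⟨p.2, (Prod.ext_iff.1 hp).2⟩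
  · rw [zeroPad_apply, zeroPad_apply]

theorem entries_zeroPad_subset {Ω : Type} {X : Ω → Matrix I J ℝ} {V : Set (Ω → ℝ)}
    (h0 : (fun _ => 0) ∈ V) (hX : entries X ⊆ V) : entries (fun ω => zeroPad e₁ e₂ (X ω)) ⊆ V := by
  refine entries_subset fun i' j' => ?_
  by_cases h : (i', j') ∈ Set.range (Prod.map e₁ e₂)
  · obtain ⟨⟨i, j⟩, h⟩ := h
    cases h
    simpa only [zeroPad_apply] using mem_of_entries_subset hX i j
  · simpa only [zeroPad_eq_zero _ _ _ h] using h0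

end ZeroPad

namespace MulBound

variable {I J K Q : Type} [Fintype J] [Fintype Q] {s t : ℕ}

theorem mono (h : MulBound I J K s) (hst : s ≤ t) : MulBound I J K t :=
  fun Ω c V X Y h0 hX hY => (h Ω c V X Y h0 hX hY).weaken hst

theorem embed {I' J' K' : Type} [Fintype J'] (h : MulBound I' J' K' t) (e₁ : I ↪ I')
    (e₂ : J ↪ J') (e₃ : K ↪ K') : MulBound I J K t := by
  intro Ω c V X Y h0 hX hY
  refine (h Ω c V _ _ h0 (entries_zeroPad_subset e₁ e₂ h0 hX)
    (entries_zeroPad_subset e₂ e₃ h0 hY)).mono_right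
      (entries_subset fun i k => ⟨(e₁ i, e₃ k), ?_⟩)
  simp only [zeroPad_mul_zeroPad]

theorem blocks_left (h : MulBound I J K t) : MulBound (Q × I) J K (Fintype.card Q * t) := by
  intro Ω c V X Y h0 hX hY
  refine (StraightLine.iUnion fun q : Q => h Ω c V (fun ω => Matrix.of fun i j => X ω (q, i) j) Y
    h0 (entries_subset fun i j => mem_of_entries_subset hX (q, i) j) hY).mono_right ?_
  exact entries_subset fun i k => Set.mem_iUnion.2 ⟨i.1, (i.2, k), by simp [Matrix.mul_apply]⟩

theorem blocks_right (h : MulBound I J K t) : MulBound I J (Q × K) (Fintype.card Q * t) := by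
  intro Ω c V X Y h0 hX hY
  refine (StraightLine.iUnion fun q : Q => h Ω c V X (fun ω => Matrix.of fun i j => Y ω i (q, j))
    h0 hX (entries_subset fun i j => mem_of_entries_subset hY i (q, j))).mono_right ?_
  exact entries_subset fun i k => Set.mem_iUnion.2 ⟨k.1, (i, k.2), by simp [Matrix.mul_apply]⟩

theorem blocks_mid [Fintype I] [Fintype K] (h : MulBound I J K t) :
    MulBound I (Q × J) K
      (Fintype.card Q * t + Fintype.card I * Fintype.card K * (Fintype.card Q * 1)) := by
  intro Ω c V X Y h0 hX hY
  have block_products := StraightLine.iUnion fun q : Q => h Ω c V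
    (fun ω => Matrix.of fun i j => X ω i (q, j)) (fun ω => Matrix.of fun j k => Y ω (q, j) k) h0
    (entries_subset fun i j => mem_of_entries_subset hX i (q, j))
    (entries_subset fun j k => mem_of_entries_subset hY (q, j) k)
  refine block_products.trans (StraightLine.matrix fun i k => ?_)
  simp only [Matrix.mul_apply, Fintype.sum_prod_type]
  refine StraightLine.sum (t := 0) Finset.univ (Or.inl h0) fun q _ => .of_mem (Or.inr ?_)
  exact Set.mem_iUnion.2 ⟨q, (i, k), by simp [Matrix.mul_apply]⟩

end MulBound

/-! ### Bilinear rank -/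

/-- The tensor of `n × m` by `m × p` matrix multiplication has rank at most `R`: there are at most
`R` products `(∑ α i k * X i k) * (∑ β k j * Y k j)` of linear forms of which all entries of `X * Y`
are linear combinations, with coefficients `γ`.  The equations say so for matrix units (Brent's
equations). -/
def BilinRank (n m p R : ℕ) : Prop :=
  ∃ (ι : Type) (_ : Fintype ι) (α : ι → Matrix (Fin n) (Fin m) ℝ) (β : ι → Matrix (Fin m) (Fin p) ℝ)
    (γ : ι → Matrix (Fin n) (Fin p) ℝ), Fintype.card ι ≤ R ∧ ∀ i k k' j i' j',
      ∑ l, α l i k * β l k' j * γ l i' j' = if i = i' ∧ k = k' ∧ j = j' then 1 else 0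

namespace BilinRank

variable {n m p R : ℕ}

theorem mono {R' : ℕ} (h : BilinRank n m p R) (hR : R ≤ R') : BilinRank n m p R' := by
  obtain ⟨ι, hι, α, β, γ, hcard, h⟩ := h
  exact ⟨ι, hι, α, β, γ, hcard.trans hR, h⟩

/-- The tensor `∑ x_ik y_kj z_ij` is symmetric in its three arguments up to transposition. -/
theorem swap (h : BilinRank n m p R) : BilinRank n p m R := by
  obtain ⟨ι, hι, α, β, γ, hcard, h⟩ := h
  refine ⟨ι, hι, γ, fun l => (β l).transpose, α, hcard, fun i k k' j i' j' => ?_⟩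
  calc ∑ l, γ l i k * β l j k' * α l i' j'
      = ∑ l, α l i' j' * β l j k' * γ l i k := Finset.sum_congr rfl fun l _ => by ring
    _ = _ := by rw [h]; exact if_congr (by tauto) rfl rfl

theorem restrict {m' : ℕ} (h : BilinRank n m p R) (hm : m' ≤ m) : BilinRank n m' p R := by
  obtain ⟨ι, hι, α, β, γ, hcard, h⟩ := h
  refine ⟨ι, hι, fun l => (α l).submatrix id (Fin.castLE hm),
    fun l => (β l).submatrix (Fin.castLE hm) id, γ, hcard, fun i k k' j i' j' => ?_⟩
  simp [h]

theorem outer (b : ℕ) : BilinRank b 1 b (b * b) := by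
  refine ⟨Fin b × Fin b, inferInstance, fun l => Matrix.single l.1 0 1,
    fun l => Matrix.single 0 l.2 1, fun l => Matrix.single l.1 l.2 1, by simp,
    fun i k k' j i' j' => ?_⟩
  have hk : k = 0 := Subsingleton.elim _ _
  have hk' : k' = 0 := Subsingleton.elim _ _
  rw [Finset.sum_eq_single (i', j') (fun l _ hl => ?_) (by simp)]
  · simp only [Matrix.single_apply, hk, hk']
    split_ifs <;> simp_all
  · have : ¬ (l.1 = i' ∧ l.2 = j') := fun h => hl (Prod.ext h.1 h.2)
    simp [Matrix.single_apply, this]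

end BilinRank

/-- The coefficients in `Q` of the monomials `x_ik * y_k'j`, as a matrix; here the variables of `Q`
are the registers of a matrix multiplication circuit. -/
noncomputable def bilinPart {n m p : ℕ} (Q : MvPolynomial (MulReg n m p) ℝ) :
    Matrix (Fin n × Fin m) (Fin m × Fin p) ℝ :=
  Matrix.of fun x y => MvPolynomial.constantCoeff
    (MvPolynomial.pderiv (.X x.1 x.2) (MvPolynomial.pderiv (.Y y.1 y.2) Q))

/-- The coefficients in `Q` of the monomials `x_ik`. -/
noncomputable def linPartX {n m p : ℕ} (Q : MvPolynomial (MulReg n m p) ℝ) (x : Fin n × Fin m) :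
    ℝ :=
  MvPolynomial.constantCoeff (MvPolynomial.pderiv (.X x.1 x.2) Q)

/-- The coefficients in `Q` of the monomials `y_kj`. -/
noncomputable def linPartY {n m p : ℕ} (Q : MvPolynomial (MulReg n m p) ℝ) (y : Fin m × Fin p) :
    ℝ :=
  MvPolynomial.constantCoeff (MvPolynomial.pderiv (.Y y.1 y.2) Q)

section BilinPart

variable {n m p : ℕ}

theorem bilinPart_add (P Q : MvPolynomial (MulReg n m p) ℝ) :
    bilinPart (P + Q) = bilinPart P + bilinPart Q := by
  ext; simp [bilinPart]

theorem bilinPart_sub (P Q : MvPolynomial (MulReg n m p) ℝ) :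
    bilinPart (P - Q) = bilinPart P - bilinPart Q := by
  ext; simp [bilinPart]

theorem bilinPart_C (r : ℝ) : bilinPart (n := n) (m := m) (p := p) (MvPolynomial.C r) = 0 := by
  ext; simp [bilinPart]

theorem bilinPart_X (x : MulReg n m p) : bilinPart (MvPolynomial.X x) = 0 := by
  classical
  ext
  simp only [bilinPart, MvPolynomial.pderiv_X, Pi.single_apply, Matrix.of_apply, Matrix.zero_apply]
  split_ifs <;> simp

theorem bilinPart_mul (P Q : MvPolynomial (MulReg n m p) ℝ) :
    bilinPart (P * Q) = MvPolynomial.constantCoeff Q • bilinPart P +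
      MvPolynomial.constantCoeff P • bilinPart Q + Matrix.vecMulVec (linPartX P) (linPartY Q) +
      Matrix.vecMulVec (linPartX Q) (linPartY P) := by
  ext x y
  simp only [bilinPart, linPartX, linPartY, Derivation.leibniz, map_add, smul_eq_mul, map_mul,
    Matrix.of_apply, Matrix.add_apply, Matrix.smul_apply, Matrix.vecMulVec_apply]
  ring

theorem bilinPart_product_entry (i : Fin n) (j : Fin p) :
    bilinPart (∑ k : Fin m, MvPolynomial.X (.X i k) * MvPolynomial.X (.Y k j)) =
      Matrix.of fun x y => if x.1 = i ∧ x.2 = y.1 ∧ y.2 = j then 1 else 0 := by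
  classical
  ext ⟨i', k⟩ ⟨k', j'⟩
  have entry_eq (l : Fin m) :
      MvPolynomial.constantCoeff (MvPolynomial.pderiv (MulReg.X i' k)
        (MvPolynomial.pderiv (.Y k' j')
          (MvPolynomial.X (R := ℝ) (MulReg.X i l) * MvPolynomial.X (.Y l j)))) =
        if k' = l then if i' = i ∧ k = l ∧ j' = j then 1 else 0 else 0 := by
    simp only [Derivation.leibniz, MvPolynomial.pderiv_X, Pi.single_apply]
    split_ifs <;> simp_all
  simp only [bilinPart, map_sum, Matrix.of_apply, entry_eq, Finset.sum_ite_eq, Finset.mem_univ,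
    if_true]

/-- The matrices of the products of a linear form in the first and one in the second factor. -/
def rankOneForms (n m p : ℕ) : Set (Matrix (Fin n × Fin m) (Fin m × Fin p) ℝ) :=
  Set.range fun d : (Fin n × Fin m → ℝ) × (Fin m × Fin p → ℝ) => Matrix.vecMulVec d.1 d.2

theorem ArithOp.exists_bilinPart_mem_span (o : ArithOp) {P Q : MvPolynomial (MulReg n m p) ℝ}
    {F : Submodule ℝ (Matrix (Fin n × Fin m) (Fin m × Fin p) ℝ)} (hP : bilinPart P ∈ F)
    (hQ : bilinPart Q ∈ F) :
    ∃ E : Finset (Matrix (Fin n × Fin m) (Fin m × Fin p) ℝ), ↑E ⊆ rankOneForms n m p ∧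
      E.card ≤ 2 ∧ bilinPart (o.evalIn P Q) ∈ F ⊔ Submodule.span ℝ E := by
  classical
  cases o with
  | add =>
    refine ⟨∅, by simp, by simp, Submodule.mem_sup_left ?_⟩
    rw [ArithOp.evalIn, bilinPart_add]
    exact F.add_mem hP hQ
  | sub =>
    refine ⟨∅, by simp, by simp, Submodule.mem_sup_left ?_⟩
    rw [ArithOp.evalIn, bilinPart_sub]
    exact F.sub_mem hP hQ
  | mul =>
    refine ⟨{Matrix.vecMulVec (linPartX P) (linPartY Q),
      Matrix.vecMulVec (linPartX Q) (linPartY P)}, ?_, Finset.card_le_two, ?_⟩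
    · rw [Finset.coe_pair, Set.pair_subset_iff]
      exact ⟨⟨(_, _), rfl⟩, ⟨(_, _), rfl⟩⟩
    · rw [ArithOp.evalIn, bilinPart_mul, add_assoc]
      refine Submodule.add_mem_sup (F.add_mem (F.smul_mem _ hP) (F.smul_mem _ hQ))
        (Submodule.add_mem _ (Submodule.subset_span ?_) (Submodule.subset_span ?_)) <;> simp
  | div =>
    refine ⟨∅, by simp, by simp, Submodule.mem_sup_left ?_⟩
    rw [ArithOp.evalIn, ← MvPolynomial.C_0, bilinPart_C]
    exact F.zero_mem

theorem Prog.IsCircuit.exists_bilinPart_mem_span {P : Prog (MulReg n m p)} (hP : P.IsCircuit)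
    (f : ℝ → ℝ) (σ : MulReg n m p → ℝ) (τ : MulReg n m p → MvPolynomial (MulReg n m p) ℝ)
    (F : Submodule ℝ (Matrix (Fin n × Fin m) (Fin m × Fin p) ℝ)) (hτ : ∀ x, bilinPart (τ x) ∈ F) :
    ∃ E : Finset (Matrix (Fin n × Fin m) (Fin m × Fin p) ℝ), ↑E ⊆ rankOneForms n m p ∧
      E.card ≤ 2 * P.cost f σ ∧ ∀ x, bilinPart (P.runIn _ τ x) ∈ F ⊔ Submodule.span ℝ E := by
  classical
  have update_mem {F : Submodule ℝ (Matrix (Fin n × Fin m) (Fin m × Fin p) ℝ)}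
      {τ : MulReg n m p → MvPolynomial (MulReg n m p) ℝ} (hτ : ∀ x, bilinPart (τ x) ∈ F)
      (z : MulReg n m p) {Q : MvPolynomial (MulReg n m p) ℝ} (hQ : bilinPart Q ∈ F)
      (x : MulReg n m p) : bilinPart (Function.update τ z Q x) ∈ F := by
    by_cases hx : x = z
    · subst hx; simpa using hQ
    · simpa [hx] using hτ x
  induction P generalizing σ τ F with
  | halt => exact ⟨∅, by simp, by simp, fun x => Submodule.mem_sup_left (hτ x)⟩
  | const z r P ih =>
    obtain ⟨E, hE, hcard, hmem⟩ := ih hP (writeReg σ z r) _ F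
      (update_mem hτ z (Q := MvPolynomial.C r) (bilinPart_C r ▸ F.zero_mem))
    exact ⟨E, hE, hcard.trans (by simp [Prog.cost]), hmem⟩
  | arith o z x y P ih =>
    obtain ⟨E, hE, hcard, hmem⟩ := o.exists_bilinPart_mem_span (hτ x) (hτ y)
    obtain ⟨E', hE', hcard', hmem'⟩ := ih hP.2 (writeReg σ z (o.eval (σ x) (σ y))) _ _
      (update_mem (fun w => Submodule.mem_sup_left (hτ w)) z hmem)
    refine ⟨E ∪ E', by simp [hE, hE'], (Finset.card_union_le E E').trans ?_, fun w => ?_⟩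
    · rw [Prog.cost]
      omega
    · rw [Finset.coe_union, Submodule.span_union, ← sup_assoc]
      exact hmem' w
  | _ => exact hP.elim

theorem runIn_mvPolynomial_eq {P : Prog (MulReg n m p)} (hP : P.IsCircuit) (i : Fin n) (j : Fin p)
    (hrun : ∀ σ, P.run id σ (.Z i j) = ∑ k : Fin m, σ (.X i k) * σ (.Y k j)) :
    P.runIn (MvPolynomial (MulReg n m p) ℝ) MvPolynomial.X (.Z i j) =
      ∑ k : Fin m, MvPolynomial.X (.X i k) * MvPolynomial.X (.Y k j) := by
  refine MvPolynomial.funext fun σ => ?_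
  rw [← MvPolynomial.coe_aeval_eq_eval, RingHom.coe_coe, Prog.map_runIn]
  simp only [MvPolynomial.aeval_X, hP.runIn_real, hrun, map_sum, map_mul]

end BilinPart

theorem CanMultiply.bilinRank {n m p t : ℕ} (h : CanMultiply n m p t) :
    BilinRank n m p (2 * t) := by
  classical
  obtain ⟨P, hP, hrun⟩ := h
  obtain ⟨E, hE, hcard, hmem⟩ := hP.exists_bilinPart_mem_span id 0 MvPolynomial.X ⊥
    fun x => bilinPart_X x ▸ Submodule.zero_mem _
  have exists_combination (i : Fin n) (j : Fin p) :
      ∃ w : Matrix (Fin n × Fin m) (Fin m × Fin p) ℝ → ℝ,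
        ∑ B ∈ E, w B • B =
          Matrix.of fun x y => if x.1 = i ∧ x.2 = y.1 ∧ y.2 = j then 1 else 0 := by
    have := hmem (.Z i j)
    rw [runIn_mvPolynomial_eq hP i j fun σ => (hrun σ).2 i j, bilinPart_product_entry, bot_sup_eq,
      Submodule.mem_span_finset] at this
    obtain ⟨w, -, hw⟩ := this
    exact ⟨w, hw⟩
  choose w hw using exists_combination
  have exists_forms : ∀ B ∈ E, ∃ d : (Fin n × Fin m → ℝ) × (Fin m × Fin p → ℝ),
      Matrix.vecMulVec d.1 d.2 = B := fun B hB => hE hB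
  choose! d hd using exists_forms
  refine ⟨{B // B ∈ E}, inferInstance, fun B i k => (d B).1 (i, k), fun B k j => (d B).2 (k, j),
    fun B i j => w i j B, ?_, fun i k k' j i' j' => ?_⟩
  · rw [Fintype.card_coe]
    exact hcard.trans (by have := (hrun 0).1; omega)
  · calc ∑ B : {B // B ∈ E}, (d B).1 (i, k) * (d B).2 (k', j) * w i' j' B
        = ∑ B ∈ E, (d B).1 (i, k) * (d B).2 (k', j) * w i' j' B :=
          Finset.sum_coe_sort E fun B => (d B).1 (i, k) * (d B).2 (k', j) * w i' j' B
      _ = (∑ B ∈ E, w i' j' B • B) (i, k) (k', j) := by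
          rw [Matrix.sum_apply]
          exact Finset.sum_congr rfl fun B hB => by
            rw [Matrix.smul_apply, smul_eq_mul, mul_comm,
              ← Matrix.vecMulVec_apply (d B).1 (d B).2 (i, k) (k', j), hd B hB]
      _ = if i = i' ∧ k = k' ∧ j = j' then 1 else 0 := by
          rw [hw, Matrix.of_apply]

/-! ### Tensor powers -/

/-- The linear combination with coefficients `α` of the blocks of a block matrix `X`. -/
noncomputable def blockCombination {b m : ℕ} {I J : Type} (α : Matrix (Fin b) (Fin m) ℝ)
    (X : Matrix (Fin b × I) (Fin m × J) ℝ) : Matrix I J ℝ :=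
  Matrix.of fun i j => ∑ x : Fin b × Fin m, α x.1 x.2 * X (x.1, i) (x.2, j)

theorem StraightLine.blockCombination {Ω I J : Type} [Fintype I] [Fintype J] {b m : ℕ}
    {c : Ω → ℝ → ℝ} {V : Set (Ω → ℝ)} (α : Matrix (Fin b) (Fin m) ℝ)
    {X : Ω → Matrix (Fin b × I) (Fin m × J) ℝ} (h0 : (fun _ => 0) ∈ V) (hX : entries X ⊆ V) :
    StraightLine c V (Fintype.card I * Fintype.card J * (b * m * 3))
      (entries fun ω => _root_.blockCombination α (X ω)) := by
  refine StraightLine.matrix fun i j => ?_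
  simpa [_root_.blockCombination] using
    linearCombination (c := c) (fun x : Fin b × Fin m => α x.1 x.2)
      (u := fun x ω => X ω (x.1, i) (x.2, j)) h0 fun x => mem_of_entries_subset hX _ _

theorem mul_apply_eq_sum_blockCombination {b m b' : ℕ} {ι I J K : Type} [Fintype ι] [Fintype J]
    {α : ι → Matrix (Fin b) (Fin m) ℝ} {β : ι → Matrix (Fin m) (Fin b') ℝ}
    {γ : ι → Matrix (Fin b) (Fin b') ℝ}
    (h : ∀ i k k' j i' j', ∑ l, α l i k * β l k' j * γ l i' j' =
      if i = i' ∧ k = k' ∧ j = j' then 1 else 0)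
    (X : Matrix (Fin b × I) (Fin m × J) ℝ) (Y : Matrix (Fin m × J) (Fin b' × K) ℝ)
    (i : Fin b) (x : I) (j : Fin b') (y : K) :
    (X * Y) (i, x) (j, y) =
      ∑ l, γ l i j * (blockCombination (α l) X * blockCombination (β l) Y) x y := by
  let B (u : Fin b × Fin m) (v : Fin m × Fin b') : ℝ :=
    ∑ z, X (u.1, x) (u.2, z) * Y (v.1, z) (v.2, y)
  have mul_blockCombination (l : ι) :
      (blockCombination (α l) X * blockCombination (β l) Y) x y =
        ∑ u : Fin b × Fin m, ∑ v : Fin m × Fin b', α l u.1 u.2 * β l v.1 v.2 * B u v := by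
    simp only [Matrix.mul_apply, blockCombination, Matrix.of_apply, Finset.sum_mul_sum]
    rw [Finset.sum_comm]
    refine Finset.sum_congr rfl fun u _ => ?_
    rw [Finset.sum_comm]
    refine Finset.sum_congr rfl fun v _ => ?_
    rw [Finset.mul_sum]
    exact Finset.sum_congr rfl fun z _ => by ring
  calc (X * Y) (i, x) (j, y) = ∑ k, B (i, k) (k, j) := by
        simp only [Matrix.mul_apply, Fintype.sum_prod_type, B]
    _ = ∑ u : Fin b × Fin m, ∑ v : Fin m × Fin b',
          (if u.1 = i ∧ u.2 = v.1 ∧ v.2 = j then 1 else 0) * B u v := by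
        simp [Fintype.sum_prod_type, ite_and, Finset.sum_ite_eq]
    _ = ∑ u : Fin b × Fin m, ∑ v : Fin m × Fin b',
          (∑ l, α l u.1 u.2 * β l v.1 v.2 * γ l i j) * B u v := by simp only [h]
    _ = ∑ l, γ l i j * (blockCombination (α l) X * blockCombination (β l) Y) x y := by
        simp only [mul_blockCombination, Finset.mul_sum, Finset.sum_mul]
        rw [Finset.sum_comm (s := (Finset.univ : Finset ι))]
        refine Finset.sum_congr rfl fun u _ => ?_
        rw [Finset.sum_comm]
        exact Finset.sum_congr rfl fun l _ => Finset.sum_congr rfl fun v _ => by ring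

namespace BilinRank

theorem mulBound_prod {b m b' R t : ℕ} (h : BilinRank b m b' R) {I J K : Type}
    [Fintype I] [Fintype J] [Fintype K] (H : MulBound I J K t) :
    MulBound (Fin b × I) (Fin m × J) (Fin b' × K)
      (R * (Fintype.card I * Fintype.card J * (b * m * 3)) +
        R * (Fintype.card J * Fintype.card K * (m * b' * 3)) + R * t +
        b * Fintype.card I * (b' * Fintype.card K) * (R * 3)) := by
  obtain ⟨ι, _, α, β, γ, hcard, h⟩ := h
  intro Ω c V X Y h0 hX hY
  have left_factors := StraightLine.iUnion (c := c) fun l => .blockCombination (α l) h0 hX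
  have right_factors := StraightLine.iUnion (c := c) fun l => .blockCombination (β l) h0 hY
  have products := StraightLine.iUnion fun l => H Ω c
    (V ∪ ((⋃ l, entries fun ω => blockCombination (α l) (X ω)) ∪
      ⋃ l, entries fun ω => blockCombination (β l) (Y ω)))
    (fun ω => blockCombination (α l) (X ω)) (fun ω => blockCombination (β l) (Y ω)) (Or.inl h0)
    (fun _ hg => Or.inr (Or.inl (Set.mem_iUnion_of_mem l hg)))
    (fun _ hg => Or.inr (Or.inr (Set.mem_iUnion_of_mem l hg)))
  refine ((left_factors.union right_factors).trans
    (products.trans (StraightLine.matrix (t := Fintype.card ι * 3) ?_))).weaken ?_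
  · rintro ⟨i, x⟩ ⟨j, y⟩
    simp only [mul_apply_eq_sum_blockCombination h]
    exact StraightLine.linearCombination (fun l => γ l i j) (Or.inl (Or.inl h0))
      fun l => Or.inr (Set.mem_iUnion.2 ⟨l, (x, y), rfl⟩)
  · simp only [Fintype.card_fin, Fintype.card_prod]
    rw [← add_assoc]
    gcongr

theorem mulBound_pow {b m R : ℕ} (h : BilinRank b m b R) (hR : 2 * b ^ 2 ≤ R) (hm : m ≤ b)
    {N t : ℕ} (H : MulBound (Fin N) (Fin N) (Fin N) t) (L : ℕ) :
    ∃ t', MulBound (Fin (b ^ L * N)) (Fin (m ^ L * N)) (Fin (b ^ L * N)) t' ∧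
      t' + 18 * b ^ 2 * (b ^ L * N) ^ 2 ≤ R ^ L * (t + 18 * b ^ 2 * N ^ 2) := by
  induction L with
  | zero =>
    have e (c : ℕ) : Fin (c ^ 0 * N) ≃ Fin N := finCongr (by simp)
    exact ⟨t, H.embed (e b).toEmbedding (e m).toEmbedding (e b).toEmbedding, by simp⟩
  | succ L ih =>
    obtain ⟨t', H', ht'⟩ := ih
    have e (c : ℕ) : Fin (c ^ (L + 1) * N) ≃ Fin c × Fin (c ^ L * N) :=
      (finCongr (by ring)).trans finProdFinEquiv.symm
    refine ⟨_, (h.mulBound_prod H').embed (e b).toEmbedding (e m).toEmbedding (e b).toEmbedding, ?_⟩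
    simp only [Fintype.card_fin]
    have hpow : b ^ (L + 1) * N = b * (b ^ L * N) := by ring
    rw [hpow, pow_succ' R L]
    generalize hp : b ^ L * N = p at ht' ⊢
    have hmp : m ^ L * N ≤ p := hp ▸ Nat.mul_le_mul_right _ (Nat.pow_le_pow_left hm L)
    generalize m ^ L * N = q at hmp ⊢
    have left_cost : R * (p * q * (b * m * 3)) ≤ R * (p * p * (b * b * 3)) := by gcongr
    have right_cost : R * (q * p * (m * b * 3)) ≤ R * (p * p * (b * b * 3)) := by gcongr
    have overhead_le : 9 * b ^ 2 * p ^ 2 * (2 * b ^ 2) ≤ 9 * b ^ 2 * p ^ 2 * R := by gcongr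
    nlinarith [Nat.mul_le_mul_left R ht', left_cost, right_cost, overhead_le]

end BilinRank

/-! ### Exponents -/

section Exponents

open Filter Asymptotics Topology

theorem Prog.IsCircuit.exists_written {ρ : Type} {P : Prog ρ} (hP : P.IsCircuit) (σ₀ : ρ → ℝ) :
    ∃ s : Finset ρ, s.card ≤ P.cost id σ₀ ∧ ∀ σ, ∀ x ∉ s, P.run id σ x = σ x := by
  classical
  induction P generalizing σ₀ with
  | halt => exact ⟨∅, by simp, fun σ x _ => rfl⟩
  | const z r P ih =>
    obtain ⟨s, hs, h⟩ := ih hP (writeReg σ₀ z r)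
    refine ⟨insert z s, (Finset.card_insert_le z s).trans (Nat.succ_le_succ hs), fun σ x hx => ?_⟩
    rw [Finset.mem_insert, not_or] at hx
    rw [Prog.run, h _ _ hx.2, writeReg, if_neg hx.1]
  | arith o z x y P ih =>
    obtain ⟨s, hs, h⟩ := ih hP.2 (writeReg σ₀ z (o.eval (σ₀ x) (σ₀ y)))
    refine ⟨insert z s, (Finset.card_insert_le z s).trans (Nat.succ_le_succ hs), fun σ x hx => ?_⟩
    rw [Finset.mem_insert, not_or] at hx
    rw [Prog.run, h _ _ hx.2, writeReg, if_neg hx.1]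
  | sqrt z x P _ => exact hP.elim
  | call z x P _ => exact hP.elim
  | ifLT x y P Q _ _ => exact hP.elim

theorem CanMultiply.mul_le {n m p t : ℕ} (h : CanMultiply n m p t) : n * p ≤ t := by
  classical
  obtain ⟨P, hP, hrun⟩ := h
  obtain ⟨s, hs, hw⟩ := hP.exists_written 0
  let outputReg (z : Fin n × Fin p) : MulReg n m p := .Z z.1 z.2
  have output_injective : Function.Injective outputReg := by
    rintro ⟨a, b⟩ ⟨c, d⟩ h
    simpa [outputReg] using h
  have output_subset : Finset.univ.image outputReg ⊆ s := by
    refine Finset.image_subset_iff.2 fun z _ => ?_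
    by_contra hz
    -- on the memory with `Z = 1` and all other registers `0`, every output register has to change
    have := hw (fun | .Z _ _ => 1 | _ => 0) _ hz
    rw [(hrun _).2] at this
    simp [outputReg] at this
  calc n * p = (Finset.univ.image outputReg).card := by
        simp [Finset.card_image_of_injective _ output_injective]
    _ ≤ s.card := Finset.card_le_card output_subset
    _ ≤ t := hs.trans (hrun 0).1

theorem isLittleO_natCast_rpow_of_lt {p q : ℝ} (h : p < q) :
    (fun n : ℕ => (n : ℝ) ^ p) =o[atTop] fun n : ℕ => (n : ℝ) ^ q := by
  suffices (fun x : ℝ => x ^ p) =o[atTop] fun x : ℝ => x ^ q from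
    this.comp_tendsto tendsto_natCast_atTop_atTop
  refine isLittleO_of_tendsto' ?_ ?_
  · filter_upwards [eventually_gt_atTop 0] with x hx h0
    exact absurd h0 (Real.rpow_pos_of_pos hx q).ne'
  · refine (tendsto_rpow_neg_atTop (sub_pos.2 h)).congr' ?_
    filter_upwards [eventually_gt_atTop 0] with x hx
    rw [neg_sub, Real.rpow_sub hx]

theorem isLittleO_rpow_add_of_isBigO {t η : ℕ → ℝ} {q δ : ℝ} (hη : Tendsto η atTop (𝓝 0))
    (ht : t =O[atTop] fun n : ℕ => (n : ℝ) ^ (q + η n)) (hδ : 0 < δ) :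
    t =o[atTop] fun n : ℕ => (n : ℝ) ^ (q + δ) := by
  have hle : (fun n : ℕ => (n : ℝ) ^ (q + η n)) =O[atTop] fun n : ℕ => (n : ℝ) ^ (q + δ / 2) := by
    refine .of_norm_eventuallyLE ?_
    filter_upwards [eventually_ge_atTop 1, hη.eventually (gt_mem_nhds (half_pos hδ))] with n hn hηn
    rw [Real.norm_of_nonneg (by positivity)]
    exact Real.rpow_le_rpow_of_exponent_le (by exact_mod_cast hn) (by linarith)
  exact (ht.trans hle).trans_isLittleO (isLittleO_natCast_rpow_of_lt (by linarith))

theorem le_of_rpow_le_of_isBigO {t η : ℕ → ℝ} {p q : ℝ} (hη : Tendsto η atTop (𝓝 0))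
    (h : ∀ᶠ n : ℕ in atTop, (n : ℝ) ^ p ≤ t n)
    (ht : t =O[atTop] fun n : ℕ => (n : ℝ) ^ (q + η n)) : p ≤ q := by
  by_contra! hlt
  have hle : (fun n : ℕ => (n : ℝ) ^ p) =O[atTop] t := by
    refine .of_norm_eventuallyLE ?_
    filter_upwards [h] with n hn
    rwa [Real.norm_of_nonneg (by positivity)]
  have hself : (fun n : ℕ => (n : ℝ) ^ p) =o[atTop] fun n : ℕ => (n : ℝ) ^ p := by
    simpa using hle.trans_isLittleO (isLittleO_rpow_add_of_isBigO hη ht (sub_pos.2 hlt))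
  refine isLittleO_irrefl (Eventually.frequently ?_) hself
  filter_upwards [eventually_gt_atTop 0] with n hn
  positivity

theorem IsMatMulExponent.two_le {ω : ℝ} (h : IsMatMulExponent ω) : 2 ≤ ω := by
  obtain ⟨t, ht, hO⟩ := h
  refine le_of_rpow_le_of_isBigO (η := fun _ => 0) tendsto_const_nhds (.of_forall fun n => ?_)
    (by simpa using hO)
  rw [Real.rpow_two, sq]
  exact_mod_cast (ht n).mul_le

theorem IsDualAdmissible.le_one {β : ℝ} (h : IsDualAdmissible β) : β ≤ 1 := by
  obtain ⟨t, η, ht, hη, hO⟩ := h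
  suffices 1 + β ≤ 2 by linarith
  refine le_of_rpow_le_of_isBigO hη ?_ hO
  filter_upwards [eventually_gt_atTop 0] with n hn
  calc (n : ℝ) ^ (1 + β) = n * (n : ℝ) ^ β := by
        rw [Real.rpow_add (by exact_mod_cast hn), Real.rpow_one]
    _ ≤ n * ⌈(n : ℝ) ^ β⌉₊ := by gcongr; exact Nat.le_ceil _
    _ ≤ t n := by exact_mod_cast (ht n).mul_le

theorem dualExponent_le_one : dualExponent ≤ 1 :=
  Real.sSup_le (fun _ h => IsDualAdmissible.le_one h) zero_le_one

theorem IsMatMulExponent.mono {ω ω' : ℝ} (h : IsMatMulExponent ω) (hω : ω ≤ ω') :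
    IsMatMulExponent ω' := by
  obtain ⟨t, ht, hO⟩ := h
  refine ⟨t, ht, hO.trans (.of_norm_eventuallyLE ?_)⟩
  filter_upwards [eventually_ge_atTop 1] with n hn
  rw [Real.norm_of_nonneg (by positivity)]
  exact Real.rpow_le_rpow_of_exponent_le (by exact_mod_cast hn) hω

theorem IsMatMulExponent.exists_mulBound {ω : ℝ} (h : IsMatMulExponent ω) :
    ∃ K : ℝ, 0 ≤ K ∧ ∀ n : ℕ, 1 ≤ n → ∃ t : ℕ, MulBound (Fin n) (Fin n) (Fin n) t ∧
      n ^ 2 ≤ t ∧ (t : ℝ) ≤ K * (n : ℝ) ^ ω := by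
  obtain ⟨t, ht, hO⟩ := h
  obtain ⟨K, hK, hbound⟩ := bound_of_isBigO_nat_atTop hO
  refine ⟨K, hK.le, fun n hn => ⟨t n, (ht n).mulBound, sq n ▸ (ht n).mul_le, ?_⟩⟩
  have hpos : 0 < (n : ℝ) ^ ω := Real.rpow_pos_of_pos (by exact_mod_cast hn) ω
  simpa [abs_of_pos hpos] using hbound hpos.ne'

/-! ### Rectangular matrix multiplication -/

theorem exists_isDualAdmissible_gt {β : ℝ} (h0 : 0 ≤ β) (hβ : β < dualExponent) :
    ∃ β', IsDualAdmissible β' ∧ β < β' := by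
  have hne : {β : ℝ | IsDualAdmissible β}.Nonempty := by
    by_contra hne
    rw [Set.not_nonempty_iff_eq_empty] at hne
    rw [dualExponent, hne, Real.sSup_empty] at hβ
    linarith
  exact exists_lt_of_lt_csSup hne hβ

theorem eventually_bilinRank_rpow_le {β δ : ℝ} (h0 : 0 ≤ β) (hβ : β = 0 ∨ β < dualExponent)
    (hδ : 0 < δ) : ∀ᶠ n : ℕ in atTop,
      ∃ R : ℕ, BilinRank n ⌈(n : ℝ) ^ β⌉₊ n R ∧ (R : ℝ) ≤ (n : ℝ) ^ (2 + δ) := by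
  rcases hβ with rfl | hβ
  · filter_upwards [eventually_ge_atTop 1] with n hn
    refine ⟨n * n, by simpa using BilinRank.outer n, ?_⟩
    rw [Nat.cast_mul, ← sq, ← Real.rpow_two]
    exact Real.rpow_le_rpow_of_exponent_le (by exact_mod_cast hn) (by linarith)
  · obtain ⟨β', ⟨t, η, ht, hη, hO⟩, hlt⟩ := exists_isDualAdmissible_gt h0 hβ
    filter_upwards [eventually_ge_atTop 1,
      (isLittleO_rpow_add_of_isBigO hη hO hδ).bound (half_pos one_pos)] with n hn hbound
    rw [Real.norm_of_nonneg (by positivity), Real.norm_of_nonneg (by positivity)] at hbound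
    refine ⟨2 * t n, (ht n).bilinRank.swap.restrict (Nat.ceil_mono ?_), by push_cast; linarith⟩
    exact Real.rpow_le_rpow_of_exponent_le (by exact_mod_cast hn) hlt.le

theorem eventually_ceil_rpow_lt {β : ℝ} (h0 : 0 ≤ β) (h1 : β < 1) :
    ∀ᶠ n : ℕ in atTop, ⌈(n : ℝ) ^ β⌉₊ < n := by
  filter_upwards [eventually_ge_atTop 1,
    (isLittleO_natCast_rpow_of_lt h1).bound (by norm_num : (0 : ℝ) < 1 / 3)] with n hn hbound
  rw [Real.rpow_one, Real.norm_of_nonneg (by positivity), Real.norm_of_nonneg (by positivity)]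
    at hbound
  have h2 : (1 : ℝ) ≤ (n : ℝ) ^ β := Real.one_le_rpow (by exact_mod_cast hn) h0
  have h3 := Nat.ceil_lt_add_one (zero_le_one.trans h2)
  exact_mod_cast (by linarith : (⌈(n : ℝ) ^ β⌉₊ : ℝ) < n)

theorem exists_bilinRank_rpow_le {β δ : ℝ} (h0 : 0 ≤ β) (h1 : β < 1)
    (hβ : β = 0 ∨ β < dualExponent) (hδ : 0 < δ) :
    ∃ b m R : ℕ, 2 ≤ b ∧ m < b ∧ (b : ℝ) ^ β ≤ m ∧ BilinRank b m b R ∧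
      2 * b ^ 2 ≤ R ∧ (R : ℝ) ≤ (b : ℝ) ^ (2 + δ) := by
  have hsq := (isLittleO_natCast_rpow_of_lt (by linarith : 2 < 2 + δ)).bound (half_pos one_pos)
  obtain ⟨b, hb, hm, ⟨R, hrank, hR⟩, hbound⟩ := ((eventually_ge_atTop 2).and
    ((eventually_ceil_rpow_lt h0 h1).and
      ((eventually_bilinRank_rpow_le h0 hβ hδ).and hsq))).exists
  rw [Real.norm_of_nonneg (by positivity), Real.norm_of_nonneg (by positivity), Real.rpow_two]
    at hbound
  refine ⟨b, _, max R (2 * b ^ 2), hb, hm, Nat.le_ceil _, hrank.mono (le_max_left _ _),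
    le_max_right _ _, ?_⟩
  push_cast
  exact max_le hR (by linarith)

end Exponents

theorem rpow_le_of_near {x y b p : ℝ} (hb : 1 ≤ b) (hy : 0 < y) (h1 : y ≤ x) (h2 : x ≤ y * b) :
    y ^ p ≤ b ^ |p| * x ^ p := by
  have hx : 0 < x := hy.trans_le h1
  rcases le_total 0 p with hp | hp
  · calc y ^ p ≤ 1 * x ^ p := by
          rw [one_mul]
          exact Real.rpow_le_rpow hy.le h1 hp
      _ ≤ _ := by
        gcongr
        exact Real.one_le_rpow hb (abs_nonneg p)
  · calc y ^ p = b ^ |p| * (y * b) ^ p := by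
          rw [abs_of_nonpos hp, Real.mul_rpow hy.le (by linarith), mul_left_comm,
            ← Real.rpow_add (by linarith), neg_add_cancel, Real.rpow_zero, mul_one]
      _ ≤ _ := mul_le_mul_of_nonneg_left (Real.rpow_le_rpow_of_nonpos hx h2 hp) (by positivity)

section Rectangular

variable {b m n k L N R : ℕ} {β x : ℝ}

theorem exists_pow_near_and_mul_near (hb : 2 ≤ b) (h1 : 1 ≤ x) (hx : x ≤ n) :
    ∃ L N : ℕ, ((b ^ L : ℕ) : ℝ) ≤ x ∧ x ≤ (b ^ L : ℕ) * b ∧ 1 ≤ N ∧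
      n ≤ b ^ L * N ∧ b ^ L * N ≤ 2 * n := by
  obtain ⟨L, hL, hL'⟩ := exists_nat_pow_near h1 (by exact_mod_cast hb : (1 : ℝ) < b)
  have hn : b ^ L ≤ n := by exact_mod_cast hL.trans hx
  refine ⟨L, n / b ^ L + 1, by exact_mod_cast hL, ?_, Nat.succ_pos _, ?_, ?_⟩
  · push_cast
    exact (pow_succ (b : ℝ) L ▸ hL').le
  · exact (Nat.lt_mul_div_succ n (by positivity)).le
  · rw [mul_add_one]
    linarith [Nat.mul_div_le n (b ^ L)]

theorem le_pow_mul_of_rpow_le (hb : 0 < b) (hk : 0 < k) (hbm : (b : ℝ) ^ β ≤ m)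
    (hn : n ≤ b ^ L * N) (h : ((b ^ L : ℕ) : ℝ) ^ (1 - β) ≤ n / k) : k ≤ m ^ L * N := by
  have hk' : (0 : ℝ) < k := by exact_mod_cast hk
  have hB : (0 : ℝ) < (b ^ L : ℕ) := by exact_mod_cast pow_pos hb L
  have hm : ((b ^ L : ℕ) : ℝ) ^ β ≤ (m : ℝ) ^ L := by
    rw [Nat.cast_pow, ← Real.rpow_pow_comm (by positivity)]
    gcongr
  have hBk : ((b ^ L : ℕ) : ℝ) * k ≤ (b ^ L : ℕ) * ((m : ℝ) ^ L * N) := by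
    calc ((b ^ L : ℕ) : ℝ) * k = ((b ^ L : ℕ) : ℝ) ^ β * (((b ^ L : ℕ) : ℝ) ^ (1 - β) * k) := by
          rw [← mul_assoc, ← Real.rpow_add hB, add_sub_cancel, Real.rpow_one]
      _ ≤ (m : ℝ) ^ L * (b ^ L * N : ℕ) := by
          gcongr
          exact ((le_div_iff₀ hk').1 h).trans (by exact_mod_cast hn)
      _ = _ := by push_cast; ring
  exact_mod_cast le_of_mul_le_mul_left hBk hB

theorem pow_mul_rpow_le {ω δ : ℝ} (hω : 0 ≤ ω) (hb : 1 ≤ b) (hR : (R : ℝ) ≤ (b : ℝ) ^ (2 + δ))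
    (hL : ((b ^ L : ℕ) : ℝ) ≤ x) (hL' : x ≤ (b ^ L : ℕ) * b) (hN : b ^ L * N ≤ 2 * n) :
    (R : ℝ) ^ L * (N : ℝ) ^ ω ≤
      2 ^ ω * (b : ℝ) ^ |2 + δ - ω| * ((n : ℝ) ^ ω * x ^ (2 + δ - ω)) := by
  set B : ℕ := b ^ L
  have hB : (0 : ℝ) < B := by exact_mod_cast pow_pos hb L
  have hx : 0 < x := hB.trans_le hL
  have hRB : (R : ℝ) ^ L ≤ (B : ℝ) ^ (2 + δ) := by
    rw [Nat.cast_pow, ← Real.rpow_pow_comm (by positivity)]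
    gcongr
  have hBN : (B : ℝ) ^ ω * (N : ℝ) ^ ω ≤ 2 ^ ω * (n : ℝ) ^ ω := by
    rw [← Real.mul_rpow (by positivity) (by positivity),
      ← Real.mul_rpow (by positivity) (by positivity)]
    exact Real.rpow_le_rpow (by positivity) (by exact_mod_cast hN) hω
  calc (R : ℝ) ^ L * (N : ℝ) ^ ω ≤ (B : ℝ) ^ (2 + δ) * (N : ℝ) ^ ω := by gcongr
    _ = (B : ℝ) ^ (2 + δ - ω) * ((B : ℝ) ^ ω * (N : ℝ) ^ ω) := by
        rw [← mul_assoc, ← Real.rpow_add hB, sub_add_cancel]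
    _ ≤ ((b : ℝ) ^ |2 + δ - ω| * x ^ (2 + δ - ω)) * (2 ^ ω * (n : ℝ) ^ ω) := by
        gcongr
        exact rpow_le_of_near (by exact_mod_cast hb) hB hL hL'
    _ = _ := by ring

theorem BilinRank.exists_mulBound_le {ω K : ℝ} (hrank : BilinRank b m b R)
    (hR : 2 * b ^ 2 ≤ R) (hm : m ≤ b) (hb : 1 ≤ b)
    (hmul : ∀ n : ℕ, 1 ≤ n → ∃ t : ℕ, MulBound (Fin n) (Fin n) (Fin n) t ∧
      n ^ 2 ≤ t ∧ (t : ℝ) ≤ K * (n : ℝ) ^ ω) (hN : 1 ≤ N) (hn : n ≤ b ^ L * N)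
    (hk : k ≤ m ^ L * N) :
    ∃ t, MulBound (Fin n) (Fin k) (Fin n) t ∧ n ^ 2 ≤ t ∧
      (t : ℝ) ≤ (1 + 18 * (b : ℝ) ^ 2) * K * ((R : ℝ) ^ L * (N : ℝ) ^ ω) := by
  obtain ⟨t₀, ht₀, hNt₀, ht₀K⟩ := hmul N hN
  obtain ⟨t', ht', ht'R⟩ := hrank.mulBound_pow hR hm ht₀ L
  refine ⟨t' + (b ^ L * N) ^ 2, (ht'.embed (Fin.castLEEmb hn) (Fin.castLEEmb hk)
    (Fin.castLEEmb hn)).mono (Nat.le_add_right _ _),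
    (Nat.pow_le_pow_left hn 2).trans (Nat.le_add_left _ _), ?_⟩
  have hcost : t' + (b ^ L * N) ^ 2 ≤ R ^ L * ((1 + 18 * b ^ 2) * t₀) := by
    calc t' + (b ^ L * N) ^ 2 ≤ t' + 18 * b ^ 2 * (b ^ L * N) ^ 2 := by
          gcongr
          exact Nat.le_mul_of_pos_left _ (by positivity)
      _ ≤ R ^ L * (t₀ + 18 * b ^ 2 * N ^ 2) := ht'R
      _ ≤ R ^ L * (t₀ + 18 * b ^ 2 * t₀) := by gcongr
      _ = R ^ L * ((1 + 18 * b ^ 2) * t₀) := by ring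
  calc ((t' + (b ^ L * N) ^ 2 : ℕ) : ℝ) ≤ (R : ℝ) ^ L * ((1 + 18 * (b : ℝ) ^ 2) * t₀) := by
        exact_mod_cast hcost
    _ ≤ (R : ℝ) ^ L * ((1 + 18 * (b : ℝ) ^ 2) * (K * (N : ℝ) ^ ω)) := by gcongr
    _ = _ := by ring

end Rectangular

theorem IsMatMulExponent.exists_rect_mulBound {ω β δ : ℝ} (hω : IsMatMulExponent ω) (h0 : 0 ≤ β)
    (h1 : β < 1) (hβ : β = 0 ∨ β < dualExponent) (hδ : 0 < δ) :
    ∃ K : ℝ, 0 ≤ K ∧ ∀ n k : ℕ, 1 ≤ k → k ≤ n → (n : ℝ) ^ β ≤ k → ∃ t : ℕ,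
      MulBound (Fin n) (Fin k) (Fin n) t ∧ n ^ 2 ≤ t ∧
      (t : ℝ) ≤ K * ((n : ℝ) ^ ω * ((k : ℝ) / n) ^ ((ω - 2 - δ) / (1 - β))) := by
  obtain ⟨b, m, R, hb, hm, hbm, hrank, hR, hRb⟩ := exists_bilinRank_rpow_le h0 h1 hβ hδ
  obtain ⟨K₀, hK₀, hmul⟩ := hω.exists_mulBound
  refine ⟨(1 + 18 * (b : ℝ) ^ 2) * K₀ * (2 ^ ω * (b : ℝ) ^ |2 + δ - ω|), by positivity,
    fun n k hk hkn hnk => ?_⟩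
  have hkpos : (0 : ℝ) < k := by exact_mod_cast hk
  have hkn' : (k : ℝ) ≤ n := by exact_mod_cast hkn
  have hnpos : (0 : ℝ) < n := hkpos.trans_le hkn'
  have h1β : 0 < 1 - β := by linarith
  let x : ℝ := ((n : ℝ) / k) ^ (1 - β)⁻¹
  have hx1 : 1 ≤ x := Real.one_le_rpow ((one_le_div hkpos).2 hkn') (by positivity)
  have hx : x ^ (1 - β) = n / k := Real.rpow_inv_rpow (by positivity) h1β.ne'
  have hxn : x ≤ n := by
    refine (Real.rpow_inv_le_iff_of_pos (by positivity) hnpos.le h1β).2 ?_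
    rw [Real.rpow_sub hnpos, Real.rpow_one]
    gcongr
  have hxω : x ^ (2 + δ - ω) = ((k : ℝ) / n) ^ ((ω - 2 - δ) / (1 - β)) := by
    rw [← Real.rpow_mul (by positivity), ← inv_div (k : ℝ) n, Real.inv_rpow (by positivity),
      ← Real.rpow_neg (by positivity)]
    ring_nf
  obtain ⟨L, N, hL, hL', hN, hnN, hN2⟩ := exists_pow_near_and_mul_near hb hx1 hxn
  have hkN : k ≤ m ^ L * N := le_pow_mul_of_rpow_le (by lia) hk hbm hnN
    (hx ▸ Real.rpow_le_rpow (Nat.cast_nonneg _) hL h1β.le)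
  obtain ⟨t, ht, hnt, htK⟩ := hrank.exists_mulBound_le hR hm.le (by lia) hmul hN hnN hkN
  refine ⟨t, ht, hnt, htK.trans ?_⟩
  rw [mul_assoc (_ * K₀), ← hxω]
  exact mul_le_mul_of_nonneg_left
    (pow_mul_rpow_le (by linarith [hω.two_le]) (by lia) hRb hL hL' hN2) (by positivity)

/-! ### Matrix inversion -/

/-- Positive definite matrices with index set `I` can be inverted by a straight-line computation
with `t` instructions.  The quantities `0` and `1` are given for free, so that matrices can be
padded with an identity matrix. -/
def InvBound (I : Type) [Fintype I] [DecidableEq I] (t : ℕ) : Prop :=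
  ∀ (Ω : Type) (c : Ω → ℝ → ℝ) (V : Set (Ω → ℝ)) (X : Ω → Matrix I I ℝ),
    (fun _ => 0) ∈ V → (fun _ => 1) ∈ V → entries X ⊆ V → (∀ ω, (X ω).PosDef) →
      StraightLine c V t (entries fun ω => (X ω)⁻¹)

section SchurComplement

open Matrix

variable {I J : Type} [Fintype I] [DecidableEq I]

theorem posDef_fromBlocks_iff [Finite J] {A : Matrix I I ℝ} {B : Matrix I J ℝ} {D : Matrix J J ℝ}
    (hA : A.PosDef) : (fromBlocks A B Bᵀ D).PosDef ↔ (D - Bᵀ * A⁻¹ * B).PosDef := by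
  classical
  have := Fintype.ofFinite J
  let := hA.isUnit.invertible
  have hpsd := PosDef.fromBlocks₁₁ B D hA
  have hunit : IsUnit (fromBlocks A B Bᵀ D) ↔ IsUnit (D - Bᵀ * A⁻¹ * B) := by
    rw [isUnit_fromBlocks_iff_of_invertible₁₁, invOf_eq_nonsing_inv]
  rw [conjTranspose_eq_transpose_of_trivial] at hpsd
  exact ⟨fun h => (hpsd.1 h.posSemidef).posDef_iff_isUnit.2 (hunit.1 h.isUnit),
    fun h => (hpsd.2 h.posSemidef).posDef_iff_isUnit.2 (hunit.2 h.isUnit)⟩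

variable [Fintype J] [DecidableEq J]

theorem inv_fromBlocks_of_isUnit {A : Matrix I I ℝ} {B : Matrix I J ℝ} {C : Matrix J I ℝ}
    {D : Matrix J J ℝ} (hA : IsUnit A) (hS : IsUnit (D - C * A⁻¹ * B)) :
    (fromBlocks A B C D)⁻¹ =
      fromBlocks (A⁻¹ + A⁻¹ * B * (D - C * A⁻¹ * B)⁻¹ * C * A⁻¹)
        (-(A⁻¹ * B * (D - C * A⁻¹ * B)⁻¹)) (-((D - C * A⁻¹ * B)⁻¹ * C * A⁻¹))
        (D - C * A⁻¹ * B)⁻¹ := by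
  let := hA.invertible
  rw [← invOf_eq_nonsing_inv A] at hS ⊢
  let := hS.invertible
  let := fromBlocks₁₁Invertible A B C D
  simpa only [invOf_eq_nonsing_inv] using invOf_fromBlocks₁₁_eq A B C D

theorem inv_fromBlocks_of_posDef {A : Matrix I I ℝ} {B : Matrix I J ℝ} {D : Matrix J J ℝ}
    (hA : A.PosDef) (h : (fromBlocks A B Bᵀ D).PosDef) :
    let P := A⁻¹ * B
    let S := D - Bᵀ * P
    (fromBlocks A B Bᵀ D)⁻¹ =
      fromBlocks (A⁻¹ + P * S⁻¹ * Pᵀ) (-(P * S⁻¹)) (-(P * S⁻¹)ᵀ) S⁻¹ := by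
  have hS := (posDef_fromBlocks_iff hA).1 h
  have hAt : Aᵀ = A := hA.isHermitian
  have hSt : (D - Bᵀ * A⁻¹ * B)ᵀ = D - Bᵀ * A⁻¹ * B := hS.isHermitian
  simp only [inv_fromBlocks_of_isUnit hA.isUnit hS.isUnit, ← Matrix.mul_assoc, transpose_mul,
    transpose_nonsing_inv, hAt, hSt]

end SchurComplement

section Blocks

open Matrix

variable {I : Type} [Fintype I] {Ω : Type} {c : Ω → ℝ → ℝ} {V : Set (Ω → ℝ)} {s t : ℕ}

theorem InvBound.schurComplement [DecidableEq I] (h : InvBound I t) (hm : MulBound I I I s)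
    {A B D : Ω → Matrix I I ℝ} (h0 : (fun _ => 0) ∈ V) (h1 : (fun _ => 1) ∈ V)
    (hA : entries A ⊆ V) (hB : entries B ⊆ V) (hD : entries D ⊆ V) (hpos : ∀ ω, (A ω).PosDef) :
    StraightLine c V (t + 2 * s + Fintype.card I * Fintype.card I)
      (entries (fun ω => (A ω)⁻¹) ∪ entries (fun ω => (A ω)⁻¹ * B ω) ∪
        entries fun ω => D ω - (B ω)ᵀ * ((A ω)⁻¹ * B ω)) := by
  have hBt : entries (fun ω => (B ω)ᵀ) ⊆ V :=
    entries_subset fun i j => mem_of_entries_subset hB j i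
  have inv_A := h Ω c V A h0 h1 hA hpos
  let V₁ := V ∪ entries fun ω => (A ω)⁻¹
  let V₂ := V₁ ∪ entries fun ω => (A ω)⁻¹ * B ω
  have hV₁ : V ⊆ V₁ := Set.subset_union_left
  have hV₂ : V ⊆ V₂ := hV₁.trans Set.subset_union_left
  have mul_B := hm Ω c V₁ _ B (hV₁ h0) Set.subset_union_right (hB.trans hV₁)
  have mul_Bt := hm Ω c V₂ _ _ (hV₂ h0) (hBt.trans hV₂) Set.subset_union_right
  have sub_D := StraightLine.matrix (c := c)
    (V := V₂ ∪ entries fun ω => (B ω)ᵀ * ((A ω)⁻¹ * B ω))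
    (X := fun ω => D ω - (B ω)ᵀ * ((A ω)⁻¹ * B ω)) fun i j =>
      (StraightLine.of_mem (.inl (hV₂ (mem_of_entries_subset hD i j)))).sub
        (.of_mem (.inr ⟨(i, j), rfl⟩))
  exact (inv_A.trans (mul_B.trans (mul_Bt.trans sub_D.union_left))).mono subset_rfl (by lia)
    (by grind)

theorem MulBound.schurBlocks (hm : MulBound I I I s) {A' P S' : Ω → Matrix I I ℝ}
    (h0 : (fun _ => 0) ∈ V) (hA : entries A' ⊆ V) (hP : entries P ⊆ V) (hS : entries S' ⊆ V) :
    StraightLine c V (2 * s + 2 * (Fintype.card I * Fintype.card I))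
      (entries fun ω => fromBlocks (A' ω + P ω * S' ω * (P ω)ᵀ) (-(P ω * S' ω))
        (-(P ω * S' ω)ᵀ) (S' ω)) := by
  have mul_S := hm Ω c V P S' h0 hP hS
  let V₁ := V ∪ entries fun ω => P ω * S' ω
  let V₂ := V₁ ∪ entries fun ω => P ω * S' ω * (P ω)ᵀ
  let V₃ := V₂ ∪ entries fun ω => A' ω + P ω * S' ω * (P ω)ᵀ
  have mul_Pt := hm Ω c V₁ _ (fun ω => (P ω)ᵀ) (.inl h0) Set.subset_union_right
    (entries_subset fun i j => .inl (mem_of_entries_subset hP j i))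
  have add_A := StraightLine.matrix (c := c) (V := V₂)
    (X := fun ω => A' ω + P ω * S' ω * (P ω)ᵀ) fun i j =>
      (StraightLine.of_mem (.inl (.inl (mem_of_entries_subset hA i j)))).add
        (.of_mem (.inr ⟨(i, j), rfl⟩))
  have neg_Q := StraightLine.matrix (c := c) (V := V₃) (t := 1)
    (X := fun ω => -(P ω * S' ω)) fun i j => by
      simpa using (StraightLine.of_mem (c := c) (V := V₃) (.inl (.inl (.inl h0)))).sub
        (.of_mem (.inl (.inl (.inr ⟨(i, j), rfl⟩))))
  refine (mul_S.trans (mul_Pt.trans (add_A.trans neg_Q.union_left))).mono subset_rfl (by lia)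
    (entries_subset ?_)
  rintro (i | i) (j | j)
  · exact .inl (.inr ⟨(i, j), rfl⟩)
  · exact .inr ⟨(i, j), rfl⟩
  · exact .inr ⟨(j, i), rfl⟩
  · exact .inl (.inl (.inl (.inl (hS ⟨(i, j), rfl⟩))))

end Blocks

namespace InvBound

open Matrix

variable {I : Type} [Fintype I] [DecidableEq I] {s t : ℕ}

theorem embed {I' J : Type} [Fintype I'] [DecidableEq I'] [Finite J] (h : InvBound I' t)
    (e : I ⊕ J ≃ I') : InvBound I t := by
  classical
  have := Fintype.ofFinite J
  intro Ω c V X h0 h1 hX hpos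
  have hpos' (ω : Ω) : (fromBlocks (X ω) 0 0 (1 : Matrix J J ℝ)).PosDef := by
    simpa using (posDef_fromBlocks_iff (B := (0 : Matrix I J ℝ)) (D := 1) (hpos ω)).2
      (by simpa using PosDef.one)
  have hX' : entries (fun ω => (fromBlocks (X ω) 0 0 (1 : Matrix J J ℝ)).submatrix e.symm e.symm)
      ⊆ V := entries_subset fun i j => by
    simp only [submatrix_apply]
    rcases e.symm i with i | i <;> rcases e.symm j with j | j
    · exact mem_of_entries_subset hX i j
    · exact h0
    · exact h0
    · by_cases hij : i = j
      · simpa [hij] using h1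
      · simpa [hij] using h0
  refine (h Ω c V _ h0 h1 hX' fun ω => (hpos' ω).submatrix e.symm.injective).mono_right
    (entries_subset fun i j => ⟨(e (.inl i), e (.inl j)), ?_⟩)
  funext ω
  change ((fromBlocks (X ω) 0 0 1).submatrix e.symm e.symm)⁻¹ _ _ = _
  rw [inv_submatrix_equiv, inv_fromBlocks_zero₂₁_of_isUnit_iff _ _ _
    ⟨fun _ => isUnit_one, fun _ => (hpos ω).isUnit⟩]
  simp

theorem fin_one : InvBound (Fin 1) 2 := by
  intro Ω c V X _ _ hX _
  have inv_entry := StraightLine.matrix (X := fun ω => of fun i j => 1 / X ω i j) fun i j =>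
    (StraightLine.const (c := c) (V := V) 1).div (.of_mem (mem_of_entries_subset hX i j))
  refine (inv_entry.weaken (by simp)).mono_right (entries_subset fun i j => ⟨(i, j), ?_⟩)
  funext ω
  simp [Subsingleton.elim i 0, Subsingleton.elim j 0]

theorem double (h : InvBound I t) (hm : MulBound I I I s) :
    InvBound (I ⊕ I) (2 * t + 4 * s + 3 * (Fintype.card I * Fintype.card I)) := by
  intro Ω c V X h0 h1 hX hpos
  let A (ω : Ω) : Matrix I I ℝ := (X ω).toBlocks₁₁
  let B (ω : Ω) : Matrix I I ℝ := (X ω).toBlocks₁₂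
  let D (ω : Ω) : Matrix I I ℝ := (X ω).toBlocks₂₂
  have hXe (ω : Ω) : X ω = fromBlocks (A ω) (B ω) (B ω)ᵀ (D ω) := by
    have hB : (B ω)ᵀ = (X ω).toBlocks₂₁ := by
      ext i j
      simpa [B, toBlocks₁₂, toBlocks₂₁] using (hpos ω).isHermitian.apply (Sum.inr i) (Sum.inl j)
    rw [hB, fromBlocks_toBlocks]
  have hA : entries A ⊆ V := entries_subset fun i j => mem_of_entries_subset hX (.inl i) (.inl j)
  have hB : entries B ⊆ V := entries_subset fun i j => mem_of_entries_subset hX (.inl i) (.inr j)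
  have hD : entries D ⊆ V := entries_subset fun i j => mem_of_entries_subset hX (.inr i) (.inr j)
  have hApos (ω : Ω) : (A ω).PosDef := (hpos ω).submatrix (e := Sum.inl) Sum.inl_injective
  have hSpos (ω : Ω) : (D ω - (B ω)ᵀ * ((A ω)⁻¹ * B ω)).PosDef := by
    rw [← Matrix.mul_assoc]
    exact (posDef_fromBlocks_iff (hApos ω)).1 (hXe ω ▸ hpos ω)
  simp only [fun ω => (congrArg Inv.inv (hXe ω)).trans
    (inv_fromBlocks_of_posDef (hApos ω) (hXe ω ▸ hpos ω))]
  have schur := h.schurComplement (c := c) hm h0 h1 hA hB hD hApos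
  let V₁ := V ∪ (entries (fun ω => (A ω)⁻¹) ∪ entries (fun ω => (A ω)⁻¹ * B ω) ∪
    entries fun ω => D ω - (B ω)ᵀ * ((A ω)⁻¹ * B ω))
  have inv_S := h Ω c V₁ _ (.inl h0) (.inl h1)
    (Set.subset_union_right.trans Set.subset_union_right) hSpos
  have blocks := hm.schurBlocks (c := c)
    (V := V₁ ∪ entries fun ω => (D ω - (B ω)ᵀ * ((A ω)⁻¹ * B ω))⁻¹)
    (A' := fun ω => (A ω)⁻¹) (P := fun ω => (A ω)⁻¹ * B ω) (.inl (.inl h0))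
    (by grind) (by grind) Set.subset_union_right
  exact (schur.trans (inv_S.trans blocks)).weaken (by lia)

/-- By `X⁻¹ = (Xᵀ X)⁻¹ Xᵀ`, where `Xᵀ X` is positive definite. -/
theorem straightLine_inv (h : InvBound I t) (hm : MulBound I I I s) {Ω : Type}
    {c : Ω → ℝ → ℝ} {V : Set (Ω → ℝ)} {X : Ω → Matrix I I ℝ} (h0 : (fun _ => 0) ∈ V)
    (h1 : (fun _ => 1) ∈ V) (hX : entries X ⊆ V) (hu : ∀ ω, IsUnit (X ω)) :
    StraightLine c V (2 * s + t) (entries fun ω => (X ω)⁻¹) := by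
  have hXt : entries (fun ω => (X ω)ᵀ) ⊆ V :=
    entries_subset fun i j => mem_of_entries_subset hX j i
  have gram := hm Ω c V _ X h0 hXt hX
  let V₁ := V ∪ entries fun ω => (X ω)ᵀ * X ω
  let V₂ := V₁ ∪ entries fun ω => ((X ω)ᵀ * X ω)⁻¹
  have inv_gram := h Ω c V₁ (fun ω => (X ω)ᵀ * X ω) (.inl h0) (.inl h1) Set.subset_union_right
    fun ω => PosDef.conjTranspose_mul_self _ (mulVec_injective_iff_isUnit.2 (hu ω))
  have mul_Xt := hm Ω c V₂ _ _ (.inl (.inl h0)) Set.subset_union_right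
    (hXt.trans (Set.subset_union_left.trans Set.subset_union_left))
  have inv_eq (ω : Ω) : ((X ω)ᵀ * X ω)⁻¹ * (X ω)ᵀ = (X ω)⁻¹ := by
    have hω := hu ω
    rw [Matrix.mul_inv_rev, Matrix.mul_assoc,
      nonsing_inv_mul _ (by rwa [det_transpose, ← isUnit_iff_isUnit_det]), Matrix.mul_one]
  simp only [inv_eq] at mul_Xt
  exact (gram.trans (inv_gram.trans mul_Xt)).weaken (by lia)

end InvBound

theorem IsMatMulExponent.exists_invBound_two_pow {ω : ℝ} (hω : IsMatMulExponent ω) :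
    ∃ K : ℝ, 0 ≤ K ∧ ∀ L : ℕ, ∃ t : ℕ, InvBound (Fin (2 ^ L)) t ∧
      (t : ℝ) ≤ K * ((2 : ℝ) ^ L) ^ ω := by
  obtain ⟨K, hK, hmul⟩ := hω.exists_mulBound
  have four_le : (4 : ℝ) ≤ 2 ^ ω := by
    calc (4 : ℝ) = 2 ^ (2 : ℝ) := by norm_num
      _ ≤ 2 ^ ω := Real.rpow_le_rpow_of_exponent_le one_le_two hω.two_le
  refine ⟨4 * K, by positivity, fun L => ?_⟩
  induction L with
  | zero =>
    obtain ⟨s, -, one_le_s, s_le⟩ := hmul 1 le_rfl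
    have one_le_K : 1 ≤ K := by simpa using (Nat.one_le_cast.2 one_le_s).trans s_le
    exact ⟨2, InvBound.fin_one, by simp only [pow_zero, Real.one_rpow]; push_cast; linarith⟩
  | succ L ih =>
    obtain ⟨t, ht, t_le⟩ := ih
    obtain ⟨s, hs, sq_le_s, s_le⟩ := hmul (2 ^ L) Nat.one_le_two_pow
    have e : (Fin (2 ^ (L + 1)) ⊕ Fin 0) ≃ Fin (2 ^ L) ⊕ Fin (2 ^ L) :=
      (Equiv.sumEmpty _ _).trans ((finCongr (by ring)).trans finSumFinEquiv.symm)
    refine ⟨_, (ht.double hs).embed e, ?_⟩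
    have sq_le_s' : (2 : ℝ) ^ L * 2 ^ L ≤ s := by
      rw [← sq]
      exact_mod_cast sq_le_s
    simp only [Fintype.card_fin]
    push_cast at s_le ⊢
    calc 2 * (t : ℝ) + 4 * s + 3 * (2 ^ L * 2 ^ L) ≤ 4 * (4 * K * ((2 : ℝ) ^ L) ^ ω) := by
          linarith
      _ ≤ 2 ^ ω * (4 * K * ((2 : ℝ) ^ L) ^ ω) := by gcongr
      _ = 4 * K * ((2 : ℝ) ^ (L + 1)) ^ ω := by
          rw [pow_succ, Real.mul_rpow (by positivity) zero_le_two]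
          ring

theorem IsMatMulExponent.exists_invBound {ω : ℝ} (hω : IsMatMulExponent ω) :
    ∃ K : ℝ, 0 ≤ K ∧ ∀ n : ℕ, 1 ≤ n → ∃ t : ℕ, InvBound (Fin n) t ∧
      (t : ℝ) ≤ K * (n : ℝ) ^ ω := by
  obtain ⟨K, hK, hpow⟩ := hω.exists_invBound_two_pow
  have two_le := hω.two_le
  refine ⟨K * 2 ^ ω, by positivity, fun n hn => ?_⟩
  obtain ⟨L, pow_le, lt_pow⟩ := exists_nat_pow_near hn one_lt_two
  obtain ⟨t, ht, t_le⟩ := hpow (L + 1)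
  have e : Fin n ⊕ Fin (2 ^ (L + 1) - n) ≃ Fin (2 ^ (L + 1)) :=
    finSumFinEquiv.trans (finCongr (by omega))
  refine ⟨t, ht.embed e, t_le.trans ?_⟩
  have pow_le' : (2 : ℝ) ^ L ≤ n := by exact_mod_cast pow_le
  rw [mul_assoc K, ← Real.mul_rpow zero_le_two n.cast_nonneg, pow_succ']
  gcongr

/-! ### Programs from straight-line computations -/

section WriteReg

variable {ρ : Type}

theorem writeReg_same (σ : ρ → ℝ) (z : ρ) (r : ℝ) : writeReg σ z r z = r := if_pos rfl

theorem writeReg_ne (σ : ρ → ℝ) {z x : ρ} (r : ℝ) (h : x ≠ z) : writeReg σ z r x = σ x := if_neg h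

theorem writeReg_writeReg (σ : ρ → ℝ) (z : ρ) (r s : ℝ) :
    writeReg (writeReg σ z r) z s = writeReg σ z s := by
  funext x
  by_cases hx : x = z <;> simp [writeReg, hx]

end WriteReg

/-- There is a segment of a program that, in at most `t` instructions, changes the memory `σ` to a
memory `σ'` and determines a value `a` such that `R f σ a σ'`.  Values are determined by the branch
that is taken: the rest of the program is a family `K` indexed by them. -/
def HasSegment {ρ α : Type} (t : ℕ) (R : (ℝ → ℝ) → (ρ → ℝ) → α → (ρ → ℝ) → Prop) : Prop :=
  ∀ K : α → Prog ρ, ∃ P : Prog ρ, ∀ f σ, ∃ a σ', R f σ a σ' ∧ P.run f σ = (K a).run f σ' ∧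
    P.cost f σ ≤ (K a).cost f σ' + t

namespace HasSegment

variable {ρ α β : Type} {s t : ℕ} {R R' : (ℝ → ℝ) → (ρ → ℝ) → α → (ρ → ℝ) → Prop}

theorem mono (h : HasSegment s R) (hR : ∀ f σ a σ', R f σ a σ' → R' f σ a σ') (hst : s ≤ t) :
    HasSegment t R' := fun K => by
  obtain ⟨P, hP⟩ := h K
  refine ⟨P, fun f σ => ?_⟩
  obtain ⟨a, σ', ha, run_eq, cost_le⟩ := hP f σ
  exact ⟨a, σ', hR f σ a σ' ha, run_eq, cost_le.trans (by gcongr)⟩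

theorem weaken (h : HasSegment s R) (hst : s ≤ t) : HasSegment t R :=
  h.mono (fun _ _ _ _ => id) hst

theorem pure (a : α) : HasSegment (ρ := ρ) 0 fun _ σ b σ' => b = a ∧ σ' = σ :=
  fun K => ⟨K a, fun _ σ => ⟨a, σ, ⟨rfl, rfl⟩, rfl, le_rfl⟩⟩

theorem bind {S : α → (ℝ → ℝ) → (ρ → ℝ) → β → (ρ → ℝ) → Prop} {q : α → Prop}
    (h : HasSegment s R) (hq : ∀ f σ a σ', R f σ a σ' → q a)
    (h' : ∀ a, q a → HasSegment t (S a)) :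
    HasSegment (s + t) fun f σ b σ'' => ∃ a σ', R f σ a σ' ∧ S a f σ' b σ'' := fun K => by
  classical
  choose next hnext using fun a ha => h' a ha K
  obtain ⟨P, hP⟩ := h fun a => if ha : q a then next a ha else .halt
  refine ⟨P, fun f σ => ?_⟩
  obtain ⟨a, σ', ha, run_eq, cost_le⟩ := hP f σ
  have hqa := hq f σ a σ' ha
  obtain ⟨b, σ'', hb, run_next, cost_next⟩ := hnext a hqa f σ'
  simp only [dif_pos hqa] at run_eq cost_le
  exact ⟨b, σ'', ⟨a, σ', ha, hb⟩, run_eq.trans run_next, by omega⟩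

theorem seq {S : (ℝ → ℝ) → (ρ → ℝ) → β → (ρ → ℝ) → Prop} (h : HasSegment s R)
    (h' : HasSegment t S) :
    HasSegment (s + t) fun f σ b σ'' => ∃ a σ', R f σ a σ' ∧ S f σ' b σ'' :=
  h.bind (q := fun _ => True) (fun _ _ _ _ _ => trivial) fun _ _ => h'

theorem map (h : HasSegment t R) (g : α → β) :
    HasSegment t fun f σ b σ' => ∃ a, b = g a ∧ R f σ a σ' :=
  (h.bind (q := fun _ => True) (fun _ _ _ _ _ => trivial) fun a _ => pure (g a)).mono
    (by rintro f σ _ _ ⟨a, σ', ha, rfl, rfl⟩; exact ⟨a, rfl, ha⟩) le_rfl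

theorem const (z : ρ) (r : ℝ) :
    HasSegment 1 fun _ σ (_ : Unit) σ' => σ' = writeReg σ z r :=
  fun K => ⟨.const z r (K ()), fun _ _ => ⟨(), _, rfl, rfl, le_rfl⟩⟩

theorem arith (o : ArithOp) (z x y : ρ) :
    HasSegment 1 fun _ σ (_ : Unit) σ' => σ' = writeReg σ z (o.eval (σ x) (σ y)) :=
  fun K => ⟨.arith o z x y (K ()), fun _ _ => ⟨(), _, rfl, rfl, le_rfl⟩⟩

theorem sqrt (z x : ρ) :
    HasSegment 1 fun _ σ (_ : Unit) σ' => σ' = writeReg σ z (Real.sqrt (σ x)) :=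
  fun K => ⟨.sqrt z x (K ()), fun _ _ => ⟨(), _, rfl, rfl, le_rfl⟩⟩

theorem call (z x : ρ) :
    HasSegment 1 fun f σ (_ : Unit) σ' => σ' = writeReg σ z (f (σ x)) :=
  fun K => ⟨.call z x (K ()), fun _ _ => ⟨(), _, rfl, rfl, le_rfl⟩⟩

theorem lt (x y : ρ) : HasSegment 1 fun _ σ (b : Bool) σ' => (b = true ↔ σ x < σ y) ∧ σ' = σ := by
  intro K
  refine ⟨.ifLT x y (K true) (K false), fun f σ => ?_⟩
  by_cases h : σ x < σ y
  · exact ⟨true, σ, by simp [h], by simp [Prog.run, h], by simp [Prog.cost, h]⟩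
  · exact ⟨false, σ, by simp [h], by simp [Prog.run, h], by simp [Prog.cost, h]⟩

theorem copy {κ : Type} {dst src : κ → ρ} (hdst : Function.Injective dst)
    (hne : ∀ i j, dst i ≠ src j) (l : List κ) :
    HasSegment (2 * l.length) fun _ σ (_ : Unit) σ' =>
      (∀ i ∈ l, σ' (dst i) = σ (src i)) ∧ ∀ x, (∀ i ∈ l, x ≠ dst i) → σ' x = σ x := by
  induction l with
  | nil => exact (pure ()).mono (by simp) le_rfl
  | cons a l ih =>
    refine (((const (dst a) 0).seq (arith .add (dst a) (dst a) (src a))).seq ih).mono ?_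
      (by simp only [List.length_cons]; omega)
    rintro _ σ - σ' ⟨-, σ₁, ⟨-, σ₀, rfl, rfl⟩, copied, unchanged⟩
    rw [writeReg_writeReg, writeReg_same, writeReg_ne _ _ (hne a a).symm, ArithOp.eval, zero_add]
      at copied unchanged
    refine ⟨fun i hi => ?_, fun x hx => ?_⟩
    · by_cases hil : i ∈ l
      · rw [copied i hil, writeReg_ne _ _ (hne a i).symm]
      · obtain rfl : i = a := (List.mem_cons.1 hi).resolve_right hil
        rw [unchanged _ fun j hj h => hil (by rwa [hdst h]), writeReg_same]
    · rw [unchanged x fun i hi => hx i (List.mem_cons_of_mem _ hi),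
        writeReg_ne _ _ (hx a List.mem_cons_self)]

end HasSegment

/-- The quantities in `W` can be computed from those in `V` by a segment of `t` instructions that
writes into the scratch registers `tmp l` with `l ≥ n₀`, wherever else the quantities in `V` are
stored.  It leaves the scratch registers `tmp l` with `l ≥ n₁` free. -/
def Compiles {Ω ρ : Type} (c : Ω → ℝ → ℝ) (tmp : ℕ → ρ) (V : Set (Ω → ℝ)) (t : ℕ)
    (W : Set (Ω → ℝ)) : Prop :=
  ∀ (mem : Ω → ρ → ℝ) (n₀ : ℕ), (∀ g ∈ V, ∃ x, (∀ l ≥ n₀, x ≠ tmp l) ∧ ∀ ω, mem ω x = g ω) →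
    ∃ n₁ ≥ n₀, ∃ loc : W → ρ, (∀ g, ∀ l ≥ n₁, loc g ≠ tmp l) ∧
      HasSegment t fun f σ (_ : Unit) σ' => ∀ ω, f = c ω → σ = mem ω →
        (∀ g, σ' (loc g) = g.1 ω) ∧ ∀ x, (∀ l ≥ n₀, x ≠ tmp l) → σ' x = σ x

section Compile

variable {Ω ρ : Type} {c : Ω → ℝ → ℝ} {tmp : ℕ → ρ} {V W : Set (Ω → ℝ)} {t : ℕ} {g : Ω → ℝ}

theorem Instr.hasSegment (hg : Instr c V g) {mem : Ω → ρ → ℝ}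
    (hV : ∀ g ∈ V, ∃ x, ∀ ω, mem ω x = g ω) (z : ρ) :
    HasSegment 1 fun f σ (_ : Unit) σ' =>
      ∀ ω, f = c ω → σ = mem ω → σ' = writeReg (mem ω) z (g ω) := by
  cases hg with
  | const r => exact (HasSegment.const z r).mono (by rintro _ _ - _ rfl ω - rfl; rfl) le_rfl
  | arith o hg hh =>
    obtain ⟨x, hx⟩ := hV _ hg
    obtain ⟨y, hy⟩ := hV _ hh
    refine (HasSegment.arith o z x y).mono ?_ le_rfl
    rintro _ _ - _ rfl ω - rfl
    rw [hx, hy]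
  | sqrt hg =>
    obtain ⟨x, hx⟩ := hV _ hg
    refine (HasSegment.sqrt z x).mono ?_ le_rfl
    rintro _ _ - _ rfl ω - rfl
    rw [hx]
  | call hg =>
    obtain ⟨x, hx⟩ := hV _ hg
    refine (HasSegment.call z x).mono ?_ le_rfl
    rintro _ _ - _ rfl ω rfl rfl
    rw [hx]

theorem Compiles.step (htmp : Function.Injective tmp) (hg : Instr c V g)
    (h : Compiles c tmp (insert g V) t W) : Compiles c tmp V (t + 1) W := by
  intro mem n₀ hV
  let mem' (ω : Ω) : ρ → ℝ := writeReg (mem ω) (tmp n₀) (g ω)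
  have write := hg.hasSegment (mem := mem) (fun g hg => (hV g hg).imp fun _ hx => hx.2) (tmp n₀)
  have stored : ∀ g' ∈ insert g V,
      ∃ x, (∀ l ≥ n₀ + 1, x ≠ tmp l) ∧ ∀ ω, mem' ω x = g' ω := by
    rintro g' (rfl | hg')
    · exact ⟨tmp n₀, fun l hl h => absurd (htmp h) (by omega), fun ω => writeReg_same _ _ _⟩
    · obtain ⟨x, hx, hmem⟩ := hV g' hg'
      exact ⟨x, fun l hl => hx l (by omega), fun ω => by
        rw [← hmem]; exact writeReg_ne _ _ (hx n₀ le_rfl)⟩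
  obtain ⟨n₁, hn, loc, hloc, rest⟩ := h mem' (n₀ + 1) stored
  refine ⟨n₁, by omega, loc, hloc, (write.seq rest).mono ?_ (add_comm 1 t).le⟩
  rintro f σ - σ' ⟨-, σ₁, hσ₁, hσ'⟩ ω hf rfl
  obtain rfl := hσ₁ ω hf rfl
  obtain ⟨values, unchanged⟩ := hσ' ω hf rfl
  exact ⟨values, fun x hx => (unchanged x fun l hl => hx l (by omega)).trans
    (writeReg_ne _ _ (hx n₀ le_rfl))⟩

theorem StraightLine.compiles (H : StraightLine c V t W) (htmp : Function.Injective tmp) :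
    Compiles c tmp V t W := by
  induction H with
  | @done V' _ _ hW =>
    intro mem n₀ hV
    choose loc hloc hmem using fun g : V' => hV g g.2
    refine ⟨n₀, le_rfl, fun g => loc ⟨g, hW g.2⟩, fun g => hloc _,
      (HasSegment.pure ()).mono ?_ (Nat.zero_le _)⟩
    rintro f σ - σ' ⟨-, rfl⟩ ω - rfl
    exact ⟨fun g => hmem _ ω, fun _ _ => rfl⟩
  | step hg _ ih => exact ih.step htmp hg

/-- The outputs are first copied to scratch registers, because the registers `dst i` that are to
receive them may still hold other outputs. -/
theorem StraightLine.hasSegment {κ : Type} [Fintype κ] (H : StraightLine c V t W)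
    (htmp : Function.Injective tmp) {mem : Ω → ρ → ℝ}
    (hV : ∀ g ∈ V, ∃ x, (∀ l, x ≠ tmp l) ∧ ∀ ω, mem ω x = g ω) {dst : κ → ρ}
    (hdst : Function.Injective dst) (hdt : ∀ i l, dst i ≠ tmp l) {out : κ → Ω → ℝ}
    (hout : ∀ i, out i ∈ W) :
    HasSegment (t + 4 * Fintype.card κ) fun f σ (_ : Unit) σ' => ∀ ω, f = c ω → σ = mem ω →
      (∀ i, σ' (dst i) = out i ω) ∧
        ∀ x, (∀ i, x ≠ dst i) → (∀ l, x ≠ tmp l) → σ' x = σ x := by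
  obtain ⟨n₁, -, loc, hloc, compute⟩ := H.compiles htmp mem 0 fun g hg =>
    (hV g hg).imp fun x hx => ⟨fun l _ => hx.1 l, hx.2⟩
  let scratch (i : κ) : ρ := tmp (n₁ + Fintype.equivFin κ i)
  have scratch_injective : Function.Injective scratch := fun i j h =>
    (Fintype.equivFin κ).injective (Fin.ext (Nat.add_left_cancel (htmp h)))
  have copy_out := HasSegment.copy (src := fun i => loc ⟨out i, hout i⟩) scratch_injective
    (fun i j h => hloc _ _ (Nat.le_add_right _ _) h.symm) Finset.univ.toList
  have move := HasSegment.copy hdst (fun i j => hdt i _ : ∀ i j, dst i ≠ scratch j)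
    Finset.univ.toList
  rw [Finset.length_toList, Finset.card_univ] at copy_out move
  refine (compute.seq (copy_out.seq move)).mono ?_ (by omega)
  rintro f σ - σ₃ ⟨-, σ₁, hσ₁, -, σ₂, ⟨copied, unchanged₂⟩, moved, unchanged₃⟩ ω hf hσ
  obtain ⟨values, unchanged₁⟩ := hσ₁ ω hf hσ
  refine ⟨fun i => ?_, fun x hx hxt => ?_⟩
  · rw [moved i (by simp), copied i (by simp), values]
  · rw [unchanged₃ x fun i _ => hx i, unchanged₂ x fun i _ => hxt _, unchanged₁ x fun l _ => hxt l]

end Compile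

section Store

variable {n d : ℕ} {Ω : Type}

/-- The registers written by `Initialize` and `Update`; the vectors `ũ`, `ṽ`, `w`, `f(ṽ)`, `r` have
the numbers `0, …, 4`. -/
def outReg : (Fin n × Fin n) ⊕ (Fin 5 × Fin n) → DSReg n d
  | .inl (i, j) => .M i j
  | .inr (0, i) => .ut i
  | .inr (1, i) => .vt i
  | .inr (2, i) => .w i
  | .inr (3, i) => .fv i
  | .inr (4, i) => .r i

theorem outReg_injective : Function.Injective (outReg (n := n) (d := d)) := by
  rintro (⟨i, j⟩ | ⟨k, i⟩) (⟨i', j'⟩ | ⟨k', i'⟩) h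
  · simpa [outReg] using h
  · fin_cases k' <;> simp [outReg] at h
  · fin_cases k <;> simp [outReg] at h
  · fin_cases k <;> fin_cases k' <;> simp_all [outReg]

/-- The contents of the registers other than the scratch registers, as quantities of a straight-line
computation whose inputs are memories. -/
def regReads (mem : Ω → DSReg n d → ℝ) : Set (Ω → ℝ) :=
  {g | ∃ x : DSReg n d, (∀ l, x ≠ .tmp l) ∧ ∀ ω, mem ω x = g ω}

theorem mem_regReads (mem : Ω → DSReg n d → ℝ) {x : DSReg n d} (hx : ∀ l, x ≠ .tmp l) :
    (fun ω => mem ω x) ∈ regReads mem := ⟨x, hx, fun _ => rfl⟩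

theorem StraightLine.exists_prog {c : Ω → ℝ → ℝ} {W : Set (Ω → ℝ)} {t : ℕ}
    {mem : Ω → DSReg n d → ℝ} (H : StraightLine c (regReads mem) t W) (s : Ω → DSState n)
    (fv r : Ω → Fin n → ℝ) (hM : entries (fun ω => (s ω).M) ⊆ W)
    (hut : ∀ i, (fun ω => (s ω).ut i) ∈ W) (hvt : ∀ i, (fun ω => (s ω).vt i) ∈ W)
    (hw : ∀ i, (fun ω => (s ω).w i) ∈ W) (hfv : ∀ i, (fun ω => fv ω i) ∈ W)
    (hr : ∀ i, (fun ω => r ω i) ∈ W) :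
    ∃ P : Prog (DSReg n d), ∀ ω, P.cost (c ω) (mem ω) ≤ t + 4 * (n * n + 5 * n) ∧
      HoldsState (P.run (c ω) (mem ω)) (s ω) ∧ (∀ i, P.run (c ω) (mem ω) (.fv i) = fv ω i) ∧
      (∀ i, P.run (c ω) (mem ω) (.r i) = r ω i) ∧
      (∀ i j, P.run (c ω) (mem ω) (.A i j) = mem ω (.A i j)) ∧
      P.run (c ω) (mem ω) .eps = mem ω .eps := by
  let out : (Fin n × Fin n) ⊕ (Fin 5 × Fin n) → Ω → ℝ
    | .inl (i, j) => fun ω => (s ω).M i j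
    | .inr (0, i) => fun ω => (s ω).ut i
    | .inr (1, i) => fun ω => (s ω).vt i
    | .inr (2, i) => fun ω => (s ω).w i
    | .inr (3, i) => fun ω => fv ω i
    | .inr (4, i) => fun ω => r ω i
  have outReg_ne {x : DSReg n d} (hM : ∀ i j, .M i j ≠ x) (hut : ∀ i, .ut i ≠ x)
      (hvt : ∀ i, .vt i ≠ x) (hw : ∀ i, .w i ≠ x) (hfv : ∀ i, .fv i ≠ x) (hr : ∀ i, .r i ≠ x) :
      ∀ y, outReg y ≠ x := by
    rintro (⟨i, j⟩ | ⟨k, i⟩)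
    · exact hM i j
    · fin_cases k
      exacts [hut i, hvt i, hw i, hfv i, hr i]
  have hout : ∀ y, out y ∈ W := by
    rintro (⟨i, j⟩ | ⟨k, i⟩)
    · exact mem_of_entries_subset hM i j
    · fin_cases k
      exacts [hut i, hvt i, hw i, hfv i, hr i]
  obtain ⟨P, hP⟩ := H.hasSegment (fun _ _ h => DSReg.tmp.inj h) (fun _ hg => hg) outReg_injective
    (fun y l => outReg_ne (by simp) (by simp) (by simp) (by simp) (by simp) (by simp) y) hout
    fun _ => .halt
  refine ⟨P, fun ω => ?_⟩
  obtain ⟨-, σ', hσ', run_eq, cost_le⟩ := hP (c ω) (mem ω)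
  obtain ⟨values, unchanged⟩ := hσ' ω rfl rfl
  simp only [run_eq, Prog.run, Prog.cost, zero_add] at cost_le ⊢
  refine ⟨by simpa using cost_le, ⟨fun i j => values (.inl (i, j)), fun i => values (.inr (0, i)),
    fun i => values (.inr (1, i)), fun i => values (.inr (2, i))⟩, fun i => values (.inr (3, i)),
    fun i => values (.inr (4, i)), fun i j => unchanged _ (fun y => ?_) (by simp),
    unchanged _ (fun y => ?_) (by simp)⟩ <;>
  exact (outReg_ne (by simp) (by simp) (by simp) (by simp) (by simp) (by simp) y).symm

end Store

/-! ### Initialization -/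

section Initialize

open Matrix

theorem posDef_gram {n d : ℕ} {A : Matrix (Fin d) (Fin n) ℝ} (hA : A.rank = d) {u : Fin n → ℝ}
    (hu : ∀ i, 0 < u i) : (A * diagonal u * Aᵀ).PosDef := by
  rw [← conjTranspose_eq_transpose_of_trivial]
  refine (PosDef.diagonal hu).mul_mul_conjTranspose_same ?_
  rw [vecMul_injective_iff, linearIndependent_iff_card_eq_finrank_span, Fintype.card_fin]
  exact hA.symm.trans (rank_eq_finrank_span_row A)

theorem MulBound.thin {n d q t : ℕ} (h : MulBound (Fin d) (Fin d) (Fin d) t) (hdt : d ^ 2 ≤ t)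
    (hq : 1 ≤ q) (hn : n ≤ q * d) :
    MulBound (Fin d) (Fin n) (Fin d) (2 * (q * (q * t))) ∧
      MulBound (Fin n) (Fin d) (Fin d) (2 * (q * (q * t))) ∧
      MulBound (Fin n) (Fin d) (Fin n) (2 * (q * (q * t))) := by
  have e : Fin n ↪ Fin q × Fin d := (Fin.castLEEmb hn).trans finProdFinEquiv.symm.toEmbedding
  have le_mul : q * t ≤ q * (q * t) := Nat.mul_le_mul_left _ (Nat.le_mul_of_pos_left _ hq)
  refine ⟨(h.blocks_mid (Q := Fin q)).embed (.refl _) e (.refl _) |>.mono ?_,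
    (h.blocks_left (Q := Fin q)).embed e (.refl _) (.refl _) |>.mono ?_,
    (h.blocks_right (Q := Fin q)).blocks_left (Q := Fin q) |>.embed e (.refl _) e |>.mono ?_⟩ <;>
  simp only [Fintype.card_fin]
  · nlinarith
  · nlinarith
  · omega

theorem IsMatMulExponent.exists_thin_mulBound {ω : ℝ} (hω : IsMatMulExponent ω) :
    ∃ K : ℝ, 0 ≤ K ∧ ∀ n d : ℕ, 1 ≤ d → d ≤ n → ∃ t : ℕ,
      MulBound (Fin d) (Fin n) (Fin d) t ∧ MulBound (Fin n) (Fin d) (Fin d) t ∧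
      MulBound (Fin n) (Fin d) (Fin n) t ∧
      (t : ℝ) ≤ K * ((n : ℝ) ^ 2 * (d : ℝ) ^ (ω - 2)) := by
  obtain ⟨K, hK, hmul⟩ := hω.exists_mulBound
  refine ⟨8 * K, by positivity, fun n d hd hdn => ?_⟩
  obtain ⟨t, ht, hdt, t_le⟩ := hmul d hd
  have hdpos : (0 : ℝ) < d := by exact_mod_cast hd
  have hn : n ≤ (n / d + 1) * d := (mul_comm d _ ▸ Nat.lt_mul_div_succ n hd).le
  have blocks_le : ((n / d + 1 : ℕ) : ℝ) ≤ 2 * (n / d) := by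
    have one_le : (1 : ℝ) ≤ n / d := (one_le_div hdpos).2 (by exact_mod_cast hdn)
    have floor_le : ((n / d : ℕ) : ℝ) ≤ (n : ℝ) / d := Nat.cast_div_le
    push_cast
    linarith
  obtain ⟨h₁, h₂, h₃⟩ := ht.thin hdt (Nat.succ_pos _) hn
  refine ⟨_, h₁, h₂, h₃, ?_⟩
  calc ((2 * ((n / d + 1) * ((n / d + 1) * t)) : ℕ) : ℝ)
      = 2 * (((n / d + 1 : ℕ) : ℝ) * (((n / d + 1 : ℕ) : ℝ) * t)) := by push_cast; ring
    _ ≤ 2 * ((2 * (n / d)) * ((2 * (n / d)) * (K * (d : ℝ) ^ ω))) := by gcongr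
    _ = 8 * K * ((n : ℝ) ^ 2 * ((d : ℝ) ^ ω / (d : ℝ) ^ 2)) := by
      field_simp
      ring
    _ = 8 * K * ((n : ℝ) ^ 2 * (d : ℝ) ^ (ω - 2)) := by
      rw [Real.rpow_sub hdpos, Real.rpow_two]

variable {n d s t : ℕ} {Ω : Type} {c : Ω → ℝ → ℝ} {V : Set (Ω → ℝ)} {u v : Ω → Fin n → ℝ}

theorem straightLine_projCore (h₁ : MulBound (Fin d) (Fin n) (Fin d) t)
    (h₂ : MulBound (Fin n) (Fin d) (Fin d) t) (h₃ : MulBound (Fin n) (Fin d) (Fin n) t)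
    (hi : InvBound (Fin d) s) {A : Ω → Matrix (Fin d) (Fin n) ℝ} (h0 : (fun _ => 0) ∈ V)
    (h1 : (fun _ => 1) ∈ V) (hA : entries A ⊆ V) (hu : ∀ i, (fun ω => u ω i) ∈ V)
    (hpos : ∀ ω, (A ω * diagonal (u ω) * (A ω)ᵀ).PosDef) :
    StraightLine c V (d * n + 3 * t + s) (entries fun ω => projCore (A ω) (u ω)) := by
  have hAt : entries (fun ω => (A ω)ᵀ) ⊆ V :=
    entries_subset fun i j => mem_of_entries_subset hA j i
  let V₁ := V ∪ entries fun ω => A ω * diagonal (u ω)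
  let V₂ := V₁ ∪ entries fun ω => A ω * diagonal (u ω) * (A ω)ᵀ
  let V₃ := V₂ ∪ entries fun ω => (A ω * diagonal (u ω) * (A ω)ᵀ)⁻¹
  let V₄ := V₃ ∪ entries fun ω => (A ω)ᵀ * (A ω * diagonal (u ω) * (A ω)ᵀ)⁻¹
  have scale := StraightLine.matrix (c := c) (V := V) (t := 1)
    (X := fun ω => A ω * diagonal (u ω)) fun i j => by
      simp only [mul_diagonal]
      exact (StraightLine.of_mem (mem_of_entries_subset hA i j)).mul (.of_mem (hu j))
  have gram := h₁ Ω c V₁ _ _ (.inl h0) Set.subset_union_right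
    (hAt.trans Set.subset_union_left)
  have inverse := hi Ω c V₂ _ (.inl (.inl h0)) (.inl (.inl h1)) Set.subset_union_right hpos
  have mul_inverse := h₂ Ω c V₃ _ _ (.inl (.inl (.inl h0)))
    (hAt.trans fun _ h => .inl (.inl (.inl h))) Set.subset_union_right
  have mul_A := h₃ Ω c V₄ _ _ (.inl (.inl (.inl (.inl h0)))) Set.subset_union_right
    (hA.trans fun _ h => .inl (.inl (.inl (.inl h))))
  refine (scale.trans (gram.trans (inverse.trans (mul_inverse.trans mul_A)))).weaken ?_
  simp only [Fintype.card_fin]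
  omega

theorem straightLine_mulVec_sqrtMul {M : Ω → Matrix (Fin n) (Fin n) ℝ} (h0 : (fun _ => 0) ∈ V)
    (hM : entries M ⊆ V) (hu : ∀ i, (fun ω => u ω i) ∈ V) (hv : ∀ i, (fun ω => v ω i) ∈ V) :
    StraightLine c V (n * 3 + n * (n * 2))
      (Set.range fun i => fun ω => (M ω).mulVec (sqrtMul (c ω) (u ω) (v ω)) i) := by
  have vector := StraightLine.range (c := c) (V := V) (t := 3)
    (u := fun i => fun ω => sqrtMul (c ω) (u ω) (v ω) i) fun i =>
      (StraightLine.of_mem (hu i)).sqrt.mul (StraightLine.of_mem (hv i)).call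
  have product := StraightLine.mulVec (c := c) (X := M)
    (y := fun ω => sqrtMul (c ω) (u ω) (v ω))
    (V := V ∪ Set.range fun i => fun ω => sqrtMul (c ω) (u ω) (v ω) i) (.inl h0)
    (hM.trans Set.subset_union_left) fun i => .inr ⟨i, rfl⟩
  simpa only [Fintype.card_fin] using vector.trans product

theorem exists_implementsInit (h₁ : MulBound (Fin d) (Fin n) (Fin d) t)
    (h₂ : MulBound (Fin n) (Fin d) (Fin d) t) (h₃ : MulBound (Fin n) (Fin d) (Fin n) t)
    (hi : InvBound (Fin d) s) :
    ∃ P : Prog (DSReg n d), ∀ (A : Matrix (Fin d) (Fin n) ℝ) (ε : ℝ) (f : ℝ → ℝ) (u v : Fin n → ℝ),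
      A.rank = d → (∀ i, 0 < u i) → ImplementsInit P A ε f u v ∧
        ∀ σ, HoldsData σ A ε → HoldsInput σ u v →
          P.cost f σ ≤ 3 * t + s + d * n + 6 * n * n + 23 * n + 2 := by
  let Ω := {p : (ℝ → ℝ) × (DSReg n d → ℝ) //
    (of fun i j => p.2 (.A i j) : Matrix (Fin d) (Fin n) ℝ).rank = d ∧ ∀ i, 0 < p.2 (.un i)}
  let A (ω : Ω) : Matrix (Fin d) (Fin n) ℝ := of fun i j => ω.1.2 (.A i j)
  let u (ω : Ω) (i : Fin n) : ℝ := ω.1.2 (.un i)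
  let v (ω : Ω) (i : Fin n) : ℝ := ω.1.2 (.vn i)
  let V := regReads fun ω : Ω => ω.1.2
  have hA : entries A ⊆ V := entries_subset fun i j => mem_regReads _ (x := .A i j) (by simp)
  have hu (i) : (fun ω => u ω i) ∈ V := mem_regReads _ (x := .un i) (by simp)
  have hv (i) : (fun ω => v ω i) ∈ V := mem_regReads _ (x := .vn i) (by simp)
  let c (ω : Ω) : ℝ → ℝ := ω.1.1
  let V₁ := V ∪ ({fun _ => 0} ∪ {fun _ => 1})
  let V₂ := V₁ ∪ entries fun ω => projCore (A ω) (u ω)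
  have constants := (StraightLine.const (c := c) (V := V) 0).union (.const 1)
  have core := straightLine_projCore (c := c) (V := V₁) (A := A) h₁ h₂ h₃ hi (.inr (.inl rfl))
    (.inr (.inr rfl)) (hA.trans Set.subset_union_left) (fun i => .inl (hu i))
    fun ω => posDef_gram ω.2.1 ω.2.2
  have product := straightLine_mulVec_sqrtMul (c := c) (V := V₂) (u := u) (v := v)
    (.inl (.inr (.inl rfl))) Set.subset_union_right (fun i => .inl (.inl (hu i)))
    fun i => .inl (.inl (hv i))
  obtain ⟨P, hP⟩ := (constants.trans (core.trans product.union_left)).exists_prog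
    (fun ω => initState (A ω) (c ω) (u ω) (v ω)) u u (fun _ h => .inl (.inr h))
    (fun i => .inl (.inl (.inl (hu i)))) (fun i => .inl (.inl (.inl (hv i))))
    (fun i => .inr ⟨i, rfl⟩) (fun i => .inl (.inl (.inl (hu i))))
    (fun i => .inl (.inl (.inl (hu i))))
  refine ⟨P, fun A ε f u v hA hu => ?_⟩
  have prog_spec (σ : DSReg n d → ℝ) (hdata : HoldsData σ A ε) (hin : HoldsInput σ u v) :
      (HoldsData (P.run f σ) A ε ∧ HoldsState (P.run f σ) (initState A f u v)) ∧
        P.cost f σ ≤ 3 * t + s + d * n + 6 * n * n + 23 * n + 2 := by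
    obtain rfl : (of fun i j => σ (.A i j)) = A := by ext i j; exact hdata.1 i j
    obtain rfl : (fun i => σ (.un i)) = u := funext hin.1
    obtain rfl : (fun i => σ (.vn i)) = v := funext hin.2
    obtain ⟨cost_le, holds, -, -, hA', heps⟩ := hP ⟨(f, σ), hA, hu⟩
    exact ⟨⟨⟨hA', heps.trans hdata.2⟩, holds⟩, cost_le.trans (by ring_nf; omega)⟩
  exact ⟨fun σ hdata hin => (prog_spec σ hdata hin).1, fun σ hdata hin => (prog_spec σ hdata hin).2⟩

theorem IsMatMulExponent.exists_implementsInit {ω : ℝ} (hω : IsMatMulExponent ω) :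
    ∃ K : ℝ, ∀ n d : ℕ, 1 ≤ d → d ≤ n → ∃ P : Prog (DSReg n d),
      ∀ (A : Matrix (Fin d) (Fin n) ℝ) (ε : ℝ) (f : ℝ → ℝ) (u v : Fin n → ℝ),
        A.rank = d → (∀ i, 0 < u i) → ImplementsInit P A ε f u v ∧
          ∀ σ, HoldsData σ A ε → HoldsInput σ u v →
            (P.cost f σ : ℝ) ≤ K * ((n : ℝ) ^ 2 * (d : ℝ) ^ (ω - 2)) := by
  obtain ⟨K₁, -, hthin⟩ := hω.exists_thin_mulBound
  obtain ⟨K₂, hK₂, hinv⟩ := hω.exists_invBound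
  have two_le := hω.two_le
  refine ⟨3 * K₁ + K₂ + 32, fun n d hd hdn => ?_⟩
  obtain ⟨t, h₁, h₂, h₃, t_le⟩ := hthin n d hd hdn
  obtain ⟨s, hs, s_le⟩ := hinv d hd
  obtain ⟨P, hP⟩ := _root_.exists_implementsInit h₁ h₂ h₃ hs
  refine ⟨P, fun A ε f u v hA hu => ⟨(hP A ε f u v hA hu).1, fun σ hdata hin => ?_⟩⟩
  have hd' : (1 : ℝ) ≤ d := by exact_mod_cast hd
  have hdn' : (d : ℝ) ≤ n := by exact_mod_cast hdn
  have sq_le : (n : ℝ) ^ 2 ≤ (n : ℝ) ^ 2 * (d : ℝ) ^ (ω - 2) :=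
    le_mul_of_one_le_right (by positivity) (Real.one_le_rpow hd' (by linarith))
  have s_le' : (s : ℝ) ≤ K₂ * ((n : ℝ) ^ 2 * (d : ℝ) ^ (ω - 2)) := by
    calc (s : ℝ) ≤ K₂ * (d : ℝ) ^ ω := s_le
      _ = K₂ * ((d : ℝ) ^ 2 * (d : ℝ) ^ (ω - 2)) := by
        rw [← Real.rpow_two, ← Real.rpow_add (by linarith), add_sub_cancel]
      _ ≤ K₂ * ((n : ℝ) ^ 2 * (d : ℝ) ^ (ω - 2)) := by gcongr
  have lower_order : (d : ℝ) * n + 6 * n * n + 23 * n + 2 ≤ 32 * (n : ℝ) ^ 2 := by nlinarith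
  calc (P.cost f σ : ℝ)
      ≤ 3 * t + s + d * n + 6 * n * n + 23 * n + 2 := by
        exact_mod_cast (hP A ε f u v hA hu).2 σ hdata hin
    _ ≤ (3 * K₁ + K₂ + 32) * ((n : ℝ) ^ 2 * (d : ℝ) ^ (ω - 2)) := by linarith

end Initialize

/-! ### Rank updates -/

section Woodbury

open Matrix

theorem isUnit_inv_add_mul_inv_mul {I J : Type} [Fintype I] [DecidableEq I] [Fintype J]
    [DecidableEq J] {G : Matrix I I ℝ} {U : Matrix I J ℝ} {D : Matrix J J ℝ} {V : Matrix J I ℝ}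
    (hG : IsUnit G) (hD : IsUnit D) (h : IsUnit (G + U * D * V)) :
    IsUnit (D⁻¹ + V * G⁻¹ * U) := by
  rw [isUnit_iff_isUnit_det] at hG hD h ⊢
  have factor : 1 + V * G⁻¹ * (U * D) = (D⁻¹ + V * G⁻¹ * U) * D := by
    rw [Matrix.add_mul, nonsing_inv_mul _ hD, Matrix.mul_assoc (V * G⁻¹)]
  rw [det_add_mul (U * D) V hG, factor, det_mul] at h
  exact isUnit_of_mul_isUnit_left (isUnit_of_mul_isUnit_right h)

variable {n d : ℕ} {A : Matrix (Fin d) (Fin n) ℝ} {u u' : Fin n → ℝ} {S : Finset (Fin n)}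

theorem gram_eq_add_of_eq_off (h : ∀ i ∉ S, u' i = u i) :
    let AS : Matrix (Fin d) S ℝ := A.submatrix id Subtype.val
    A * diagonal u' * Aᵀ = A * diagonal u * Aᵀ + AS * diagonal (fun i : S => (u' - u) i) * ASᵀ := by
  ext i j
  simp only [Matrix.add_apply, mul_apply (N := _ᵀ), mul_diagonal, transpose_apply,
    submatrix_apply, id_eq, Pi.sub_apply]
  rw [Finset.sum_coe_sort S fun x => A i x * (u' x - u x) * A j x,
    Finset.sum_subset (Finset.subset_univ S) fun x _ hx => by rw [h x hx]; ring,
    ← Finset.sum_add_distrib]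
  exact Finset.sum_congr rfl fun x _ => by ring

/-- The capacitance matrix `Δ_{S,S}⁻¹ + M_{S,S}` of the rank update with the batch `S`, where
`Δ = diag(δ)`. -/
noncomputable def capMatrix (M : Matrix (Fin n) (Fin n) ℝ) (δ : Fin n → ℝ)
    (S : Finset (Fin n)) : Matrix S S ℝ :=
  (diagonal fun i : S => δ i)⁻¹ + M.submatrix Subtype.val Subtype.val

theorem isUnit_diagonal_sub (h : ∀ i ∈ S, u' i ≠ u i) :
    IsUnit (diagonal fun i : S => (u' - u) i) :=
  isUnit_diagonal.2 (Pi.isUnit_iff.2 fun i => (sub_ne_zero.2 (h i i.2)).isUnit)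

theorem isUnit_capMatrix_projCore (hA : A.rank = d) (hu : ∀ i, 0 < u i) (hu' : ∀ i, 0 < u' i)
    (hS : ∀ i ∈ S, u' i ≠ u i) (hSc : ∀ i ∉ S, u' i = u i) :
    IsUnit (capMatrix (projCore A u) (u' - u) S) :=
  isUnit_inv_add_mul_inv_mul (posDef_gram hA hu).isUnit (isUnit_diagonal_sub hS)
    (gram_eq_add_of_eq_off hSc ▸ (posDef_gram hA hu').isUnit)

theorem projCore_sub_woodburyTerm (hA : A.rank = d) (hu : ∀ i, 0 < u i) (hu' : ∀ i, 0 < u' i)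
    (hS : ∀ i ∈ S, u' i ≠ u i) (hSc : ∀ i ∉ S, u' i = u i) :
    projCore A u - woodburyTerm (projCore A u) (u' - u) S = projCore A u' := by
  let AS : Matrix (Fin d) S ℝ := A.submatrix id Subtype.val
  let G := A * diagonal u * Aᵀ
  let D : Matrix S S ℝ := diagonal fun i => (u' - u) i
  have hGt : (G⁻¹)ᵀ = G⁻¹ := by
    rw [transpose_nonsing_inv, ← conjTranspose_eq_transpose_of_trivial,
      (posDef_gram hA hu).isHermitian.eq]
  have hM : projCore A u = Aᵀ * G⁻¹ * A := rfl
  have hW : woodburyTerm (projCore A u) (u' - u) S =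
      (Aᵀ * G⁻¹ * AS) * (D⁻¹ + ASᵀ * G⁻¹ * AS)⁻¹ * (Aᵀ * G⁻¹ * AS)ᵀ := rfl
  have hgram : A * diagonal u' * Aᵀ = G + AS * D * ASᵀ := gram_eq_add_of_eq_off hSc
  rw [hW, hM, projCore, hgram, add_mul_mul_inv_eq_sub G AS D ASᵀ
    (posDef_gram hA hu).isUnit (isUnit_diagonal_sub hS)
    (isUnit_capMatrix_projCore hA hu hu' hS hSc)]
  simp only [transpose_mul, transpose_transpose, hGt, Matrix.mul_sub, Matrix.sub_mul,
    Matrix.mul_assoc]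

variable {s t : ℕ} {Ω : Type} {c : Ω → ℝ → ℝ} {V : Set (Ω → ℝ)}
  {M : Ω → Matrix (Fin n) (Fin n) ℝ} {δ : Ω → Fin n → ℝ}

theorem capMatrix_apply {M : Matrix (Fin n) (Fin n) ℝ} {δ : Fin n → ℝ} (hδ : ∀ i ∈ S, δ i ≠ 0)
    (i j : S) : capMatrix M δ S i j = if i = j then 1 / δ i + M i j else M i j := by
  have inv_diagonal : (diagonal fun i : S => δ i)⁻¹ = diagonal fun i : S => 1 / δ i := by
    refine inv_eq_right_inv ?_
    rw [diagonal_mul_diagonal, ← diagonal_one]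
    exact congrArg diagonal (funext fun i => mul_one_div_cancel (hδ i i.2))
  rw [capMatrix, inv_diagonal, Matrix.add_apply, diagonal_apply, submatrix_apply]
  split_ifs <;> simp

theorem straightLine_capMatrix (h1 : (fun _ => 1) ∈ V) (hM : entries M ⊆ V)
    (hδV : ∀ i, (fun ω => δ ω i) ∈ V) (hδ : ∀ ω, ∀ i ∈ S, δ ω i ≠ 0) :
    StraightLine c V (n * n * 2) (entries fun ω => capMatrix (M ω) (δ ω) S) := by
  have hcard : Fintype.card S ≤ n := by simpa using Finset.card_le_univ S
  refine (StraightLine.matrix (t := 2) fun i j => ?_).weaken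
    (Nat.mul_le_mul_right 2 (Nat.mul_le_mul hcard hcard))
  simp only [capMatrix_apply (hδ _)]
  have hMij := StraightLine.of_mem (c := c) (mem_of_entries_subset hM i j)
  by_cases hij : i = j
  · simp only [if_pos hij]
    exact ((StraightLine.of_mem h1).div (.of_mem (hδV i))).add hMij
  · simp only [if_neg hij]
    exact hMij.weaken (Nat.zero_le 2)

theorem straightLine_woodburyTerm (hm : MulBound (Fin n) (Fin S.card) (Fin n) t)
    (hi : InvBound (Fin S.card) s) (h0 : (fun _ => 0) ∈ V) (h1 : (fun _ => 1) ∈ V)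
    (hM : entries M ⊆ V) (hδV : ∀ i, (fun ω => δ ω i) ∈ V) (hδ : ∀ ω, ∀ i ∈ S, δ ω i ≠ 0)
    (hcap : ∀ ω, IsUnit (capMatrix (M ω) (δ ω) S)) :
    StraightLine c V (4 * t + s + n * n * 2) (entries fun ω => woodburyTerm (M ω) (δ ω) S) := by
  let MS (ω : Ω) : Matrix (Fin n) S ℝ := (M ω).submatrix id Subtype.val
  let Z (ω : Ω) : Matrix S S ℝ := capMatrix (M ω) (δ ω) S
  have hMS : entries MS ⊆ V := entries_subset fun i j => mem_of_entries_subset hM i j.val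
  have hMSt : entries (fun ω => (MS ω)ᵀ) ⊆ V :=
    entries_subset fun i j => mem_of_entries_subset hM j i.val
  have e : S ≃ Fin S.card := S.equivFin
  have mul_nSn : MulBound (Fin n) S (Fin n) t := hm.embed (.refl _) e.toEmbedding (.refl _)
  have mul_nSS : MulBound (Fin n) S S t := mul_nSn.embed (.refl _) (.refl _) (.subtype _)
  have mul_SSS : MulBound S S S t := mul_nSS.embed (.subtype _) (.refl _) (.refl _)
  have inv_S : InvBound S s := hi.embed (J := Empty) ((Equiv.sumEmpty _ _).trans e)
  let V₁ := V ∪ entries Z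
  let V₂ := V₁ ∪ entries fun ω => (Z ω)⁻¹
  let V₃ := V₂ ∪ entries fun ω => MS ω * (Z ω)⁻¹
  have cap := straightLine_capMatrix (c := c) h1 hM hδV hδ
  have inverse := inv_S.straightLine_inv mul_SSS (c := c) (V := V₁) (X := Z) (.inl h0) (.inl h1)
    Set.subset_union_right hcap
  have mul_inverse := mul_nSS Ω c V₂ _ _ (.inl (.inl h0)) (hMS.trans fun _ h => .inl (.inl h))
    Set.subset_union_right
  have mul_transpose := mul_nSn Ω c V₃ _ _ (.inl (.inl (.inl h0))) Set.subset_union_right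
    (hMSt.trans fun _ h => .inl (.inl (.inl h)))
  exact (cap.trans (inverse.trans (mul_inverse.trans mul_transpose))).weaken (by omega)

end Woodbury

section Batch

open Matrix

variable {n d : ℕ}

/-- The variables after a rank update of the state `x` with the batch `S`. -/
noncomputable def batchState (f : ℝ → ℝ) (x : DSState n) (un vn : Fin n → ℝ)
    (S : Finset (Fin n)) : DSState n :=
  let ut := S.piecewise un x.ut
  let M := x.M - woodburyTerm x.M (ut - x.ut) S
  { M := M, ut := ut, vt := vn, w := M.mulVec (sqrtMul f ut vn) }

theorem piecewise_apply_mem {Ω : Type} {V : Set (Ω → ℝ)} {S : Finset (Fin n)}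
    {u u' : Ω → Fin n → ℝ} (hu : ∀ i, (fun ω => u ω i) ∈ V) (hu' : ∀ i, (fun ω => u' ω i) ∈ V)
    (i : Fin n) : (fun ω => S.piecewise (u ω) (u' ω) i) ∈ V := by
  by_cases h : i ∈ S
  · simpa [h] using hu i
  · simpa [h] using hu' i

theorem straightLine_batchState {S : Finset (Fin n)} {t s : ℕ}
    (hm : MulBound (Fin n) (Fin S.card) (Fin n) t) (hi : InvBound (Fin S.card) s) {Ω : Type}
    {c : Ω → ℝ → ℝ} {V : Set (Ω → ℝ)} {x : Ω → DSState n} {un vn : Ω → Fin n → ℝ}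
    (hM : entries (fun ω => (x ω).M) ⊆ V) (hut : ∀ i, (fun ω => (x ω).ut i) ∈ V)
    (hun : ∀ i, (fun ω => un ω i) ∈ V) (hvn : ∀ i, (fun ω => vn ω i) ∈ V)
    (hne : ∀ ω, ∀ i ∈ S, un ω i ≠ (x ω).ut i)
    (hcap : ∀ ω, IsUnit (capMatrix (x ω).M (S.piecewise (un ω) (x ω).ut - (x ω).ut) S)) :
    StraightLine c V (4 * t + s + 5 * (n * n) + 4 * n + 2)
      (V ∪ entries (fun ω => (batchState (c ω) (x ω) (un ω) (vn ω) S).M) ∪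
        Set.range fun i => fun ω => (batchState (c ω) (x ω) (un ω) (vn ω) S).w i) := by
  let y (ω : Ω) : DSState n := batchState (c ω) (x ω) (un ω) (vn ω) S
  let δ (ω : Ω) : Fin n → ℝ := S.piecewise (un ω) (x ω).ut - (x ω).ut
  have hyu (i) : (fun ω => (y ω).ut i) ∈ V := piecewise_apply_mem hun hut i
  have hδ (ω i) (h : i ∈ S) : δ ω i ≠ 0 := by
    simpa [δ, h, sub_eq_zero] using hne ω i h
  let V₁ := V ∪ ({fun _ => 0} ∪ {fun _ => 1})
  let V₂ := V₁ ∪ Set.range fun i => fun ω => δ ω i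
  let V₃ := V₂ ∪ entries fun ω => woodburyTerm (x ω).M (δ ω) S
  let V₄ := V₃ ∪ entries fun ω => (y ω).M
  have constants := (StraightLine.const (c := c) (V := V) 0).union (.const 1)
  have difference := StraightLine.range (c := c) (V := V₁) (u := fun i => fun ω => δ ω i)
    fun i => (StraightLine.of_mem (.inl (hyu i))).sub (.of_mem (.inl (hut i)))
  have correction := straightLine_woodburyTerm (c := c) (V := V₂) hm hi (.inl (.inr (.inl rfl)))
    (.inl (.inr (.inr rfl))) (hM.trans fun _ h => .inl (.inl h)) (fun i => .inr ⟨i, rfl⟩) hδ hcap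
  have subtraction := StraightLine.matrix (c := c) (V := V₃) (X := fun ω => (y ω).M)
    fun i j => (StraightLine.of_mem (.inl (.inl (.inl (mem_of_entries_subset hM i j))))).sub
      (.of_mem (.inr ⟨(i, j), rfl⟩))
  have product := straightLine_mulVec_sqrtMul (c := c) (V := V₄) (M := fun ω => (y ω).M)
    (u := fun ω => (y ω).ut) (v := vn) (.inl (.inl (.inl (.inr (.inl rfl)))))
    Set.subset_union_right (fun i => .inl (.inl (.inl (.inl (hyu i)))))
    fun i => .inl (.inl (.inl (.inl (hvn i))))
  refine (constants.trans (difference.trans (correction.trans (subtraction.trans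
    product.union_left)))).mono subset_rfl ?_ ?_
  · simp only [Fintype.card_fin]
    ring_nf
    omega
  · exact Set.union_subset_union_left _
      (Set.union_subset (fun _ h => .inl (.inl (.inl (.inl h)))) fun _ h => .inr h)

/-- The state of the data structure that is stored in the memory `σ`. -/
def storedState (σ : DSReg n d → ℝ) : DSState n :=
  { M := of fun i j => σ (.M i j), ut := fun i => σ (.ut i), vt := fun i => σ (.vt i),
    w := fun i => σ (.w i) }

theorem HoldsState.storedState_eq {σ : DSReg n d → ℝ} {x : DSState n} (h : HoldsState σ x) :
    storedState σ = x := by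
  cases x
  simp only [storedState, DSState.mk.injEq]
  exact ⟨Matrix.ext h.1, funext h.2.1, funext h.2.2.1, funext h.2.2.2⟩

theorem exists_batchProgram {S : Finset (Fin n)} {t s : ℕ}
    (hm : MulBound (Fin n) (Fin S.card) (Fin n) t) (hi : InvBound (Fin S.card) s) :
    ∃ P : Prog (DSReg n d), ∀ (A : Matrix (Fin d) (Fin n) ℝ) (ε : ℝ) (f : ℝ → ℝ) (x : DSState n)
      (un vn : Fin n → ℝ) (σ : DSReg n d → ℝ), HoldsData σ A ε → HoldsInput σ un vn →
      HoldsState σ x → (∀ i ∈ S, un i ≠ x.ut i) →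
      IsUnit (capMatrix x.M (S.piecewise un x.ut - x.ut) S) →
      let y := batchState f x un vn S
      HoldsData (P.run f σ) A ε ∧ HoldsState (P.run f σ) y ∧
        (∀ i, P.run f σ (.fv i) = f (vn i)) ∧
        (∀ i, P.run f σ (.r i) = Real.sqrt (y.ut i) * y.w i) ∧
        P.cost f σ ≤ 4 * t + s + 9 * (n * n) + 27 * n + 2 := by
  let un (σ : DSReg n d → ℝ) (i : Fin n) : ℝ := σ (.un i)
  let vn (σ : DSReg n d → ℝ) (i : Fin n) : ℝ := σ (.vn i)
  let x (σ : DSReg n d → ℝ) : DSState n := storedState σ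
  let Ω := {p : (ℝ → ℝ) × (DSReg n d → ℝ) // (∀ i ∈ S, un p.2 i ≠ (x p.2).ut i) ∧
    IsUnit (capMatrix (x p.2).M (S.piecewise (un p.2) (x p.2).ut - (x p.2).ut) S)}
  let c (ω : Ω) : ℝ → ℝ := ω.1.1
  let V := regReads fun ω : Ω => ω.1.2
  let y (ω : Ω) : DSState n := batchState (c ω) (x ω.1.2) (un ω.1.2) (vn ω.1.2) S
  have hun (i) : (fun ω : Ω => un ω.1.2 i) ∈ V := mem_regReads _ (x := .un i) (by simp)
  have hvn (i) : (fun ω : Ω => vn ω.1.2 i) ∈ V := mem_regReads _ (x := .vn i) (by simp)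
  have hut (i) : (fun ω : Ω => (x ω.1.2).ut i) ∈ V := mem_regReads _ (x := .ut i) (by simp)
  have hyu (i) : (fun ω => (y ω).ut i) ∈ V := piecewise_apply_mem hun hut i
  have state := straightLine_batchState hm hi (c := c) (V := V) (x := fun ω => x ω.1.2)
    (un := fun ω => un ω.1.2) (vn := fun ω => vn ω.1.2)
    (entries_subset fun i j => mem_regReads _ (x := .M i j) (by simp)) hut hun hvn
    (fun ω => ω.2.1) fun ω => ω.2.2
  let V₁ := V ∪ (V ∪ entries (fun ω => (y ω).M) ∪ Set.range fun i => fun ω => (y ω).w i)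
  have projection := StraightLine.range (c := c) (V := V₁)
    (u := fun i => fun ω => Real.sqrt ((y ω).ut i) * (y ω).w i) fun i =>
      (StraightLine.of_mem (.inl (hyu i))).sqrt.mul (.of_mem (.inr (.inr ⟨i, rfl⟩)))
  have values := StraightLine.range (c := c) (V := V₁)
    (u := fun i => fun ω => c ω (vn ω.1.2 i)) fun i => (StraightLine.of_mem (.inl (hvn i))).call
  obtain ⟨P, hP⟩ := (state.trans (projection.union values).union_left).exists_prog y
    (fun ω i => c ω (vn ω.1.2 i)) (fun ω i => Real.sqrt ((y ω).ut i) * (y ω).w i)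
    (fun _ h => .inl (.inr (.inl (.inr h)))) (fun i => .inl (.inl (hyu i)))
    (fun i => .inl (.inl (hvn i))) (fun i => .inl (.inr (.inr ⟨i, rfl⟩)))
    (fun i => .inr (.inr ⟨i, rfl⟩)) (fun i => .inr (.inl ⟨i, rfl⟩))
  refine ⟨P, fun A ε f x un' vn' σ hdata hin hx hne hcap => ?_⟩
  obtain rfl := hx.storedState_eq
  obtain rfl : un σ = un' := funext hin.1
  obtain rfl : vn σ = vn' := funext hin.2
  obtain ⟨cost_le, holds, hfv, hr, hA, heps⟩ := hP ⟨(f, σ), hne, hcap⟩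
  refine ⟨⟨fun i j => (hA i j).trans (hdata.1 i j), heps.trans hdata.2⟩, holds, hfv, hr,
    cost_le.trans ?_⟩
  simp only [Fintype.card_fin]
  ring_nf
  omega

end Batch

/-! ### The batch size -/

section BatchSize

theorem one_lt_logb_two {n : ℕ} (hn : 3 ≤ n) : 1 < Real.logb 2 n := by
  rw [Real.lt_logb_iff_rpow_lt (by norm_num) (by positivity), Real.rpow_one]
  exact_mod_cast hn

theorem one_sub_inv_logb_pos {n : ℕ} (hn : 3 ≤ n) : 0 < 1 - 1 / Real.logb 2 n := by
  have := one_lt_logb_two hn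
  exact sub_pos.2 ((div_lt_one (by linarith)).2 this)

variable {n k : ℕ}

theorem le_enlarge (z : ℕ → ℝ) : k ≤ enlarge n z k := by
  fun_induction enlarge n z k <;> omega

theorem enlarge_le (z : ℕ → ℝ) (hk : k ≤ n) : enlarge n z k ≤ n := by
  fun_induction enlarge n z k with
  | case1 k _ ih => exact ih (by omega)
  | case2 => exact hk

theorem enlarge_gap (z : ℕ → ℝ) (hk : 1 ≤ k) : 2 * n ≤ 3 * enlarge n z k ∨
    z ((3 * enlarge n z k + 1) / 2) < (1 - 1 / Real.logb 2 n) * z (enlarge n z k) := by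
  fun_induction enlarge n z k with
  | case1 k _ ih => exact ih (by omega)
  | case2 k h =>
    by_contra! hcon
    exact h ⟨hk, hcon.1, hcon.2⟩

theorem exists_pow_mul_le_enlarge (hn : 3 ≤ n) (z : ℕ → ℝ) : ∃ m : ℕ,
    3 ^ m * k ≤ 2 ^ m * enlarge n z k ∧
      (1 - 1 / Real.logb 2 n) ^ m * z k ≤ z (enlarge n z k) := by
  fun_induction enlarge n z k with
  | case1 k h ih =>
    obtain ⟨m, hpow, hz⟩ := ih
    refine ⟨m + 1, ?_, ?_⟩
    · have := Nat.mul_le_mul_left (3 ^ m) (show 3 * k ≤ 2 * ((3 * k + 1) / 2) by omega)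
      rw [pow_succ, pow_succ]
      linarith
    · rw [pow_succ, mul_assoc]
      exact (mul_le_mul_of_nonneg_left h.2.2 (pow_nonneg (one_sub_inv_logb_pos hn).le _)).trans hz
  | case2 => exact ⟨0, by simp, by simp⟩

theorem le_apply_iff_lt_card_filter {α : Type*} [LinearOrder α] {g : Fin n → α} (hg : Antitone g)
    (a : α) [DecidablePred fun i => a ≤ g i] (j : Fin n) :
    a ≤ g j ↔ (j : ℕ) < (Finset.univ.filter fun i => a ≤ g i).card := by
  constructor
  · intro h
    have : Finset.Iic j ⊆ Finset.univ.filter fun i => a ≤ g i := fun i hi =>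
      Finset.mem_filter.2 ⟨Finset.mem_univ i, h.trans (hg (Finset.mem_Iic.1 hi))⟩
    simpa using Finset.card_le_card this
  · contrapose!
    intro h
    have : (Finset.univ.filter fun i => a ≤ g i) ⊆ Finset.Iio j := fun i hi =>
      Finset.mem_Iio.2 (hg.reflect_lt (h.trans_le (Finset.mem_filter.1 hi).2))
    simpa using Finset.card_le_card this

theorem numLarge_comp_perm (ε : ℝ) (y : Fin n → ℝ) (π : Equiv.Perm (Fin n)) :
    numLarge ε (y ∘ π) = numLarge ε y := by
  simp only [numLarge, ← Fintype.card_subtype]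
  exact Fintype.card_congr (π.subtypeEquiv fun _ => Iff.rfl)

theorem le_sortedAbs_iff {y : Fin n → ℝ} {π : Equiv.Perm (Fin n)}
    (hπ : Antitone fun j => |y (π j)|) (ε : ℝ) (hk : 1 ≤ k) (hkn : k ≤ n) :
    ε ≤ sortedAbs y π k ↔ k ≤ numLarge ε y := by
  classical
  rw [sortedAbs, dif_pos ⟨hk, hkn⟩, ← numLarge_comp_perm ε y π]
  exact (le_apply_iff_lt_card_filter hπ ε ⟨k - 1, by omega⟩).trans
    ((Nat.sub_lt_iff_lt_add hk).trans Nat.lt_succ_iff)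

theorem numLarge_le (ε : ℝ) (y : Fin n → ℝ) : numLarge ε y ≤ n :=
  (Finset.card_filter_le _ _).trans_eq (Finset.card_fin n)

theorem card_firstIndices (π : Equiv.Perm (Fin n)) (hk : k ≤ n) : (firstIndices π k).card = k := by
  have : firstIndices π k = (Finset.univ.filter fun j : Fin n => (j : ℕ) < k).map π.toEmbedding :=
    by ext i; simp [firstIndices, Finset.mem_map_equiv]
  rw [this, Finset.card_map, Fin.card_filter_val_lt, min_eq_right hk]

variable {a ε : ℝ} {s : DSState n} {un : Fin n → ℝ} {π : Equiv.Perm (Fin n)}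

theorem batchSize_le : batchSize a ε s un π ≤ n := by
  rw [batchSize]
  split_ifs
  · exact enlarge_le _ (numLarge_le _ _)
  · exact numLarge_le _ _

theorem numLarge_le_batchSize : numLarge ε (relDev s un) ≤ batchSize a ε s un π := by
  rw [batchSize]
  split_ifs
  · exact le_enlarge _
  · exact le_rfl

theorem RankBranch.one_le_numLarge (hn : 1 ≤ n) (ha : 0 ≤ a) (h : RankBranch a ε s un) :
    1 ≤ numLarge ε (relDev s un) := by
  have := (Real.one_le_rpow (Nat.one_le_cast.2 hn) ha).trans h
  exact_mod_cast this

theorem RankBranch.batchSize_gap (hn : 1 ≤ n) (ha : 0 ≤ a) (h : RankBranch a ε s un) :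
    2 * n ≤ 3 * batchSize a ε s un π ∨
      sortedAbs (relDev s un) π ((3 * batchSize a ε s un π + 1) / 2) <
        (1 - 1 / Real.logb 2 n) * sortedAbs (relDev s un) π (batchSize a ε s un π) := by
  rw [batchSize, if_pos h]
  exact enlarge_gap _ (h.one_le_numLarge hn ha)

theorem RankBranch.exists_pow_mul_le_sortedAbs (hn : 3 ≤ n) (ha : 0 ≤ a)
    (h : RankBranch a ε s un) (hπ : Antitone fun j => |relDev s un (π j)|) : ∃ m : ℕ,
    3 ^ m ≤ 2 ^ m * n ∧
      (1 - 1 / Real.logb 2 n) ^ m * ε ≤ sortedAbs (relDev s un) π (batchSize a ε s un π) := by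
  have hk := h.one_le_numLarge (by omega) ha
  have hkn := numLarge_le ε (relDev s un)
  rw [batchSize, if_pos h]
  obtain ⟨m, hpow, hz⟩ := exists_pow_mul_le_enlarge hn (sortedAbs (relDev s un) π)
    (k := numLarge ε (relDev s un))
  refine ⟨m, ?_, le_trans ?_ hz⟩
  · exact (Nat.le_mul_of_pos_right _ hk).trans
      (hpow.trans (Nat.mul_le_mul_left _ (enlarge_le _ hkn)))
  · exact mul_le_mul_of_nonneg_left ((le_sortedAbs_iff hπ ε hk hkn).2 le_rfl)
      (pow_nonneg (one_sub_inv_logb_pos hn).le _)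

theorem RankBranch.relDev_ne_zero_of_mem (hn : 3 ≤ n) (ha : 0 ≤ a) (hε : 0 < ε)
    (h : RankBranch a ε s un) (hπ : Antitone fun j => |relDev s un (π j)|) {i : Fin n}
    (hi : i ∈ firstIndices π (batchSize a ε s un π)) : relDev s un i ≠ 0 := by
  obtain ⟨m, -, hm⟩ := h.exists_pow_mul_le_sortedAbs hn ha hπ
  replace hi : (π.symm i : ℕ) < batchSize a ε s un π := (Finset.mem_filter.1 hi).2
  have hk : batchSize a ε s un π ≤ n := batchSize_le
  have hle : π.symm i ≤ ⟨batchSize a ε s un π - 1, by omega⟩ := Nat.le_sub_one_of_lt hi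
  rw [sortedAbs, dif_pos ⟨by omega, hk⟩] at hm
  have := hm.trans (hπ hle)
  simp only [Equiv.apply_symm_apply] at this
  exact abs_pos.1 ((mul_pos (pow_pos (one_sub_inv_logb_pos hn) _) hε).trans_le this)

end BatchSize

/-! ### Decision trees -/

theorem pairwise_append_cons_of_perm_left {ι : Type} {r : ι → ι → Prop} [IsTrans ι r]
    {l₁ l₂ l' : List ι} {a x : ι} (h : (l₁ ++ a :: l₂).Pairwise r) (hperm : l'.Perm (x :: l₁))
    (hl' : l'.Pairwise r) (hxa : r x a) : (l' ++ a :: l₂).Pairwise r := by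
  simp only [List.pairwise_append, List.pairwise_cons, List.mem_cons, hperm.mem_iff] at h ⊢
  refine ⟨hl', h.2.1, ?_⟩
  rintro i (rfl | hi) j (rfl | hj)
  exacts [hxa, _root_.trans hxa (h.2.1.1 j hj), h.2.2 i hi _ (.inl rfl), h.2.2 i hi j (.inr hj)]

theorem pairwise_append_cons_of_perm_right {ι : Type} {r : ι → ι → Prop} [IsTrans ι r]
    {l₁ l₂ l' : List ι} {a x : ι} (h : (l₁ ++ a :: l₂).Pairwise r) (hperm : l'.Perm (x :: l₂))
    (hl' : l'.Pairwise r) (hax : r a x) : (l₁ ++ a :: l').Pairwise r := by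
  simp only [List.pairwise_append, List.pairwise_cons, List.mem_cons, hperm.mem_iff] at h ⊢
  refine ⟨h.1, ⟨?_, hl'⟩, ?_⟩
  · rintro j (rfl | hj)
    exacts [hax, h.2.1.1 j hj]
  · rintro i hi j (rfl | rfl | hj)
    exacts [h.2.2 i hi _ (.inl rfl), _root_.trans (h.2.2 i hi a (.inl rfl)) hax,
      h.2.2 i hi j (.inr hj)]

theorem exists_eq_append_cons_of_length_lt {ι : Type} {l : List ι} (hl : l ≠ []) {s : ℕ}
    (h : l.length < 2 ^ (s + 1)) : ∃ l₁ a l₂, l = l₁ ++ a :: l₂ ∧ l₁.length < 2 ^ s ∧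
      l₂.length < 2 ^ s := by
  have hpos := List.length_pos_iff.2 hl
  have hlt : l.length / 2 < l.length := by omega
  rw [pow_succ] at h
  refine ⟨l.take (l.length / 2), l[l.length / 2], l.drop (l.length / 2 + 1), ?_, ?_, ?_⟩
  · rw [← List.drop_eq_getElem_cons hlt, List.take_append_drop]
  · rw [List.length_take]
    omega
  · rw [List.length_drop]
    omega

theorem exists_ofFn_of_perm {n : ℕ} {l : List (Fin n)} (h : l.Perm (List.finRange n)) :
    ∃ π : Equiv.Perm (Fin n), l = List.ofFn π := by
  have hlen : l.length = n := by simpa using h.length_eq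
  have hnd : l.Nodup := h.nodup_iff.2 (List.nodup_finRange n)
  have hinj : Function.Injective fun j : Fin n => l.get (Fin.cast hlen.symm j) := fun i j hij =>
    Fin.cast_injective hlen.symm (List.nodup_iff_injective_get.1 hnd hij)
  refine ⟨Equiv.ofBijective _ (Finite.injective_iff_bijective.1 hinj), ?_⟩
  exact List.ext_getElem (by simp [hlen]) fun j _ _ => by simp

section SortedBy

variable {ρ ι : Type}

/-- The contents of the registers `key i` do not increase along the list `l`: the sorting criterion
of the decision trees. -/
def SortedBy (key : ι → ρ) (σ : ρ → ℝ) (l : List ι) : Prop :=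
  l.Pairwise fun i j => σ (key j) ≤ σ (key i)

end SortedBy

namespace HasSegment

variable {ρ ι : Type}

theorem ite_lt {α : Type} {t : ℕ} (x y : ρ) {R R' : (ℝ → ℝ) → (ρ → ℝ) → α → (ρ → ℝ) → Prop}
    (h : HasSegment t R) (h' : HasSegment t R') :
    HasSegment (t + 1) fun f σ a σ' =>
      (σ x < σ y → R f σ a σ') ∧ (σ y ≤ σ x → R' f σ a σ') := by
  refine ((lt x y).bind (q := fun _ => True) (fun _ _ _ _ _ => trivial)
    (S := fun b f σ a σ' => (b = true → R f σ a σ') ∧ (b = false → R' f σ a σ'))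
    fun b _ => ?_).mono ?_ (add_comm 1 t).le
  · cases b
    · exact h'.mono (by simp) le_rfl
    · exact h.mono (by simp) le_rfl
  · rintro f _ a σ' ⟨b, σ, ⟨hb, rfl⟩, htrue, hfalse⟩
    exact ⟨fun hlt => htrue (hb.2 hlt), fun hle => hfalse (by simpa using mt hb.1 hle.not_gt)⟩

theorem count (key : ι → ρ) (b : ρ) (l : List ι) (m : ℕ) :
    HasSegment l.length fun _ σ k σ' =>
      k = m + (l.filter fun i => σ b ≤ σ (key i)).length ∧ σ' = σ := by
  induction l generalizing m with
  | nil => exact (pure m).mono (by simp) le_rfl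
  | cons a l ih =>
    refine (ite_lt (key a) b (ih m) (ih (m + 1))).mono ?_ le_rfl
    rintro _ σ k σ' ⟨hlt, hle⟩
    rcases lt_or_ge (σ (key a)) (σ b) with h | h
    · simpa [not_le.2 h] using hlt h
    · simpa [h, add_assoc, add_comm] using hle h

theorem insert (key : ι → ρ) (x : ι) {s : ℕ} {l : List ι} (hl : l.length < 2 ^ s) :
    HasSegment s fun _ σ (l' : List ι) σ' =>
      (l'.Perm (x :: l) ∧ (SortedBy key σ l → SortedBy key σ l')) ∧ σ' = σ := by
  have insert_nil (s : ℕ) : HasSegment s fun _ σ (l' : List ι) σ' =>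
      (l'.Perm [x] ∧ (SortedBy key σ [] → SortedBy key σ l')) ∧ σ' = σ := by
    refine (pure [x]).mono ?_ (Nat.zero_le s)
    rintro _ σ l' σ' ⟨rfl, rfl⟩
    simp [SortedBy]
  induction s generalizing l with
  | zero =>
    obtain rfl : l = [] := List.eq_nil_of_length_eq_zero (by simpa using hl)
    exact insert_nil 0
  | succ s ih =>
    rcases eq_or_ne l [] with rfl | hne
    · exact insert_nil (s + 1)
    obtain ⟨l₁, a, l₂, rfl, h₁, h₂⟩ := exists_eq_append_cons_of_length_lt hne hl
    have left := (ih h₁).map fun l' => l' ++ a :: l₂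
    have right := (ih h₂).map fun l' => l₁ ++ a :: l'
    refine (ite_lt (key a) (key x) left right).mono ?_ le_rfl
    rintro _ σ l' σ' ⟨hlt, hle⟩
    have : IsTrans ι fun i j => σ (key j) ≤ σ (key i) := ⟨fun _ _ _ hij hjk => hjk.trans hij⟩
    rcases lt_or_ge (σ (key a)) (σ (key x)) with h | h
    · obtain ⟨m, rfl, ⟨hperm, hsorted⟩, rfl⟩ := hlt h
      exact ⟨⟨hperm.append_right _, fun hl => pairwise_append_cons_of_perm_left hl hperm
        (hsorted (List.pairwise_append.1 hl).1) h.le⟩, rfl⟩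
    · obtain ⟨m, rfl, ⟨hperm, hsorted⟩, rfl⟩ := hle h
      refine ⟨⟨?_, fun hl => pairwise_append_cons_of_perm_right hl hperm
        (hsorted (List.pairwise_cons.1 (List.pairwise_append.1 hl).2.1).2) h⟩, rfl⟩
      exact (((hperm.cons a).trans (.swap x a l₂)).append_left l₁).trans List.perm_middle

theorem sort (key : ι → ρ) {s : ℕ} (l acc : List ι) (h : l.length + acc.length ≤ 2 ^ s) :
    HasSegment (l.length * s) fun _ σ (l' : List ι) σ' =>
      (l'.Perm (l ++ acc) ∧ (SortedBy key σ acc → SortedBy key σ l')) ∧ σ' = σ := by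
  induction l generalizing acc with
  | nil =>
    refine (pure acc).mono ?_ (by simp)
    rintro _ σ l' σ' ⟨rfl, rfl⟩
    exact ⟨⟨.refl _, id⟩, rfl⟩
  | cons a l ih =>
    rw [List.length_cons] at h
    refine ((insert key a (show acc.length < 2 ^ s by omega)).bind
      (q := fun acc' => acc'.Perm (a :: acc)) (fun _ _ _ _ hR => hR.1.1)
      fun acc' hacc' => ih acc' ?_).mono ?_ ?_
    · rw [hacc'.length_eq, List.length_cons]
      omega
    · rintro _ _ l' _ ⟨acc', σ, ⟨⟨hperm, hsorted⟩, rfl⟩, ⟨hperm', hsorted'⟩, rfl⟩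
      exact ⟨⟨hperm'.trans ((hperm.append_left l).trans List.perm_middle),
        hsorted' ∘ hsorted⟩, rfl⟩
    · rw [List.length_cons]
      linarith

theorem sortPerm {n : ℕ} (key : Fin n → ρ) :
    HasSegment (n * n) fun _ σ (π : Equiv.Perm (Fin n)) σ' =>
      Antitone (fun j => σ (key (π j))) ∧ σ' = σ := by
  have sorting := sort key (s := n) (List.finRange n) [] (by simpa using Nat.lt_two_pow_self.le)
  simp only [List.append_nil, List.length_finRange] at sorting
  refine (sorting.bind (q := fun l => l.Perm (List.finRange n)) (fun _ _ _ _ hR => hR.1.1)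
    (S := fun l _ σ (π : Equiv.Perm (Fin n)) σ' => l = List.ofFn π ∧ σ' = σ)
    fun l hl => ?_).mono ?_ (Nat.add_zero _).le
  · obtain ⟨π, hπ⟩ := exists_ofFn_of_perm hl
    refine (pure π).mono ?_ le_rfl
    rintro _ σ _ _ ⟨rfl, rfl⟩
    exact ⟨hπ, rfl⟩
  · rintro _ _ π _ ⟨_, σ, ⟨⟨-, hsorted⟩, rfl⟩, rfl, rfl⟩
    have hsorted := List.pairwise_ofFn.1 (hsorted .nil)
    exact ⟨antitone_iff_forall_lt.2 fun i j hij => hsorted hij, rfl⟩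

theorem enlargeLoop {n : ℕ} {zr : ℕ → ρ} {t : ρ} (ht : ∀ j, zr j ≠ t) {r k : ℕ} (hr : n - k ≤ r)
    (hk : 1 ≤ k) : HasSegment (3 * r) fun _ σ k' σ' =>
      k' = enlarge n (fun j => σ (zr j)) k ∧ ∀ x, x ≠ t → σ' x = σ x := by
  have unchanged {k : ℕ} (h : ¬ 3 * k < 2 * n) (r : ℕ) : HasSegment r fun _ σ k' σ' =>
      k' = enlarge n (fun j => σ (zr j)) k ∧ ∀ x, x ≠ t → σ' x = σ x := by
    refine (pure k).mono ?_ (Nat.zero_le _)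
    rintro _ σ k' σ' ⟨rfl, rfl⟩
    rw [enlarge, dif_neg fun h' => h h'.2.1]
    simp
  induction r generalizing k with
  | zero => exact unchanged (by omega) _
  | succ r ih =>
    by_cases h : 3 * k < 2 * n
    swap
    · exact unchanged h _
    refine ((const t (1 - 1 / Real.logb 2 n)).seq ((arith .mul t t (zr k)).seq
      (ite_lt (zr ((3 * k + 1) / 2)) t ((pure k).weaken (Nat.zero_le _))
        (ih (k := (3 * k + 1) / 2) (by omega) (by omega))))).mono ?_ (by omega)
    rintro _ σ k' σ' ⟨-, -, rfl, -, -, rfl, hlt, hle⟩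
    simp only [writeReg_writeReg, writeReg_same, ArithOp.eval, writeReg_ne _ _ (ht _)] at hlt hle
    rw [enlarge]
    split_ifs with hz
    · obtain ⟨rfl, unchanged⟩ := hle hz.2.2
      exact ⟨rfl, fun x hx => (unchanged x hx).trans (writeReg_ne _ _ hx)⟩
    · obtain ⟨rfl, rfl⟩ := hlt (not_le.1 fun hle' => hz ⟨hk, h, hle'⟩)
      exact ⟨rfl, fun x hx => writeReg_ne _ _ hx⟩

end HasSegment

/-! ### The program for `Update` -/

section EqOffScratch

variable {n d : ℕ}

/-- The memories `σ` and `σ'` agree outside the scratch registers. -/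
def EqOffScratch (σ σ' : DSReg n d → ℝ) : Prop := ∀ x : DSReg n d, (∀ l, x ≠ .tmp l) → σ' x = σ x

namespace EqOffScratch

variable {σ σ' σ'' : DSReg n d → ℝ}

theorem trans (h : EqOffScratch σ σ') (h' : EqOffScratch σ' σ'') : EqOffScratch σ σ'' :=
  fun x hx => (h' x hx).trans (h x hx)

theorem holdsData (h : EqOffScratch σ σ') {A : Matrix (Fin d) (Fin n) ℝ} {ε : ℝ}
    (hd : HoldsData σ A ε) : HoldsData σ' A ε :=
  ⟨fun i j => (h _ (by simp)).trans (hd.1 i j), (h _ (by simp)).trans hd.2⟩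

theorem holdsInput (h : EqOffScratch σ σ') {un vn : Fin n → ℝ} (hin : HoldsInput σ un vn) :
    HoldsInput σ' un vn :=
  ⟨fun i => (h _ (by simp)).trans (hin.1 i), fun i => (h _ (by simp)).trans (hin.2 i)⟩

theorem holdsState (h : EqOffScratch σ σ') {x : DSState n} (hx : HoldsState σ x) :
    HoldsState σ' x :=
  ⟨fun i j => (h _ (by simp)).trans (hx.1 i j), fun i => (h _ (by simp)).trans (hx.2.1 i),
    fun i => (h _ (by simp)).trans (hx.2.2.1 i), fun i => (h _ (by simp)).trans (hx.2.2.2 i)⟩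

end EqOffScratch

end EqOffScratch

section BatchSelection

variable {n : ℕ}

theorem enlarge_congr {z z' : ℕ → ℝ} {k : ℕ} (h : ∀ j, 1 ≤ j → j ≤ n → z j = z' j) (hk : 1 ≤ k)
    (hkn : k ≤ n) : enlarge n z k = enlarge n z' k := by
  fun_induction enlarge n z k with
  | case1 k hz ih =>
    rw [ih (by omega) (by omega), enlarge.eq_def n z' k, dif_pos]
    rwa [← h k hk hkn, ← h _ (by omega) (by omega)]
  | case2 k hz =>
    rw [enlarge, dif_neg]
    rintro ⟨-, hlt, hle⟩
    rw [← h k hk hkn, ← h _ (by omega) (by omega)] at hle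
    exact hz ⟨hk, hlt, hle⟩

theorem length_filter_eq_numLarge (ε : ℝ) (y : Fin n → ℝ) :
    ((List.finRange n).filter fun i => ε ≤ |y i|).length = numLarge ε y := by
  classical
  rw [numLarge, ← List.toFinset_card_of_nodup ((List.nodup_finRange n).filter _)]
  congr 1
  ext i
  simp

variable {d : ℕ}

/-- The vector `u_i^new / ũ_i - 1` for the `u^new` and `ũ` in the memory `σ`. -/
noncomputable def regDev (σ : DSReg n d → ℝ) (i : Fin n) : ℝ := σ (.un i) / σ (.ut i) - 1

theorem regDev_eq_relDev {σ : DSReg n d → ℝ} {x : DSState n} {un vn : Fin n → ℝ}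
    (hin : HoldsInput σ un vn) (hx : HoldsState σ x) : regDev σ = relDev x un := by
  funext i
  rw [regDev, hin.1, hx.2.1, relDev]

theorem exists_hasSegment_abs_regDev (n d : ℕ) : ∃ (key : Fin n → DSReg n d) (b : ℕ),
    (∀ i, key i ≠ .tmp b) ∧ HasSegment (8 * n) fun _ σ (_ : Unit) σ' =>
      (∀ i, σ' (key i) = |regDev σ i|) ∧ EqOffScratch σ σ' := by
  let Ω := (ℝ → ℝ) × (DSReg n d → ℝ)
  let c : Ω → ℝ → ℝ := Prod.fst
  let mem : Ω → DSReg n d → ℝ := Prod.snd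
  have abs_dev : StraightLine c (regReads mem) (n * 8)
      (Set.range fun i ω => |regDev (mem ω) i|) := by
    have := StraightLine.range (c := c) (V := regReads mem) (t := 8)
      (u := fun i ω => |regDev (mem ω) i|) fun i => by
        have dev : StraightLine c (regReads mem) 3 {fun ω => regDev (mem ω) i} :=
          ((StraightLine.of_mem (mem_regReads mem (x := .un i) (by simp))).div
            (.of_mem (mem_regReads mem (x := .ut i) (by simp)))).sub (.const 1)
        simp only [← Real.sqrt_mul_self_eq_abs]
        exact (dev.mul dev).sqrt
    rwa [Fintype.card_fin] at this
  obtain ⟨b, -, loc, hloc, seg⟩ := abs_dev.compiles (tmp := DSReg.tmp)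
    (fun _ _ => DSReg.tmp.inj) mem 0 fun g ⟨x, hx, hg⟩ => ⟨x, fun l _ => hx l, hg⟩
  refine ⟨fun i => loc ⟨_, i, rfl⟩, b, fun i => hloc _ b le_rfl,
    seg.mono (fun f σ _ σ' h => ?_) (mul_comm n 8).le⟩
  obtain ⟨hval, unchanged⟩ := h (f, σ) rfl rfl
  exact ⟨fun i => hval _, fun x hx => unchanged x fun l _ => hx l⟩

theorem hasSegment_numLarge (key : Fin n → DSReg n d) : HasSegment n fun _ σ k σ' =>
    (∀ y, (∀ i, σ (key i) = |y i|) → k = numLarge (σ .eps) y) ∧ σ' = σ := by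
  refine (HasSegment.count key .eps (List.finRange n) 0).mono ?_ (List.length_finRange).le
  rintro _ σ k _ ⟨rfl, rfl⟩
  refine ⟨fun y hy => ?_, rfl⟩
  simp only [hy, zero_add, length_filter_eq_numLarge]

theorem hasSegment_firstIndices {key : Fin n → DSReg n d} {b : ℕ} (hb : ∀ i, key i ≠ .tmp b)
    {k : ℕ} (hk : 1 ≤ k) (hkn : k ≤ n) : HasSegment (n * n + 3 * n) fun _ σ S σ' =>
      (∀ y, (∀ i, σ (key i) = |y i|) → ∃ π : Equiv.Perm (Fin n), Antitone (fun j => |y (π j)|) ∧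
        S = firstIndices π (enlarge n (sortedAbs y π) k)) ∧ EqOffScratch σ σ' := by
  let zr (π : Equiv.Perm (Fin n)) (j : ℕ) : DSReg n d :=
    if h : 1 ≤ j ∧ j ≤ n then key (π ⟨j - 1, by omega⟩) else .eps
  have hzr (π : Equiv.Perm (Fin n)) (j : ℕ) : zr π j ≠ .tmp b := by
    simp only [zr]
    split_ifs
    exacts [hb _, by simp]
  refine ((HasSegment.sortPerm key).bind (q := fun _ => True) (fun _ _ _ _ _ => trivial)
    fun π _ => (HasSegment.enlargeLoop (hzr π) (Nat.sub_le n k) hk).map (firstIndices π)).mono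
      ?_ le_rfl
  rintro _ _ S σ' ⟨π, σ, ⟨hπ, rfl⟩, _, rfl, rfl, unchanged⟩
  refine ⟨fun y hy => ⟨π, by simpa only [hy] using hπ, ?_⟩, fun x hx => unchanged x (hx b)⟩
  refine congrArg _ (enlarge_congr (fun j hj hjn => ?_) hk hkn)
  simp only [zr, dif_pos (And.intro hj hjn), hy, sortedAbs]

theorem exists_branchProgram {a : ℝ} (hn : 1 ≤ n) (ha : 0 ≤ a)
    (PB : Finset (Fin n) → Prog (DSReg n d)) : ∃ P : Prog (DSReg n d), ∀ f x un vn σ,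
      HoldsInput σ un vn → HoldsState σ x →
      (¬ RankBranch a (σ .eps) x un → EqOffScratch σ (P.run f σ) ∧ P.cost f σ ≤ 9 * n) ∧
      (RankBranch a (σ .eps) x un → ∃ π : Equiv.Perm (Fin n),
        Antitone (fun j => |relDev x un (π j)|) ∧ ∃ σ', EqOffScratch σ σ' ∧
          let S := firstIndices π (batchSize a (σ .eps) x un π)
          P.run f σ = (PB S).run f σ' ∧ P.cost f σ ≤ (PB S).cost f σ' + (n * n + 12 * n)) := by
  classical
  obtain ⟨key, b, hb, dev⟩ := exists_hasSegment_abs_regDev n d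
  choose select hselect using fun k (hk : 1 ≤ k ∧ k ≤ n) =>
    hasSegment_firstIndices hb hk.1 hk.2 PB
  obtain ⟨P, hP⟩ := dev.seq (hasSegment_numLarge key) fun k =>
    if hk : (n : ℝ) ^ a ≤ k ∧ 1 ≤ k ∧ k ≤ n then select k hk.2 else .halt
  refine ⟨P, fun f x un vn σ hin hx => ?_⟩
  obtain ⟨k, σ₁, ⟨-, _, ⟨hdev, scratch⟩, hk, rfl⟩, run_eq, cost_le⟩ := hP f σ
  have hkey (i) : σ₁ (key i) = |relDev x un i| := by rw [hdev, regDev_eq_relDev hin hx]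
  have heps : σ₁ .eps = σ .eps := scratch .eps (by simp)
  obtain rfl := heps ▸ hk _ hkey
  constructor <;> intro hr
  · rw [dif_neg fun h => hr h.1] at run_eq cost_le
    simp only [Prog.cost] at cost_le
    exact ⟨run_eq ▸ scratch, by omega⟩
  · have hk := And.intro (hr.one_le_numLarge hn ha) (numLarge_le (σ .eps) (relDev x un))
    rw [dif_pos ⟨hr, hk⟩] at run_eq cost_le
    obtain ⟨S, σ₂, ⟨hS, scratch₂⟩, run_select, cost_select⟩ := hselect _ hk f σ₁
    obtain ⟨π, hπ, rfl⟩ := hS _ hkey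
    simp only [batchSize, if_pos hr]
    exact ⟨π, hπ, σ₂, scratch.trans scratch₂, run_eq.trans run_select, by omega⟩

end BatchSelection

section UpdateProgram

variable {n d : ℕ} {a ε : ℝ} {x : DSState n} {un vn : Fin n → ℝ} {π : Equiv.Perm (Fin n)}
  {A : Matrix (Fin d) (Fin n) ℝ}

theorem RankBranch.ne_of_mem_firstIndices (hn : 3 ≤ n) (ha : 0 ≤ a) (hε : 0 < ε)
    (hut : ∀ i, 0 < x.ut i) (hr : RankBranch a ε x un)
    (hπ : Antitone fun j => |relDev x un (π j)|) {i : Fin n}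
    (hi : i ∈ firstIndices π (batchSize a ε x un π)) : un i ≠ x.ut i := fun h =>
  hr.relDev_ne_zero_of_mem hn ha hε hπ hi (by rw [relDev, h, div_self (hut i).ne', sub_self])

theorem piecewise_pos {S : Finset (Fin n)} {u u' : Fin n → ℝ} (hu : ∀ i, 0 < u i)
    (hu' : ∀ i, 0 < u' i) (i : Fin n) : 0 < S.piecewise u u' i :=
  S.piecewise_cases u u' (0 < ·) (hu i) (hu' i)

theorem isUpdate_batchState (f : ℝ → ℝ) (hr : RankBranch a ε x un)
    (hπ : Antitone fun j => |relDev x un (π j)|) :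
    let y := batchState f x un vn (firstIndices π (batchSize a ε x un π))
    IsUpdate a ε f x un vn y ⟨y.ut, vn, fun i => f (vn i), fun i => √(y.ut i) * y.w i⟩ := by
  have ite_eq (S : Finset (Fin n)) [∀ i, Decidable (i ∈ S)] (i : Fin n) :
      (if i ∈ S then un i else x.ut i) = S.piecewise un x.ut i := by
    rw [Finset.piecewise]
  refine ⟨π, hπ, ?_⟩
  simp only [if_pos hr, ite_eq, batchState, and_self]

theorem exists_batchProgram_of_le (hn : 3 ≤ n) (ha : 0 ≤ a) {tm ti : ℕ → ℕ}
    (hm : ∀ k : ℕ, (n : ℝ) ^ a ≤ k → k ≤ n →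
      MulBound (Fin n) (Fin k) (Fin n) (tm k) ∧ InvBound (Fin k) (ti k)) :
    ∃ PB : Finset (Fin n) → Prog (DSReg n d), ∀ A ε f x un vn σ (π : Equiv.Perm (Fin n)),
      A.rank = d → 0 < ε → x.M = projCore A x.ut → (∀ i, 0 < x.ut i) → (∀ i, 0 < un i) →
      HoldsData σ A ε → HoldsInput σ un vn → HoldsState σ x → RankBranch a ε x un →
      Antitone (fun j => |relDev x un (π j)|) →
      let k := batchSize a ε x un π
      let σ' := (PB (firstIndices π k)).run f σ
      let y := batchState f x un vn (firstIndices π k)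
      HoldsData σ' A ε ∧ HoldsState σ' y ∧ (∀ i, σ' (.fv i) = f (vn i)) ∧
        (∀ i, σ' (.r i) = √(y.ut i) * y.w i) ∧
        (PB (firstIndices π k)).cost f σ ≤ 4 * tm k + ti k + 9 * (n * n) + 27 * n + 2 := by
  classical
  have hcard (S : Finset (Fin n)) : S.card ≤ n := S.card_le_univ.trans_eq (Fintype.card_fin n)
  choose batch hbatch using fun (S : Finset (Fin n)) (hS : (n : ℝ) ^ a ≤ S.card) =>
    exists_batchProgram (d := d) (hm _ hS (hcard S)).1 (hm _ hS (hcard S)).2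
  refine ⟨fun S => if hS : (n : ℝ) ^ a ≤ S.card then batch S hS else .halt,
    fun A ε f x un vn σ π hA hε hM hut hun hd hin hx hr hπ => ?_⟩
  have hS := card_firstIndices π (batchSize_le (a := a) (ε := ε) (s := x) (un := un) (π := π))
  have hne (i) (hi : i ∈ firstIndices π (batchSize a ε x un π)) : un i ≠ x.ut i :=
    hr.ne_of_mem_firstIndices hn ha hε hut hπ hi
  have hcap := isUnit_capMatrix_projCore hA hut (piecewise_pos hun hut)
    (fun i hi => (Finset.piecewise_eq_of_mem _ _ _ hi).trans_ne (hne i hi))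
    fun i hi => Finset.piecewise_eq_of_notMem _ _ _ hi
  have hle : (n : ℝ) ^ a ≤ (firstIndices π (batchSize a ε x un π)).card :=
    hr.trans (by rw [hS]; exact_mod_cast numLarge_le_batchSize)
  have spec := hbatch _ hle A ε f x un vn σ hd hin hx hne (hM ▸ hcap)
  simp only [dif_pos hle]
  rwa [hS] at spec

theorem exists_updateProgram (hn : 3 ≤ n) (ha : 0 ≤ a) {tm ti : ℕ → ℕ}
    (hm : ∀ k : ℕ, (n : ℝ) ^ a ≤ k → k ≤ n →
      MulBound (Fin n) (Fin k) (Fin n) (tm k) ∧ InvBound (Fin k) (ti k)) :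
    ∃ P : Prog (DSReg n d), ∀ A ε f x un vn, A.rank = d → 0 < ε → x.M = projCore A x.ut →
      (∀ i, 0 < x.ut i) → (∀ i, 0 < un i) → ImplementsUpdate P a A ε f x un vn ∧
      ∀ σ, HoldsData σ A ε → HoldsInput σ un vn → HoldsState σ x →
        (¬ RankBranch a ε x un → P.cost f σ ≤ 9 * n) ∧
        (RankBranch a ε x un → ∃ π : Equiv.Perm (Fin n), Antitone (fun j => |relDev x un (π j)|) ∧
          P.cost f σ ≤ 4 * tm (batchSize a ε x un π) + ti (batchSize a ε x un π) +
            50 * (n * n)) := by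
  obtain ⟨PB, hPB⟩ := exists_batchProgram_of_le (d := d) hn ha hm
  obtain ⟨P, hP⟩ := exists_branchProgram (by omega) ha PB
  refine ⟨P, fun A ε f x un vn hA hε hM hut hun => ⟨fun σ hd hin hx => ?_, fun σ hd hin hx => ?_⟩⟩
    <;> obtain ⟨small, large⟩ := hd.2 ▸ hP f x un vn σ hin hx
  · by_cases hr : RankBranch a ε x un
    · obtain ⟨π, hπ, σ', scratch, run_eq, -⟩ := large hr
      obtain ⟨hdata, hstate, hfv, hout, -⟩ := hPB A ε f x un vn σ' π hA hε hM hut hun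
        (scratch.holdsData hd) (scratch.holdsInput hin) (scratch.holdsState hx) hr hπ
      rw [← run_eq] at hdata hstate hfv hout
      exact ⟨hdata, fun _ => ⟨_, _, isUpdate_batchState f hr hπ, hstate, hfv, hout⟩,
        fun h => absurd hr h⟩
    · have scratch := (small hr).1
      exact ⟨scratch.holdsData hd, fun h => absurd h hr,
        fun _ => ⟨scratch.holdsInput hin, scratch.holdsState hx⟩⟩
  · refine ⟨fun hr => (small hr).2, fun hr => ?_⟩
    obtain ⟨π, hπ, σ', scratch, -, cost_le⟩ := large hr
    obtain ⟨-, -, -, -, cost_batch⟩ := hPB A ε f x un vn σ' π hA hε hM hut hun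
      (scratch.holdsData hd) (scratch.holdsInput hin) (scratch.holdsState hx) hr hπ
    refine ⟨π, hπ, cost_le.trans ?_⟩
    nlinarith

end UpdateProgram

section Execution

variable {n d : ℕ} {a ε C : ℝ} {f : ℝ → ℝ} {A : Matrix (Fin d) (Fin n) ℝ}

theorem IsUpdate.exists_perm {x x' : DSState n} {un vn : Fin n → ℝ} {o : DSOutput n}
    (h : IsUpdate a ε f x un vn x' o) :
    ∃ π : Equiv.Perm (Fin n), Antitone (fun j => |relDev x un (π j)|) ∧
      (RankBranch a ε x un →
        x'.ut = (firstIndices π (batchSize a ε x un π)).piecewise un x.ut ∧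
        x'.M = x.M - woodburyTerm x.M (x'.ut - x.ut) (firstIndices π (batchSize a ε x un π))) ∧
      (¬ RankBranch a ε x un → x'.ut = x.ut ∧ x'.M = x.M) := by
  obtain ⟨π, hπ, h⟩ := h
  refine ⟨π, hπ, fun hr => ?_, fun hr => ?_⟩
  · simp only [if_pos hr] at h
    have hut : x'.ut = (firstIndices π (batchSize a ε x un π)).piecewise un x.ut := by
      rw [h.2.2.1]
      funext i
      rw [Finset.piecewise]
    exact ⟨hut, by rw [h.1, h.2.2.1]⟩
  · simp only [if_neg hr] at h
    split_ifs at h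
    · exact ⟨h.2.2.1, h.1⟩
    · exact ⟨by rw [h.1], by rw [h.1]⟩

theorem IsUpdate.invariant {x x' : DSState n} {un vn : Fin n → ℝ} {o : DSOutput n}
    (h : IsUpdate a ε f x un vn x' o) (hn : 3 ≤ n) (ha : 0 ≤ a) (hA : A.rank = d) (hε : 0 < ε)
    (hun : ∀ i, 0 < un i) (hut : ∀ i, 0 < x.ut i) (hM : x.M = projCore A x.ut) :
    (∀ i, 0 < x'.ut i) ∧ x'.M = projCore A x'.ut := by
  obtain ⟨π, hπ, rank, small⟩ := h.exists_perm
  by_cases hr : RankBranch a ε x un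
  · obtain ⟨hut', hM'⟩ := rank hr
    have hpos : ∀ i, 0 < x'.ut i := hut' ▸ piecewise_pos hun hut
    refine ⟨hpos, ?_⟩
    rw [hM', hM]
    refine projCore_sub_woodburyTerm hA hut hpos (fun i hi => ?_) fun i hi => ?_
    · rw [hut', Finset.piecewise_eq_of_mem _ _ _ hi]
      exact hr.ne_of_mem_firstIndices hn ha hε hut hπ hi
    · rw [hut', Finset.piecewise_eq_of_notMem _ _ _ hi]
  · rw [(small hr).1, (small hr).2]
    exact ⟨hut, hM⟩

variable {T : ℕ} {u v : ℕ → Fin n → ℝ} {s : ℕ → DSState n}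

theorem SmallChange.pos (h : SmallChange C T u) (h0 : ∀ i, 0 < u 0 i) :
    ∀ t ≤ T, ∀ i, 0 < u t i := by
  intro t
  induction t with
  | zero => exact fun _ => h0
  | succ t ih =>
    intro ht i
    have hpos := ih (by omega) i
    have hle := neg_le_of_abs_le ((h t (by omega)).2 i)
    rw [le_div_iff₀ hpos] at hle
    linarith

theorem IsExecution.invariant (h : IsExecution a ε A f T u v s) (hn : 3 ≤ n) (ha : 0 ≤ a)
    (hA : A.rank = d) (hε : 0 < ε) (hpos : ∀ t ≤ T, ∀ i, 0 < u t i) :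
    ∀ t ≤ T, (∀ i, 0 < (s t).ut i) ∧ (s t).M = projCore A (s t).ut := by
  intro t
  induction t with
  | zero =>
    intro _
    rw [h.1]
    exact ⟨hpos 0 (Nat.zero_le T), rfl⟩
  | succ t ih =>
    intro ht
    obtain ⟨hut, hM⟩ := ih (by omega)
    obtain ⟨o, ho⟩ := h.2 t (by omega)
    exact ho.invariant hn ha hA hε (hpos _ ht) hut hM

theorem sortedAbs_eq_of_antitone {y : Fin n → ℝ} {π τ : Equiv.Perm (Fin n)}
    (hπ : Antitone fun j => |y (π j)|) (hτ : Antitone fun j => |y (τ j)|) :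
    sortedAbs y π = sortedAbs y τ := by
  have h : (fun i => -|y i|) ∘ π = (fun i => -|y i|) ∘ τ :=
    Tuple.unique_monotone (fun i j hij => neg_le_neg (hπ hij)) fun i j hij => neg_le_neg (hτ hij)
  funext k
  rw [sortedAbs, sortedAbs]
  split_ifs with hk
  · exact neg_injective (congrFun h _)
  · rfl

theorem batchSize_eq_of_antitone {x : DSState n} {un : Fin n → ℝ} {π τ : Equiv.Perm (Fin n)}
    (hπ : Antitone fun j => |relDev x un (π j)|) (hτ : Antitone fun j => |relDev x un (τ j)|) :
    batchSize a ε x un π = batchSize a ε x un τ := by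
  rw [batchSize, batchSize, sortedAbs_eq_of_antitone hπ hτ]

end Execution

/-! ### Sorted weighted sums -/

section SortedSum

variable {n k : ℕ} {g z : Fin n → ℝ} {π : Equiv.Perm (Fin n)} {D : ℝ}

/-- The entries of `z` listed in non-increasing order. -/
noncomputable def sortedDesc (z : Fin n → ℝ) : Fin n → ℝ :=
  z ∘ Tuple.sort (-z)

/-- The sum of the entries of `z` weighted by `g`, where `g j` is the weight of the `j`-th largest
entry. This is the shape of the potential function. -/
noncomputable def sortedSum (g z : Fin n → ℝ) : ℝ :=
  ∑ j, g j * sortedDesc z j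

theorem antitone_sortedDesc (z : Fin n → ℝ) : Antitone (sortedDesc z) := fun _ _ hij =>
  neg_le_neg_iff.1 (Tuple.monotone_sort (-z) hij)

theorem sum_mul_perm_le_sortedSum (hg : Antitone g) (z : Fin n → ℝ) (σ : Equiv.Perm (Fin n)) :
    ∑ j, g j * z (σ j) ≤ sortedSum g z := by
  have h := (hg.monovary (antitone_sortedDesc z)).sum_mul_comp_perm_le_sum_mul
    (σ := σ.trans (Tuple.sort (-z)).symm)
  simpa [sortedSum, sortedDesc] using h

theorem sortedSum_le_add (hg : Antitone g) (hg0 : ∀ j, 0 ≤ g j) {z' e : Fin n → ℝ} {E : ℝ}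
    (hE : 0 ≤ E) (h : ∀ i, z' i ≤ z i + e i) (he : ∑ i, e i ^ 2 ≤ E ^ 2) :
    sortedSum g z' ≤ sortedSum g z + E * √(∑ j, g j ^ 2) := by
  let τ := Tuple.sort (-z')
  have cauchy_schwarz : ∑ j, g j * e (τ j) ≤ E * √(∑ j, g j ^ 2) := by
    refine (Real.sum_mul_le_sqrt_mul_sqrt _ _ _).trans ?_
    rw [mul_comm, Equiv.sum_comp τ fun i => e i ^ 2]
    gcongr
    exact (Real.sqrt_le_left hE).2 he
  calc sortedSum g z' ≤ ∑ j, (g j * z (τ j) + g j * e (τ j)) := by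
        refine Finset.sum_le_sum fun j _ => ?_
        rw [← mul_add]
        exact mul_le_mul_of_nonneg_left (h _) (hg0 j)
    _ ≤ sortedSum g z + E * √(∑ j, g j ^ 2) := by
        rw [Finset.sum_add_distrib]
        exact add_le_add (sum_mul_perm_le_sortedSum hg z τ) cauchy_schwarz

theorem sortedDesc_piecewise_zero_le {b : ℝ} (hb : 0 ≤ b) {j : Fin n}
    (h : ∀ i : Fin n, (j : ℕ) + k ≤ i → z (π i) ≤ b) :
    sortedDesc ((firstIndices π k).piecewise 0 z) j ≤ b := by
  set z' := (firstIndices π k).piecewise 0 z with hz'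
  by_contra! hlt
  have hmem : ∀ l : Fin n, sortedDesc z' j ≤ sortedDesc z' l →
      (π.symm (Tuple.sort (-z') l) : ℕ) ∈ Finset.Ico k (j + k) := by
    intro l hl
    replace hl : b < z' (Tuple.sort (-z') l) := hlt.trans_le hl
    generalize Tuple.sort (-z') l = i at hl
    by_cases hi : i ∈ firstIndices π k
    · rw [hz', Finset.piecewise_eq_of_mem _ _ _ hi] at hl
      exact absurd hl hb.not_gt
    · rw [hz', Finset.piecewise_eq_of_notMem _ _ _ hi] at hl
      refine Finset.mem_Ico.2 ⟨by simpa [firstIndices] using hi, ?_⟩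
      by_contra! hle
      exact absurd hl (by simpa using h _ hle)
  have hcard : (Finset.univ.filter fun l => sortedDesc z' j ≤ sortedDesc z' l).card ≤
      (Finset.Ico k (j + k)).card :=
    Finset.card_le_card_of_injOn _ (fun l hl => hmem l (Finset.mem_filter.1 hl).2)
      ((Fin.val_injective.comp (π.symm.injective.comp (Equiv.injective _))).injOn)
  have := (le_apply_iff_lt_card_filter (antitone_sortedDesc z') _ j).1 le_rfl
  rw [Nat.card_Ico] at hcard
  omega

theorem half_le_card_filter (hk : k ≤ n) : (k : ℝ) / 2 ≤
    ((Finset.univ.filter fun j : Fin n => k / 2 ≤ (j : ℕ) ∧ (j : ℕ) < k).card : ℝ) := by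
  have hcard : (Finset.Ico (k / 2) k).card ≤
      (Finset.univ.filter fun j : Fin n => k / 2 ≤ (j : ℕ) ∧ (j : ℕ) < k).card := by
    refine Finset.card_le_card_of_surjOn (fun j : Fin n => (j : ℕ)) fun m hm => ?_
    rw [Finset.coe_Ico, Set.mem_Ico] at hm
    exact ⟨⟨m, by omega⟩, by simpa using hm, rfl⟩
  rw [Nat.card_Ico] at hcard
  rw [div_le_iff₀' two_pos]
  exact_mod_cast (by omega)

theorem sortedSum_piecewise_zero_add_le (hg : Antitone g) (hg0 : ∀ j, 0 ≤ g j) (hz : ∀ i, 0 ≤ z i)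
    (hπ : Antitone fun j => z (π j)) {l : Fin n} (hl : (l : ℕ) + 1 = k) (hD0 : 0 ≤ D)
    (hD : ∀ i : Fin n, (i : ℕ) < k → D ≤ z (π i))
    (hgap : ∀ i j : Fin n, (i : ℕ) < k → 3 * k ≤ 2 * j + 1 → z (π j) + D ≤ z (π i)) :
    sortedSum g ((firstIndices π k).piecewise 0 z) + k / 2 * (g l * D) ≤ sortedSum g z := by
  set w := sortedDesc ((firstIndices π k).piecewise 0 z)
  have hle : ∀ j, w j ≤ z (π j) := fun j =>
    sortedDesc_piecewise_zero_le (hz _) fun i hi => hπ (Fin.le_def.2 (by omega))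
  have hadd : ∀ j : Fin n, k / 2 ≤ (j : ℕ) → (j : ℕ) < k → w j + D ≤ z (π j) := by
    intro j hj hjk
    refine le_sub_iff_add_le.1 (sortedDesc_piecewise_zero_le (sub_nonneg.2 (hD j hjk)) ?_)
    exact fun i hi => le_sub_iff_add_le.2 (hgap j i hjk (by omega))
  have hsum : ∑ j, g j * w j +
      ∑ _j ∈ Finset.univ.filter fun j : Fin n => k / 2 ≤ (j : ℕ) ∧ (j : ℕ) < k, g l * D ≤
        ∑ j, g j * z (π j) := by
    rw [Finset.sum_filter, ← Finset.sum_add_distrib]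
    refine Finset.sum_le_sum fun j _ => ?_
    split_ifs with hj
    · have hgl : g l ≤ g j := hg (Fin.le_def.2 (by omega))
      calc g j * w j + g l * D ≤ g j * w j + g j * D := by gcongr
        _ = g j * (w j + D) := by ring
        _ ≤ g j * z (π j) := mul_le_mul_of_nonneg_left (hadd j hj.1 hj.2) (hg0 j)
    · rw [add_zero]
      exact mul_le_mul_of_nonneg_left (hle j) (hg0 j)
  rw [Finset.sum_const, nsmul_eq_mul] at hsum
  calc sortedSum g ((firstIndices π k).piecewise 0 z) + k / 2 * (g l * D)
      ≤ ∑ j, g j * w j + _ * (g l * D) :=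
        add_le_add_right (mul_le_mul_of_nonneg_right (half_le_card_filter (n := n) (by omega))
          (mul_nonneg (hg0 l) hD0)) _
    _ ≤ ∑ j, g j * z (π j) := hsum
    _ ≤ sortedSum g z := sum_mul_perm_le_sortedSum hg z π

end SortedSum

section Estimates

theorem three_halves_le_logb_two {n : ℕ} (hn : 3 ≤ n) : 3 / 2 ≤ Real.logb 2 n := by
  have hnR : (3 : ℝ) ≤ n := by exact_mod_cast hn
  have h := Real.logb_le_logb_of_le (b := 2) (by norm_num) (by norm_num)
    (show (2 : ℝ) ^ 3 ≤ (n : ℝ) ^ 2 by nlinarith)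
  rw [Real.logb_pow, Real.logb_pow, Real.logb_self_eq_one (by norm_num)] at h
  push_cast at h
  linarith

theorem le_two_mul_logb_two {n m : ℕ} (hm : 3 ^ m ≤ 2 ^ m * n) :
    (m : ℝ) ≤ 2 * Real.logb 2 n := by
  have hpow : (2 : ℝ) ^ m ≤ (n : ℝ) ^ 2 := by
    refine le_of_mul_le_mul_right ?_ (show (0 : ℝ) < 4 ^ m by positivity)
    calc (2 : ℝ) ^ m * 4 ^ m = 8 ^ m := by rw [← mul_pow]; norm_num
      _ ≤ 9 ^ m := by gcongr; norm_num
      _ = (3 ^ m) ^ 2 := by rw [← pow_mul, mul_comm, pow_mul]; norm_num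
      _ ≤ (2 ^ m * n) ^ 2 := by gcongr; exact_mod_cast hm
      _ = (n : ℝ) ^ 2 * 4 ^ m := by rw [mul_pow, ← pow_mul, mul_comm m, pow_mul]; norm_num; ring
  have h := Real.logb_le_logb_of_le (b := 2) (by norm_num) (by positivity) hpow
  rw [Real.logb_pow, Real.logb_pow, Real.logb_self_eq_one (by norm_num)] at h
  push_cast at h
  linarith

theorem exp_neg_six_le_pow {n m : ℕ} (hn : 3 ≤ n) (hm : 3 ^ m ≤ 2 ^ m * n) :
    Real.exp (-6) ≤ (1 - 1 / Real.logb 2 n) ^ m := by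
  have hL := three_halves_le_logb_two hn
  have hmL := le_two_mul_logb_two hm
  have hpos := one_sub_inv_logb_pos hn
  set L := Real.logb 2 n
  have hlog : -(1 / (L - 1)) ≤ Real.log (1 - 1 / L) := by
    refine le_trans (le_of_eq ?_) (Real.one_sub_inv_le_log_of_pos hpos)
    have : L ≠ 0 := by linarith
    have : L - 1 ≠ 0 := by linarith
    field_simp
    ring
  rw [← Real.exp_log (pow_pos hpos m), Real.exp_le_exp, Real.log_pow]
  calc (-6 : ℝ) ≤ m * -(1 / (L - 1)) := by
        rw [mul_neg, neg_le_neg_iff, mul_one_div, div_le_iff₀ (by linarith)]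
        linarith
    _ ≤ m * Real.log (1 - 1 / L) := mul_le_mul_of_nonneg_left hlog (Nat.cast_nonneg m)

theorem rpow_add_mul_rpow_sub_one_le {s x : ℝ} (hs : 0 < s) (hs1 : s ≤ 1) (hx : 0 ≤ x) :
    x ^ s + s * (x + 1) ^ (s - 1) ≤ (x + 1) ^ s := by
  have hx1 : 0 < x + 1 := by positivity
  have hinv : 1 / (x + 1) ≤ 1 := (div_le_one hx1).2 (by linarith)
  have hmul : x = (x + 1) * (1 + -(1 / (x + 1))) := by
    field_simp
    ring
  rw [← le_sub_iff_add_le]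
  calc x ^ s = ((x + 1) * (1 + -(1 / (x + 1)))) ^ s := by rw [← hmul]
    _ = (x + 1) ^ s * (1 + -(1 / (x + 1))) ^ s := Real.mul_rpow hx1.le (by linarith)
    _ ≤ (x + 1) ^ s * (1 + s * -(1 / (x + 1))) := by
        gcongr
        exact rpow_one_add_le_one_add_mul_self (by linarith) hs.le hs1
    _ = (x + 1) ^ s - s * (x + 1) ^ (s - 1) := by
        rw [Real.rpow_sub hx1, Real.rpow_one]
        ring

theorem sum_rpow_sub_one_le {s : ℝ} (hs : 0 < s) (hs1 : s ≤ 1) (n : ℕ) :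
    ∑ j ∈ Finset.range n, ((j : ℝ) + 1) ^ (s - 1) ≤ (n : ℝ) ^ s / s := by
  rw [le_div_iff₀ hs]
  induction n with
  | zero => simp [Real.zero_rpow hs.ne']
  | succ n ih =>
    rw [Finset.sum_range_succ, add_mul]
    push_cast
    linarith [rpow_add_mul_rpow_sub_one_le hs hs1 n.cast_nonneg]

end Estimates

/-! ### The potential function -/

section Potential

variable {n d : ℕ} {g : Fin n → ℝ} {a ε C : ℝ} {x x' : DSState n} {u un : Fin n → ℝ}

/-- The potential of a state with respect to the exact vector `u`: the relative deviations,
truncated at `2 * ε` and weighted by `g` in non-increasing order. -/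
noncomputable def potential (g : Fin n → ℝ) (ε : ℝ) (x : DSState n) (u : Fin n → ℝ) : ℝ :=
  sortedSum g fun i => min |relDev x u i| (2 * ε)

theorem potential_nonneg (hg0 : ∀ j, 0 ≤ g j) (hε : 0 ≤ ε) (x : DSState n) (u : Fin n → ℝ) :
    0 ≤ potential g ε x u := by
  have hmin : ∀ i, 0 ≤ min |relDev x u i| (2 * ε) := fun i => le_min (abs_nonneg _) (by linarith)
  unfold potential sortedSum
  exact Finset.sum_nonneg fun j _ => mul_nonneg (hg0 j) (hmin _)

theorem potential_congr_ut (h : x'.ut = x.ut) : potential g ε x' u = potential g ε x u := by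
  simp only [potential, relDev, h]

theorem relDev_eq_add {i : Fin n} (hx : x.ut i ≠ 0) (hu : u i ≠ 0) :
    relDev x un i = relDev x u i + (un i - u i) / u i * (1 + relDev x u i) := by
  simp only [relDev]
  field_simp
  ring

/-- Where the deviation exceeds the truncation level, nothing is left to gain; elsewhere
`1 + relDev x u i ≤ 1 + 2 * ε ≤ 3 / 2`. -/
theorem min_abs_relDev_le (hε : ε ≤ 1 / 4) {i : Fin n} (hx : x.ut i ≠ 0) (hu : u i ≠ 0) :
    min |relDev x un i| (2 * ε) ≤
      min |relDev x u i| (2 * ε) + 3 / 2 * |(un i - u i) / u i| := by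
  rcases le_total (2 * ε) |relDev x u i| with hlarge | hsmall
  · rw [min_eq_right hlarge]
    exact (min_le_right _ _).trans (le_add_of_nonneg_right (by positivity))
  · rw [min_eq_left hsmall]
    have h1 : |1 + relDev x u i| ≤ 3 / 2 :=
      (abs_add_le _ _).trans (by rw [abs_one]; linarith)
    calc min |relDev x un i| (2 * ε) ≤ |relDev x un i| := min_le_left _ _
      _ ≤ |relDev x u i| + |(un i - u i) / u i * (1 + relDev x u i)| := by
          rw [relDev_eq_add hx hu]
          exact abs_add_le _ _
      _ ≤ |relDev x u i| + 3 / 2 * |(un i - u i) / u i| := by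
          rw [abs_mul, mul_comm]
          gcongr

theorem potential_le_add (hg : Antitone g) (hg0 : ∀ j, 0 ≤ g j) (hε : ε ≤ 1 / 4) (hC : 0 ≤ C)
    (hx : ∀ i, x.ut i ≠ 0) (hu : ∀ i, u i ≠ 0)
    (h : ∑ i, ((un i - u i) / u i) ^ 2 ≤ C ^ 2) :
    potential g ε x un ≤ potential g ε x u + 3 / 2 * C * √(∑ j, g j ^ 2) := by
  refine sortedSum_le_add hg hg0 (e := fun i => 3 / 2 * |(un i - u i) / u i|) (by positivity)
    (fun i => min_abs_relDev_le hε (hx i) (hu i)) ?_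
  simp only [mul_pow, sq_abs, ← Finset.mul_sum]
  gcongr

theorem relDev_eq_piecewise {S : Finset (Fin n)} (hun : ∀ i, un i ≠ 0)
    (hx' : x'.ut = S.piecewise un x.ut) : relDev x' un = S.piecewise 0 (relDev x un) := by
  funext i
  rw [relDev, hx']
  by_cases hi : i ∈ S
  · rw [S.piecewise_eq_of_mem _ _ hi, S.piecewise_eq_of_mem _ _ hi, div_self (hun i), sub_self,
      Pi.zero_apply]
  · rw [S.piecewise_eq_of_notMem _ _ hi, S.piecewise_eq_of_notMem _ _ hi, relDev]

variable {π : Equiv.Perm (Fin n)}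

theorem sortedAbs_le_abs {y : Fin n → ℝ} (hπ : Antitone fun j => |y (π j)|) {k : ℕ} (hkn : k ≤ n)
    {i : Fin n} (hi : (i : ℕ) < k) : sortedAbs y π k ≤ |y (π i)| := by
  rw [sortedAbs, dif_pos ⟨by omega, hkn⟩]
  exact hπ (Nat.le_sub_one_of_lt hi)

theorem abs_le_sortedAbs {y : Fin n → ℝ} (hπ : Antitone fun j => |y (π j)|) {k : ℕ} (hk : 1 ≤ k)
    {i : Fin n} (hi : k ≤ (i : ℕ) + 1) : |y (π i)| ≤ sortedAbs y π k := by
  rw [sortedAbs, dif_pos ⟨hk, by omega⟩]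
  exact hπ (Fin.le_def.2 (Nat.sub_le_of_le_add hi))

theorem RankBranch.exp_mul_le_sortedAbs (h : RankBranch a ε x un) (hn : 3 ≤ n) (ha : 0 ≤ a)
    (hε : 0 ≤ ε) (hπ : Antitone fun j => |relDev x un (π j)|) :
    Real.exp (-6) * ε ≤ sortedAbs (relDev x un) π (batchSize a ε x un π) := by
  obtain ⟨m, hm, hle⟩ := h.exists_pow_mul_le_sortedAbs hn ha hπ
  exact (mul_le_mul_of_nonneg_right (exp_neg_six_le_pow hn hm) hε).trans hle

/-- The enlargement loop stops at a gap: beyond `3 / 2` times the batch size, the truncated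
deviations are smaller by `exp (-6) * ε / log n`. -/
theorem RankBranch.min_abs_relDev_add_le (h : RankBranch a ε x un) (hn : 3 ≤ n) (ha : 0 ≤ a)
    (hε : 0 ≤ ε) (hπ : Antitone fun j => |relDev x un (π j)|) {i j : Fin n}
    (hi : (i : ℕ) < batchSize a ε x un π) (hj : 3 * batchSize a ε x un π ≤ 2 * j + 1) :
    min |relDev x un (π j)| (2 * ε) + Real.exp (-6) * ε / Real.logb 2 n ≤
      min |relDev x un (π i)| (2 * ε) := by
  have hL := one_lt_logb_two hn
  have hgap := (h.batchSize_gap (by omega) ha (π := π)).resolve_left (by omega)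
  have hlow := h.exp_mul_le_sortedAbs hn ha hε hπ
  have hnum : numLarge ε (relDev x un) ≤ batchSize a ε x un π := numLarge_le_batchSize
  have hk : batchSize a ε x un π ≤ n := batchSize_le
  set k := batchSize a ε x un π
  set L := Real.logb 2 n
  have hgap_le : Real.exp (-6) * ε / L ≤ ε :=
    (div_le_self (by positivity) hL.le).trans
      (mul_le_of_le_one_left hε (Real.exp_le_one_iff.2 (by norm_num)))
  have hgap_le' : Real.exp (-6) * ε / L ≤ 1 / L * sortedAbs (relDev x un) π k := by
    rw [div_eq_inv_mul, one_div]
    gcongr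
  have hjlt : sortedAbs (relDev x un) π ((3 * k + 1) / 2) < ε := by
    rw [← not_le, le_sortedAbs_iff hπ ε (by omega) (by omega)]
    omega
  have hjle : min |relDev x un (π j)| (2 * ε) ≤ sortedAbs (relDev x un) π ((3 * k + 1) / 2) :=
    (min_le_left _ _).trans (abs_le_sortedAbs hπ (by omega) (by omega))
  refine le_min ?_ (by linarith)
  linarith [sortedAbs_le_abs hπ hk hi]

theorem RankBranch.potential_add_le (h : RankBranch a ε x un) (hg : Antitone g)
    (hg0 : ∀ j, 0 ≤ g j) (hn : 3 ≤ n) (ha : 0 ≤ a) (hε : 0 ≤ ε)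
    (hπ : Antitone fun j => |relDev x un (π j)|) (hun : ∀ i, un i ≠ 0)
    (hx' : x'.ut = (firstIndices π (batchSize a ε x un π)).piecewise un x.ut)
    {l : Fin n} (hl : (l : ℕ) + 1 = batchSize a ε x un π) :
    potential g ε x' un + batchSize a ε x un π / 2 *
      (g l * (Real.exp (-6) * ε / Real.logb 2 n)) ≤ potential g ε x un := by
  have hL := one_lt_logb_two hn
  have hgap_le : Real.exp (-6) * ε / Real.logb 2 n ≤ Real.exp (-6) * ε :=
    div_le_self (by positivity) hL.le
  have hexp : Real.exp (-6) * ε ≤ ε :=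
    mul_le_of_le_one_left hε (Real.exp_le_one_iff.2 (by norm_num))
  have hpot : potential g ε x' un = sortedSum g
      ((firstIndices π (batchSize a ε x un π)).piecewise 0
        fun i => min |relDev x un i| (2 * ε)) := by
    rw [potential, relDev_eq_piecewise hun hx']
    congr 1
    funext i
    simp only [Finset.piecewise]
    split_ifs
    · simpa using hε
    · rfl
  rw [hpot]
  refine sortedSum_piecewise_zero_add_le hg hg0 (fun i => le_min (abs_nonneg _) (by linarith))
    (fun i j hij => min_le_min_right _ (hπ hij)) hl (by positivity) (fun i hi => ?_)
    fun i j hi hj => h.min_abs_relDev_add_le hn ha hε hπ hi hj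
  refine le_min ?_ (by linarith)
  linarith [sortedAbs_le_abs hπ batchSize_le hi, h.exp_mul_le_sortedAbs hn ha hε hπ]

end Potential

section TotalBatchSize

variable {n d : ℕ} {a ε C θ : ℝ} {f : ℝ → ℝ} {x x' : DSState n} {un vn : Fin n → ℝ}

/-- The weights of the potential function; the exponent is chosen so that `k` times the `k`-th
weight is `k ^ θ`, the cost of a batch of size `k` up to a power of `n`. -/
noncomputable def potentialWeight (n : ℕ) (θ : ℝ) (j : Fin n) : ℝ :=
  ((j : ℝ) + 1) ^ (θ - 1)

theorem potentialWeight_nonneg (j : Fin n) : 0 ≤ potentialWeight n θ j :=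
  Real.rpow_nonneg (by positivity) _

theorem antitone_potentialWeight (hθ : θ ≤ 1) : Antitone (potentialWeight n θ) := by
  intro i j hij
  refine Real.rpow_le_rpow_of_nonpos (by positivity) ?_ (by linarith)
  have : (i : ℝ) ≤ (j : ℝ) := by exact_mod_cast hij
  linarith

theorem mul_potentialWeight {k : ℕ} {l : Fin n} (hl : (l : ℕ) + 1 = k) :
    (k : ℝ) * potentialWeight n θ l = (k : ℝ) ^ θ := by
  have hk : (0 : ℝ) < k := by exact_mod_cast (by omega : 0 < k)
  rw [potentialWeight, ← Nat.cast_add_one, hl, Real.rpow_sub_one hk.ne', mul_div_cancel₀ _ hk.ne']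

theorem sqrt_sum_potentialWeight_sq_le (hθ : 1 / 2 < θ) (hθ1 : θ ≤ 1) :
    √(∑ j, potentialWeight n θ j ^ 2) ≤ (n : ℝ) ^ (θ - 1 / 2) / √(2 * θ - 1) := by
  have hsum : ∑ j, potentialWeight n θ j ^ 2 ≤ (n : ℝ) ^ (2 * θ - 1) / (2 * θ - 1) := by
    have h := sum_rpow_sub_one_le (s := 2 * θ - 1) (by linarith) (by linarith) n
    rw [← Fin.sum_univ_eq_sum_range fun j => ((j : ℝ) + 1) ^ (2 * θ - 1 - 1)] at h
    refine (Finset.sum_congr rfl fun j _ => ?_).trans_le h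
    rw [potentialWeight, ← Real.rpow_mul_natCast (by positivity)]
    congr 1
    push_cast
    ring
  refine (Real.sqrt_le_sqrt hsum).trans_eq ?_
  rw [Real.sqrt_div (by positivity), Real.sqrt_eq_rpow, ← Real.rpow_mul (by positivity)]
  congr 2
  ring

theorem IsUpdate.potential_add_le {o : DSOutput n} (h : IsUpdate a ε f x un vn x' o)
    (hr : RankBranch a ε x un) (hn : 3 ≤ n) (ha : 0 ≤ a) (hε : 0 ≤ ε) (hθ : θ ≤ 1)
    (hun : ∀ i, un i ≠ 0) {π : Equiv.Perm (Fin n)}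
    (hπ : Antitone fun j => |relDev x un (π j)|) :
    potential (potentialWeight n θ) ε x' un +
      Real.exp (-6) * ε / Real.logb 2 n / 2 * (batchSize a ε x un π : ℝ) ^ θ ≤
        potential (potentialWeight n θ) ε x un := by
  obtain ⟨τ, hτ, rank, -⟩ := h.exists_perm
  have hk : 1 ≤ batchSize a ε x un τ :=
    (hr.one_le_numLarge (by omega) ha).trans numLarge_le_batchSize
  have hkn : batchSize a ε x un τ ≤ n := batchSize_le
  have hl : batchSize a ε x un τ - 1 + 1 = batchSize a ε x un τ := by omega
  have hpot := hr.potential_add_le (antitone_potentialWeight hθ) potentialWeight_nonneg hn ha hε hτ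
    hun (rank hr).1 (l := ⟨batchSize a ε x un τ - 1, by omega⟩) hl
  rw [batchSize_eq_of_antitone hπ hτ]
  refine le_trans (le_of_eq ?_) hpot
  rw [← mul_potentialWeight (l := (⟨batchSize a ε x un τ - 1, by omega⟩ : Fin n)) hl]
  ring

theorem potential_initState (g : Fin n → ℝ) (hε : 0 ≤ ε) (A : Matrix (Fin d) (Fin n) ℝ)
    {u v : Fin n → ℝ} (hu : ∀ i, u i ≠ 0) : potential g ε (initState A f u v) u = 0 := by
  have hdev : relDev (initState A f u v) u = 0 := by
    funext i
    rw [relDev, initState, div_self (hu i), sub_self, Pi.zero_apply]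
  simp [potential, sortedSum, sortedDesc, hdev, hε]

theorem add_sum_range_le_of_add_le {φ c : ℕ → ℝ} {b : ℝ} {T : ℕ}
    (h : ∀ t < T, φ (t + 1) + c t ≤ φ t + b) :
    φ T + ∑ t ∈ Finset.range T, c t ≤ φ 0 + T * b := by
  induction T with
  | zero => simp
  | succ T ih =>
    have hT := h T (by omega)
    have hsum := ih fun t ht => h t (by omega)
    rw [Finset.sum_range_succ]
    push_cast
    linarith

variable {A : Matrix (Fin d) (Fin n) ℝ} {T : ℕ} {u v : ℕ → Fin n → ℝ} {s : ℕ → DSState n}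
  {π : ℕ → Equiv.Perm (Fin n)}

theorem mem_rankCalls {t : ℕ} :
    t ∈ rankCalls a ε T u s ↔ t < T ∧ RankBranch a ε (s t) (u (t + 1)) := by
  simp only [rankCalls, Finset.mem_filter, Finset.mem_range]

theorem IsExecution.potential_step (h : IsExecution a ε A f T u v s) (hn : 3 ≤ n) (ha : 0 ≤ a)
    (hA : A.rank = d) (hε : 0 < ε) (hε' : ε ≤ 1 / 4) (hC : 0 ≤ C) (hθ1 : θ ≤ 1)
    (h0 : ∀ i, 0 < u 0 i) (hu : SmallChange C T u)
    (hπ : ∀ t ∈ rankCalls a ε T u s, Antitone fun j => |relDev (s t) (u (t + 1)) (π t j)|)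
    {t : ℕ} (ht : t < T) :
    potential (potentialWeight n θ) ε (s (t + 1)) (u (t + 1)) +
      (if t ∈ rankCalls a ε T u s then Real.exp (-6) * ε / Real.logb 2 n / 2 *
        (batchSize a ε (s t) (u (t + 1)) (π t) : ℝ) ^ θ else 0) ≤
      potential (potentialWeight n θ) ε (s t) (u t) +
        3 / 2 * C * √(∑ j, potentialWeight n θ j ^ 2) := by
  have hpos := hu.pos h0
  have hut := (h.invariant hn ha hA hε hpos t ht.le).1
  refine le_trans ?_ (potential_le_add (antitone_potentialWeight hθ1) potentialWeight_nonneg hε' hC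
    (fun i => (hut i).ne') (fun i => (hpos t ht.le i).ne') (hu t ht).1)
  obtain ⟨o, ho⟩ := h.2 t ht
  split_ifs with hr
  · exact ho.potential_add_le (mem_rankCalls.1 hr).2 hn ha hε.le hθ1
      (fun i => (hpos (t + 1) ht i).ne') (hπ t hr)
  · obtain ⟨-, -, -, small⟩ := ho.exists_perm
    rw [add_zero, potential_congr_ut (small fun hr' => hr (mem_rankCalls.2 ⟨ht, hr'⟩)).1]

theorem IsExecution.mul_sum_batchSize_rpow_le (h : IsExecution a ε A f T u v s) (hn : 3 ≤ n)
    (ha : 0 ≤ a) (hA : A.rank = d) (hε : 0 < ε) (hε' : ε ≤ 1 / 4) (hC : 0 ≤ C) (hθ1 : θ ≤ 1)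
    (h0 : ∀ i, 0 < u 0 i) (hu : SmallChange C T u)
    (hπ : ∀ t ∈ rankCalls a ε T u s, Antitone fun j => |relDev (s t) (u (t + 1)) (π t j)|) :
    Real.exp (-6) * ε / Real.logb 2 n / 2 *
        ∑ t ∈ rankCalls a ε T u s, (batchSize a ε (s t) (u (t + 1)) (π t) : ℝ) ^ θ ≤
      T * (3 / 2 * C * √(∑ j, potentialWeight n θ j ^ 2)) := by
  have total := add_sum_range_le_of_add_le
    (φ := fun t => potential (potentialWeight n θ) ε (s t) (u t)) fun t (ht : t < T) =>
      h.potential_step (θ := θ) hn ha hA hε hε' hC hθ1 h0 hu hπ ht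
  have hrange : Finset.range T ∩ rankCalls a ε T u s = rankCalls a ε T u s :=
    Finset.inter_eq_right.2 fun t ht => Finset.mem_range.2 (mem_rankCalls.1 ht).1
  rw [Finset.sum_ite_mem, hrange, ← Finset.mul_sum, h.1,
    potential_initState _ hε.le A fun i => (h0 i).ne', zero_add] at total
  linarith [potential_nonneg (potentialWeight_nonneg (θ := θ)) hε.le (s T) (u T)]

theorem IsExecution.sum_batchSize_rpow_le (h : IsExecution a ε A f T u v s) (hn : 3 ≤ n)
    (ha : 0 ≤ a) (hA : A.rank = d) (hε : 0 < ε) (hε' : ε ≤ 1 / 4) (hC : 0 ≤ C) (hθ : 1 / 2 < θ)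
    (hθ1 : θ ≤ 1) (h0 : ∀ i, 0 < u 0 i) (hu : SmallChange C T u)
    (hπ : ∀ t ∈ rankCalls a ε T u s, Antitone fun j => |relDev (s t) (u (t + 1)) (π t j)|) :
    ∑ t ∈ rankCalls a ε T u s, (batchSize a ε (s t) (u (t + 1)) (π t) : ℝ) ^ θ ≤
      3 * Real.exp 6 / √(2 * θ - 1) * (T * (C / ε * (n : ℝ) ^ (θ - 1 / 2) * Real.logb 2 n)) := by
  have hL := one_lt_logb_two hn
  have hmul := h.mul_sum_batchSize_rpow_le (θ := θ) hn ha hA hε hε' hC hθ1 h0 hu hπ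
  set Z := ∑ t ∈ rankCalls a ε T u s, (batchSize a ε (s t) (u (t + 1)) (π t) : ℝ) ^ θ
  set L := Real.logb 2 n
  have hexp : Real.exp (-6) * Real.exp 6 = 1 := by rw [← Real.exp_add]; simp
  calc Z = 2 * Real.exp 6 * L / ε * (Real.exp (-6) * ε / L / 2 * Z) := by
        field_simp
        linear_combination (-Z) * hexp
    _ ≤ 2 * Real.exp 6 * L / ε * (T * (3 / 2 * C * √(∑ j, potentialWeight n θ j ^ 2))) := by
        gcongr
    _ ≤ 2 * Real.exp 6 * L / ε *
          (T * (3 / 2 * C * ((n : ℝ) ^ (θ - 1 / 2) / √(2 * θ - 1)))) := by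
        gcongr
        exact sqrt_sum_potentialWeight_sq_le hθ hθ1
    _ = 3 * Real.exp 6 / √(2 * θ - 1) * (T * (C / ε * (n : ℝ) ^ (θ - 1 / 2) * L)) := by
        field_simp

end TotalBatchSize

/-! ### The total time of the updates -/

section TotalTime

/-- There is a program for `Update` on which `T` calls take time `T * (C / ε * B * log n)`, apart
from the body of the small-`k` branch, which takes time at most `9 * n` to reach. -/
def HasUpdateProgram (n d : ℕ) (a B : ℝ) : Prop :=
  ∃ P : Prog (DSReg n d),
    ∀ (A : Matrix (Fin d) (Fin n) ℝ) (ε : ℝ) (f : ℝ → ℝ),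
      A.rank = d → 0 < ε → ε < 1 / 4 →
    ∀ (C : ℝ) (T : ℕ) (u v : ℕ → Fin n → ℝ) (s : ℕ → DSState n),
      0 ≤ C → (∀ i, 0 < u 0 i) → SmallChange C T u → IsExecution a ε A f T u v s →
      (∀ t < T, ImplementsUpdate P a A ε f (s t) (u (t + 1)) (v (t + 1))) ∧
      ∀ σ : ℕ → DSReg n d → ℝ,
        (∀ t < T, HoldsData (σ t) A ε ∧ HoldsInput (σ t) (u (t + 1)) (v (t + 1)) ∧
          HoldsState (σ t) (s t)) →
        ∑ t ∈ rankCalls a ε T u s, (P.cost f (σ t) : ℝ) ≤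
          T * (C / ε * B * Real.logb 2 n) ∧
        ∀ t < T, ¬ RankBranch a ε (s t) (u (t + 1)) → (P.cost f (σ t) : ℝ) ≤ 9 * n

theorem HasUpdateProgram.mono {n d : ℕ} {a B B' : ℝ} (h : HasUpdateProgram n d a B) (hn : 3 ≤ n)
    (hB : B ≤ B') : HasUpdateProgram n d a B' := by
  obtain ⟨P, hP⟩ := h
  refine ⟨P, fun A ε f hA hε hε' C T u v s hC h0 hu hs => ?_⟩
  obtain ⟨impl, time⟩ := hP A ε f hA hε hε' C T u v s hC h0 hu hs
  refine ⟨impl, fun σ hσ => ⟨(time σ hσ).1.trans ?_, (time σ hσ).2⟩⟩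
  have := one_lt_logb_two hn
  gcongr

variable {ω a : ℝ}

/-- When `a = dualExponent`, the exponent `β` of the rectangular products has to be strictly below
`a`, and the hypothesis `5 / 2 - a / 2 < ω` leaves room for that. -/
theorem IsMatMulExponent.exists_rect_mulBound_rpow (hω : IsMatMulExponent ω) (ha : 0 ≤ a)
    (ha' : a ≤ dualExponent) (h : 5 / 2 - a / 2 < ω) :
    ∃ θ K : ℝ, 1 / 2 < θ ∧ θ ≤ 1 ∧ 0 ≤ K ∧
      ∀ n k : ℕ, 1 ≤ k → k ≤ n → (n : ℝ) ^ a ≤ k → ∃ t : ℕ, MulBound (Fin n) (Fin k) (Fin n) t ∧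
        n ^ 2 ≤ t ∧ (t : ℝ) ≤ K * ((n : ℝ) ^ ω * ((k : ℝ) / n) ^ θ) := by
  have ha1 := ha'.trans dualExponent_le_one
  obtain ⟨β, hβ0, hβ1, hβa, hβ, hβω⟩ : ∃ β : ℝ, 0 ≤ β ∧ β < 1 ∧ β ≤ a ∧
      (β = 0 ∨ β < dualExponent) ∧ 5 - 2 * ω < β := by
    rcases ha.eq_or_lt with rfl | ha0
    · exact ⟨0, le_rfl, one_pos, le_rfl, Or.inl rfl, by linarith⟩
    · obtain ⟨β, hlow, hβa⟩ := exists_between (max_lt ha0 (by linarith : 5 - 2 * ω < a))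
      obtain ⟨hβ0, hβω⟩ := max_lt_iff.1 hlow
      exact ⟨β, hβ0.le, hβa.trans_le ha1, hβa.le, Or.inr (hβa.trans_le ha'), hβω⟩
  obtain ⟨δ, hδ, hδω⟩ : ∃ δ : ℝ, 0 < δ ∧ 1 - β < 2 * (ω - 2 - δ) :=
    ⟨(β - (5 - 2 * ω)) / 4, by linarith, by linarith⟩
  obtain ⟨K, hK, hrect⟩ := hω.exists_rect_mulBound hβ0 hβ1 hβ hδ
  refine ⟨min 1 ((ω - 2 - δ) / (1 - β)), K, lt_min (by norm_num) ?_, min_le_left _ _, hK, ?_⟩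
  · rw [lt_div_iff₀ (by linarith)]
    linarith
  intro n k hk hkn hka
  have : (0 : ℝ) < k := by exact_mod_cast hk
  have hkn' : (k : ℝ) ≤ n := by exact_mod_cast hkn
  have hn1 : (1 : ℝ) ≤ n := by exact_mod_cast hk.trans hkn
  obtain ⟨t, ht, htn, htK⟩ := hrect n k hk hkn
    ((Real.rpow_le_rpow_of_exponent_le hn1 hβa).trans hka)
  refine ⟨t, ht, htn, htK.trans ?_⟩
  gcongr ?_ * (?_ * ?_)
  exact Real.rpow_le_rpow_of_exponent_ge (by positivity) (div_le_one_of_le₀ hkn' (by positivity))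
    (min_le_right _ _)

theorem rpow_mul_div_rpow {x y : ℝ} (hx : 0 < x) (hy : 0 ≤ y) (p q : ℝ) :
    x ^ p * (y / x) ^ q = x ^ (p - q) * y ^ q := by
  rw [Real.div_rpow hy hx.le, Real.rpow_sub hx]
  ring

theorem IsMatMulExponent.exists_batch_bound (hω : IsMatMulExponent ω) (ha : 0 ≤ a)
    (ha' : a ≤ dualExponent) (h : 5 / 2 - a / 2 < ω) :
    ∃ θ K : ℝ, 1 / 2 < θ ∧ θ ≤ 1 ∧ 0 ≤ K ∧
      ∀ n k : ℕ, 1 ≤ k → k ≤ n → (n : ℝ) ^ a ≤ k → ∃ tm ti : ℕ,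
        MulBound (Fin n) (Fin k) (Fin n) tm ∧ InvBound (Fin k) ti ∧
          4 * (tm : ℝ) + ti + 50 * (n * n) ≤ K * ((n : ℝ) ^ (ω - θ) * (k : ℝ) ^ θ) := by
  obtain ⟨θ, K₁, hθ, hθ1, hK₁, hrect⟩ := hω.exists_rect_mulBound_rpow ha ha' h
  obtain ⟨K₂, hK₂, hinv⟩ := hω.exists_invBound
  refine ⟨θ, 54 * K₁ + K₂, hθ, hθ1, by positivity, fun n k hk hkn hka => ?_⟩
  have hk0 : (0 : ℝ) < k := by exact_mod_cast hk
  have hn0 : (0 : ℝ) < n := by exact_mod_cast hk.trans hkn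
  obtain ⟨tm, htm, hntm, htmK⟩ := hrect n k hk hkn hka
  obtain ⟨ti, hti, htiK⟩ := hinv k hk
  refine ⟨tm, ti, htm, hti, ?_⟩
  have hkω : (k : ℝ) ^ ω ≤ (n : ℝ) ^ ω * ((k : ℝ) / n) ^ θ := by
    calc (k : ℝ) ^ ω = (n : ℝ) ^ ω * ((k : ℝ) / n) ^ ω := by
          rw [rpow_mul_div_rpow hn0 hk0.le, sub_self, Real.rpow_zero, one_mul]
      _ ≤ (n : ℝ) ^ ω * ((k : ℝ) / n) ^ θ := by
          gcongr ?_ * ?_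
          exact Real.rpow_le_rpow_of_exponent_ge (by positivity)
            ((div_le_one hn0).2 (by exact_mod_cast hkn)) (hθ1.trans (by linarith [hω.two_le]))
  have hnn : (n : ℝ) * n ≤ tm := by exact_mod_cast (sq n).symm.trans_le hntm
  rw [← rpow_mul_div_rpow hn0 hk0.le]
  linarith [mul_le_mul_of_nonneg_left hkω hK₂]

theorem IsExecution.sum_le_of_le_batchSize_rpow {n d T : ℕ} {ε C θ K : ℝ} {f : ℝ → ℝ}
    {A : Matrix (Fin d) (Fin n) ℝ} {u v : ℕ → Fin n → ℝ} {s : ℕ → DSState n}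
    (h : IsExecution a ε A f T u v s) (hn : 3 ≤ n) (ha : 0 ≤ a) (hA : A.rank = d) (hε : 0 < ε)
    (hε' : ε ≤ 1 / 4) (hC : 0 ≤ C) (hθ : 1 / 2 < θ) (hθ1 : θ ≤ 1) (hK : 0 ≤ K)
    (h0 : ∀ i, 0 < u 0 i) (hu : SmallChange C T u) {c : ℕ → ℝ}
    (hc : ∀ t ∈ rankCalls a ε T u s, ∃ π : Equiv.Perm (Fin n),
      Antitone (fun j => |relDev (s t) (u (t + 1)) (π j)|) ∧
        c t ≤ K * ((n : ℝ) ^ (ω - θ) * (batchSize a ε (s t) (u (t + 1)) π : ℝ) ^ θ)) :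
    ∑ t ∈ rankCalls a ε T u s, c t ≤ T * (C / ε *
      (K * (3 * Real.exp 6 / √(2 * θ - 1)) * (n : ℝ) ^ (ω - 1 / 2)) * Real.logb 2 n) := by
  have hn0 : (0 : ℝ) < n := by positivity
  choose! π hπ hc using hc
  calc ∑ t ∈ rankCalls a ε T u s, c t
      ≤ K * ((n : ℝ) ^ (ω - θ) *
          ∑ t ∈ rankCalls a ε T u s, (batchSize a ε (s t) (u (t + 1)) (π t) : ℝ) ^ θ) := by
        rw [Finset.mul_sum, Finset.mul_sum]
        exact Finset.sum_le_sum hc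
    _ ≤ K * ((n : ℝ) ^ (ω - θ) * (3 * Real.exp 6 / √(2 * θ - 1) *
          (T * (C / ε * (n : ℝ) ^ (θ - 1 / 2) * Real.logb 2 n)))) := by
        gcongr
        exact h.sum_batchSize_rpow_le hn ha hA hε hε' hC hθ hθ1 h0 hu hπ
    _ = T * (C / ε * (K * (3 * Real.exp 6 / √(2 * θ - 1)) * (n : ℝ) ^ (ω - 1 / 2)) *
          Real.logb 2 n) := by
        rw [show ω - 1 / 2 = (ω - θ) + (θ - 1 / 2) by ring, Real.rpow_add hn0]
        ring

theorem IsMatMulExponent.exists_hasUpdateProgram (hω : IsMatMulExponent ω) (ha : 0 ≤ a)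
    (ha' : a ≤ dualExponent) (h : 5 / 2 - a / 2 < ω) :
    ∃ K : ℝ, ∀ n d : ℕ, 3 ≤ n → HasUpdateProgram n d a (K * (n : ℝ) ^ (ω - 1 / 2)) := by
  obtain ⟨θ, K, hθ, hθ1, hK, hbatch⟩ := hω.exists_batch_bound ha ha' h
  refine ⟨K * (3 * Real.exp 6 / √(2 * θ - 1)), fun n d hn => ?_⟩
  have hone : ∀ k : ℕ, (n : ℝ) ^ a ≤ k → 1 ≤ k := fun k hk => by
    exact_mod_cast (Real.one_le_rpow (by exact_mod_cast (by omega : 1 ≤ n)) ha).trans hk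
  choose! tm ti htm hti hcost using fun k hkn hka => hbatch n k (hone k hka) hkn hka
  obtain ⟨P, hP⟩ := exists_updateProgram (d := d) hn ha fun k hka hkn =>
    ⟨htm k hkn hka, hti k hkn hka⟩
  refine ⟨P, fun A ε f hA hε hε' C T u v s hC h0 hu hs => ?_⟩
  have hpos := hu.pos h0
  have inv := hs.invariant hn ha hA hε hpos
  have hcall := fun t (ht : t < T) => hP A ε f (s t) (u (t + 1)) (v (t + 1)) hA hε
    (inv t ht.le).2 (inv t ht.le).1 (hpos (t + 1) ht)
  refine ⟨fun t ht => (hcall t ht).1, fun σ hσ => ?_⟩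
  have htime := fun t ht => (hcall t ht).2 (σ t) (hσ t ht).1 (hσ t ht).2.1 (hσ t ht).2.2
  refine ⟨hs.sum_le_of_le_batchSize_rpow hn ha hA hε hε'.le hC hθ hθ1 hK h0 hu fun t ht => ?_,
    fun t ht hr => by exact_mod_cast (htime t ht).1 hr⟩
  obtain ⟨htT, hr⟩ := mem_rankCalls.1 ht
  obtain ⟨π, hπ, hle⟩ := (htime t htT).2 hr
  have hka : (n : ℝ) ^ a ≤ batchSize a ε (s t) (u (t + 1)) π :=
    hr.trans (Nat.cast_le.2 numLarge_le_batchSize)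
  exact ⟨π, hπ, le_trans (by exact_mod_cast hle) (hcost _ batchSize_le hka)⟩

end TotalTime

section Asymptotics

open Filter Topology

theorem rpow_add_log_div_log {n K : ℝ} (hn : 1 < n) (hK : 0 < K) (b : ℝ) :
    n ^ (b + Real.log K / Real.log n) = K * n ^ b := by
  have hn0 : 0 < n := one_pos.trans hn
  rw [Real.rpow_add hn0, Real.rpow_def_of_pos hn0 (Real.log K / _),
    mul_div_cancel₀ _ (Real.log_pos hn).ne', Real.exp_log hK, mul_comm]

/-- Take the minimum over `j ≤ n`: for each fixed `j`, the term `log (K j) / log n` eventually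
falls below `1 / (j + 1)`. -/
theorem exists_tendsto_zero_eq_add_log_div_log {K : ℕ → ℝ} (hK : ∀ j, 1 ≤ K j) :
    ∃ η : ℕ → ℝ, Tendsto η atTop (𝓝 0) ∧
      ∀ n : ℕ, ∃ j : ℕ, η n = 1 / ((j : ℝ) + 1) + Real.log (K j) / Real.log n := by
  let e : ℕ → ℕ → ℝ := fun n j => 1 / ((j : ℝ) + 1) + Real.log (K j) / Real.log n
  have nonneg : ∀ n j, 0 ≤ e n j := fun n j => by
    have := Real.log_nonneg (hK j)
    have := Real.log_natCast_nonneg n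
    positivity
  have hne : ∀ n : ℕ, (Finset.range (n + 1)).Nonempty := fun n => ⟨0, by simp⟩
  refine ⟨fun n => (Finset.range (n + 1)).inf' (hne n) (e n), ?_, fun n => ?_⟩
  · refine tendsto_order.2 ⟨fun r hr => .of_forall fun n => ?_, fun r hr => ?_⟩
    · exact hr.trans_le (Finset.le_inf' _ _ fun j _ => nonneg n j)
    · obtain ⟨j, hj⟩ := exists_nat_one_div_lt hr
      have hlim : Tendsto (fun n : ℕ => e n j) atTop (𝓝 (1 / ((j : ℝ) + 1) + 0)) :=
        ((Real.tendsto_log_atTop.comp tendsto_natCast_atTop_atTop).const_div_atTop _).const_add _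
      rw [add_zero] at hlim
      filter_upwards [hlim.eventually_lt_const hj, eventually_ge_atTop j] with n hlt hjn
      exact (Finset.inf'_le _ (Finset.mem_range.2 (Nat.lt_succ_of_le hjn))).trans_lt hlt
  · obtain ⟨j, -, hj⟩ := Finset.exists_mem_eq_inf' (hne n) (e n)
    exact ⟨j, hj⟩

theorem exists_tendsto_zero_of_forall_pos {b : ℝ} {p : ℕ → ℝ → Prop} {n₀ : ℕ} (hn₀ : 1 < n₀)
    (hp : ∀ n, n₀ ≤ n → ∀ x y, x ≤ y → p n x → p n y)
    (h : ∀ δ : ℝ, 0 < δ → ∃ K : ℝ, ∀ n : ℕ, n₀ ≤ n → p n (K * (n : ℝ) ^ (b + δ))) :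
    ∃ η : ℕ → ℝ, Tendsto η atTop (𝓝 0) ∧ ∀ n : ℕ, n₀ ≤ n → p n ((n : ℝ) ^ (b + η n)) := by
  have hmax : ∀ j : ℕ, ∃ K : ℝ, 1 ≤ K ∧ ∀ n : ℕ, n₀ ≤ n →
      p n (K * (n : ℝ) ^ (b + 1 / ((j : ℝ) + 1))) := fun j => by
    obtain ⟨K, hK⟩ := h (1 / ((j : ℝ) + 1)) (by positivity)
    refine ⟨max 1 K, le_max_left _ _, fun n hn => hp n hn _ _ ?_ (hK n hn)⟩
    gcongr
    exact le_max_right _ _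
  choose K one_le hK using hmax
  obtain ⟨η, hη, heq⟩ := exists_tendsto_zero_eq_add_log_div_log one_le
  refine ⟨η, hη, fun n hn => ?_⟩
  obtain ⟨j, hj⟩ := heq n
  rw [hj, ← add_assoc, rpow_add_log_div_log (by exact_mod_cast hn₀.trans_le hn)
    (one_pos.trans_le (one_le j))]
  exact hK j n hn

end Asymptotics

/-- If `ω ≤ 5 / 2 - a / 2`, then every larger number is also a matrix multiplication exponent, and
letting it tend to `5 / 2 - a / 2` gives the term `n ^ (2 - a / 2 + o(1))`. -/
theorem IsMatMulExponent.exists_hasUpdateProgram_add {ω a : ℝ} (hω : IsMatMulExponent ω)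
    (ha : 0 ≤ a) (ha' : a ≤ dualExponent) :
    ∃ (K : ℝ) (η : ℕ → ℝ), 9 ≤ K ∧ Filter.Tendsto η Filter.atTop (nhds 0) ∧
      ∀ n d : ℕ, 3 ≤ n → HasUpdateProgram n d a
        (K * ((n : ℝ) ^ (ω - 1 / 2) + (n : ℝ) ^ (2 - a / 2 + η n))) := by
  rcases lt_or_ge (5 / 2 - a / 2) ω with h | h
  · obtain ⟨K, hK⟩ := hω.exists_hasUpdateProgram ha ha' h
    refine ⟨max 9 K, 0, le_max_left _ _, tendsto_const_nhds, fun n d hn => (hK n d hn).mono hn ?_⟩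
    calc K * (n : ℝ) ^ (ω - 1 / 2) ≤ max 9 K * (n : ℝ) ^ (ω - 1 / 2) := by
          gcongr
          exact le_max_right _ _
      _ ≤ _ := by
          gcongr
          exact le_add_of_nonneg_right (by positivity)
  · obtain ⟨η, hη, hprog⟩ := exists_tendsto_zero_of_forall_pos (b := 2 - a / 2) (n₀ := 3)
      (p := fun n B => ∀ d, HasUpdateProgram n d a B) (by norm_num)
      (fun n hn x y hxy hx d => (hx d).mono hn hxy) fun δ hδ => by
        have hδω := hω.mono (by linarith : ω ≤ 5 / 2 - a / 2 + δ)
        obtain ⟨K, hK⟩ := hδω.exists_hasUpdateProgram ha ha' (by linarith)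
        rw [show 5 / 2 - a / 2 + δ - 1 / 2 = 2 - a / 2 + δ by ring] at hK
        exact ⟨K, fun n hn d => hK n d hn⟩
    refine ⟨9, η, le_rfl, hη, fun n d hn => (hprog n hn d).mono hn ?_⟩
    have h₁ : 0 ≤ (n : ℝ) ^ (ω - 1 / 2) := by positivity
    have h₂ : 0 ≤ (n : ℝ) ^ (2 - a / 2 + η n) := by positivity
    linarith

theorem mainTheorem3 (ω : ℝ) (hω : IsMatMulExponent ω) :
    -- Preprocessing.
    (∃ K : ℝ, ∀ n d : ℕ, 1 ≤ d → d ≤ n →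
      ∃ P : Prog (DSReg n d),
        ∀ (A : Matrix (Fin d) (Fin n) ℝ) (ε : ℝ) (f : ℝ → ℝ) (u v : Fin n → ℝ),
          A.rank = d → (∀ i, 0 < u i) →
          ImplementsInit P A ε f u v ∧
          ∀ σ : DSReg n d → ℝ, HoldsData σ A ε → HoldsInput σ u v →
            (P.cost f σ : ℝ) ≤ K * ((n : ℝ) ^ 2 * (d : ℝ) ^ (ω - 2))) ∧
    -- Updates.
    (∀ a : ℝ, 0 ≤ a → a ≤ dualExponent →
      ∃ (K : ℝ) (η : ℕ → ℝ), Filter.Tendsto η Filter.atTop (nhds 0) ∧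
      ∀ n d : ℕ, 3 ≤ n → 1 ≤ d → d ≤ n →
      ∃ P : Prog (DSReg n d),
        ∀ (A : Matrix (Fin d) (Fin n) ℝ) (ε : ℝ) (f : ℝ → ℝ),
          A.rank = d → 0 < ε → ε < 1 / 4 →
        ∀ (C : ℝ) (T : ℕ) (u v : ℕ → Fin n → ℝ) (s : ℕ → DSState n),
          0 ≤ C → (∀ i, 0 < u 0 i) → SmallChange C T u → IsExecution a ε A f T u v s →
          -- `P` implements every call of `Update`.
          (∀ t < T, ImplementsUpdate P a A ε f (s t) (u (t + 1)) (v (t + 1))) ∧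
          -- `σ t` is the memory at the start of the call number `t + 1`.
          ∀ σ : ℕ → DSReg n d → ℝ,
            (∀ t < T, HoldsData (σ t) A ε ∧ HoldsInput (σ t) (u (t + 1)) (v (t + 1)) ∧
              HoldsState (σ t) (s t)) →
            -- Total time, where calls that take the branch `k < n ^ a` are ignored.
            ∑ t ∈ rankCalls a ε T u s, (P.cost f (σ t) : ℝ)
              ≤ K * (T * (C / ε *
                  ((n : ℝ) ^ (ω - 1 / 2) + (n : ℝ) ^ (2 - a / 2 + η n)) * Real.logb 2 n)) ∧
            -- Time spent in an ignored call before that branch is entered.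
            ∀ t < T, ¬ RankBranch a ε (s t) (u (t + 1)) →
              (P.cost f (σ t) : ℝ) ≤ K * (n * Real.logb 2 n)) := by
  refine ⟨hω.exists_implementsInit, fun a ha ha' => ?_⟩
  obtain ⟨K, η, hK, hη, hprog⟩ := hω.exists_hasUpdateProgram_add ha ha'
  refine ⟨K, η, hη, fun n d hn _ _ => ?_⟩
  obtain ⟨P, hP⟩ := hprog n d hn
  refine ⟨P, fun A ε f hA hε hε' C T u v s hC h0 hu hs => ?_⟩
  obtain ⟨impl, time⟩ := hP A ε f hA hε hε' C T u v s hC h0 hu hs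
  refine ⟨impl, fun σ hσ => ?_⟩
  obtain ⟨total, ignored⟩ := time σ hσ
  refine ⟨total.trans_eq (by ring), fun t ht hr => (ignored t ht hr).trans ?_⟩
  have hlog : (n : ℝ) ≤ n * Real.logb 2 n :=
    le_mul_of_one_le_right n.cast_nonneg (one_lt_logb_two hn).le
  gcongr
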